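/- Let $n\ge 1$ and work over the field $\mathbb{C}(q)$ of rational functions in an indeterminate $q$. \emph{Algebras.} $\mathcal H_n$ is the Iwahori–Hecke algebra of $S_n$, with generators $T_1,\dots,T_{n-1}$ and relations $T_i^2=(q-1)T_i+q$, $T_iT_{i+1}T_i=T_{i+1}T_iT_{i+1}$, and $T_iT_j=T_jT_i$ for $|i-j|\ge 2$; $T_w=T_{i_1}\cdots T_{i_r}$ for a reduced expression $w=s_{i_1}\cdots s_{i_r}$. $\mathcal R_n$ is the generic mirabolic Hecke algebra, in Solomon's presentation: generators $T_0,\dots,T_{n-1}$, the above relations among $T_1,\dots,T_{n-1}$, and $T_0^2=(q-2)T_0+(q-1)$, $T_0T_i=T_iT_0$ for $i\ge2$, $T_0T_1T_0T_1=(q-1)(T_1T_0T_1+T_1T_0)-T_0T_1T_0$, $T_1T_0T_1T_0=(q-1)(T_1T_0T_1+T_0T_1)-T_0T_1T_0$. $\mathcal H_n(1,0)$ is the cyclotomic Hecke algebra with generators $X,T_1,\dots,T_{n-1}$, the Hecke relations among the $T_i$ with $i\ge1$, and $XT_i=T_iX$ for $i\ge2$, $XT_1XT_1=T_1XT_1X$,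 $(X-1)X=0$. The ideal $I_n^{(\varnothing,2)}$ is its two-sided ideal generated by $$(q+1)^{-1}(1-X+T_1-XT_1-T_1X+XT_1X-T_1XT_1+XT_1XT_1),$$ the central idempotent of $\mathcal H_2(1,0)$ belonging to the bipartition $(\varnothing,(2))$ (the zero ideal if $n=1$). \emph{Modules.} The content of the box in row $l$ and column $m$ of a Young diagram is $m-l$. For a partition $\theta$ of $k$, $V^\theta$ has a basis $v_T$ indexed by the standard tableaux $T$ of shape $\theta$, and $T_i$ ($1\le i\le k-1$) acts by $T_iv_T=qv_T$ if $i,i+1$ are in the same row of $T$, $T_iv_T=-v_T$ if they are in the same column, and $T_iv_T=a\,v_T+(1+a)v_{s_i(T)}$ otherwise, where $a=\frac{q-1}{1-q^{c}}$ and $c$ is the content of the box of $i$ minus the content of the box of $i+1$. For a bipartition $\mu=(\mu^1,\mu^2)$ of $n$, $M^\mu$ has a basis $v_U$ indexed by the standard bitableaux $U=(U^1,U^2)$ of shape $\mu$, with $Xv_U=v_U$ if $1\in U^1$ and $Xv_U=0$ if $1\in U^2$; if $i,i+1$ are in the same $U^j$, then $T_iv_U$ is given by the same three formulas; $T_iv_U=v_{s_i(U)}$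 if $i\in U^1$, $i+1\in U^2$; and $T_iv_U=(q-1)v_U+qv_{s_i(U)}$ if $i\in U^2$, $i+1\in U^1$. For $0\le k\le n$ and $\theta\vdash k$, Siegel's module is $$M_n^{\theta,k}=\mathcal H_n\otimes_{\mathcal H_{(k)}\otimes\mathcal H_{(n-k)}}(V^\theta\boxtimes\mathrm{sign}),$$ where $\mathcal H_{(k)}=\langle T_1,\dots,T_{k-1}\rangle$, $\mathcal H_{(n-k)}=\langle T_{k+1},\dots,T_{n-1}\rangle$ and in $\mathrm{sign}$ each generator $T_j$ acts by $-1$. On it $T_1,\dots,T_{n-1}\in\mathcal R_n$ act by left multiplication, and for $w\in S_n$ of minimal length in the coset $w(S_k\times S_{n-k})$ and $T$ a standard tableau of shape $\theta$, $$T_0(T_w\otimes v_T)=\begin{cases}(q-1)\,T_w\otimes v_T&\text{if }w^{-1}(1)\in\{1,\dots,k\},\\-T_w\otimes v_T&\text{otherwise.}\end{cases}$$ \textbf{Proposition.} There is an algebra isomorphism $\Phi:\mathcal R_n\to\mathcal H_n(1,0)/I_n^{(\varnothing,2)}$ with $\Phi(T_0)=qX-1$ and $\Phi(T_i)=T_i$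 for $1\le i\le n-1$. The formulas above define an $\mathcal H_k$-module $V^\theta$ for every $k\ge 0$ and $\theta\vdash k$, and, for all $0\le k\le n$ and $\theta\vdash k$, an $\mathcal R_n$-module $M_n^{\theta,k}$ and an $\mathcal H_n(1,0)/I_n^{(\varnothing,2)}$-module $M^{(\theta,1^{n-k})}$. There is an isomorphism of $\mathcal R_n$-modules $$M_n^{\theta,k}\;\simeq\;M^{(\theta,1^{n-k})}$$ (the right side being an $\mathcal R_n$-module through $\Phi$), which sends $T_w\otimes v_T$, for $w$ of minimal length in $w(S_k\times S_{n-k})$, to $v_{(U^1,U^2)}$. Here $U^1=w(T)$ has $w(l)$ in the box in which $T$ has $l$, for $1\le l\le k$, and $U^2$ is the single column with the entries $w(k+1),\dots,w(n)$ from top to bottom; this $(U^1,U^2)$ is a standard bitableau. The $\mathcal R_n$-modules $M_n^{\theta,k}$ ($0\le k\le n$, $\theta\vdash k$) are irreducible and pairwise non-isomorphic, and every irreducible $\mathcal R_n$-module is isomorphic to one of them. -/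

import Mathlib

open scoped TensorProduct

namespace Mirabolic

/-- The field `ℂ(q)` of rational functions in one indeterminate. -/
abbrev K : Type := RatFunc ℂ

/-- The indeterminate `q`. -/
noncomputable abbrev q : K := RatFunc.X

/-! ### Algebras given by generators and relations

An index `i : Fin (n - 1)` stands for the generator `T_{i+1}` and for the simple transposition
`s_{i+1}`; an element `a : Fin n` stands for the number `a + 1` of `{1, …, n}`. -/

/-- The relations among `T_1, …, T_{n-1}` in the Iwahori-Hecke algebra, stated for a family `t` of
elements of a `ℂ(q)`-algebra. -/
inductive HeckeRel {m : ℕ} {A : Type} [Ring A] [Algebra K A] (t : Fin m → A) : A → A → Prop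
  | quadratic (i : Fin m) : HeckeRel t (t i * t i) ((q - 1) • t i + algebraMap K A q)
  | braid (i j : Fin m) (h : (i : ℕ) + 1 = j) : HeckeRel t (t i * t j * t i) (t j * t i * t j)
  | comm (i j : Fin m) (h : (i : ℕ) + 2 ≤ j) : HeckeRel t (t i * t j) (t j * t i)

/-- The generic Iwahori-Hecke algebra `H_n` of `S_n`. -/
def Hecke (n : ℕ) : Type :=
  RingQuot (HeckeRel (fun i : Fin (n - 1) => FreeAlgebra.ι K i))

noncomputable instance (n : ℕ) : Ring (Hecke n) := inferInstanceAs (Ring (RingQuot _))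

noncomputable instance (n : ℕ) : Algebra K (Hecke n) := inferInstanceAs (Algebra K (RingQuot _))

/-- The projection from the free algebra on the generators to `H_n`. -/
noncomputable def Hecke.mk (n : ℕ) : FreeAlgebra K (Fin (n - 1)) →ₐ[K] Hecke n :=
  RingQuot.mkAlgHom K _

/-- The generator `T_{i+1}` of `H_n`. -/
noncomputable def Hecke.T {n : ℕ} (i : Fin (n - 1)) : Hecke n :=
  Hecke.mk n (FreeAlgebra.ι K i)

/-- The relations of the mirabolic Hecke algebra, for elements `t₀` (that is `T_0`) and
`t i` (that is `T_{i+1}`). -/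
inductive MirabolicRel {m : ℕ} {A : Type} [Ring A] [Algebra K A] (t₀ : A) (t : Fin m → A) :
    A → A → Prop
  | quadratic_zero : MirabolicRel t₀ t (t₀ * t₀) ((q - 2) • t₀ + algebraMap K A (q - 1))
  | hecke (a b : A) (h : HeckeRel t a b) : MirabolicRel t₀ t a b
  | zero_one (i : Fin m) (h : (i : ℕ) = 0) : MirabolicRel t₀ t (t₀ * t i * t₀ * t i)
      ((q - 1) • (t i * t₀ * t i + t i * t₀) - t₀ * t i * t₀)
  | one_zero (i : Fin m) (h : (i : ℕ) = 0) : MirabolicRel t₀ t (t i * t₀ * t i * t₀)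
      ((q - 1) • (t i * t₀ * t i + t₀ * t i) - t₀ * t i * t₀)
  | comm_zero (i : Fin m) (h : 1 ≤ (i : ℕ)) : MirabolicRel t₀ t (t₀ * t i) (t i * t₀)

/-- The generic mirabolic Hecke algebra `R_n` (for `n ≥ 1`), in Solomon's presentation with
generators `T_0` (the index `none`) and `T_1, …, T_{n-1}`. -/
def MirabolicHecke (n : ℕ) : Type :=
  RingQuot (MirabolicRel (FreeAlgebra.ι K none) (fun i : Fin (n - 1) => FreeAlgebra.ι K (some i)))

noncomputable instance (n : ℕ) : Ring (MirabolicHecke n) := inferInstanceAs (Ring (RingQuot _))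

noncomputable instance (n : ℕ) : Algebra K (MirabolicHecke n) := inferInstanceAs (Algebra K (RingQuot _))

/-- The projection from the free algebra on the generators to `R_n`. -/
noncomputable def MirabolicHecke.mk (n : ℕ) : FreeAlgebra K (Option (Fin (n - 1))) →ₐ[K] MirabolicHecke n :=
  RingQuot.mkAlgHom K _

/-- The generator `T_0` of `R_n`. -/
noncomputable def MirabolicHecke.T₀ (n : ℕ) : MirabolicHecke n :=
  MirabolicHecke.mk n (FreeAlgebra.ι K none)

/-- The generator `T_{i+1}` of `R_n`. -/
noncomputable def MirabolicHecke.T {n : ℕ} (i : Fin (n - 1)) : MirabolicHecke n :=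
  MirabolicHecke.mk n (FreeAlgebra.ι K (some i))

/-- The relations of the cyclotomic Hecke algebra with parameters `u = (u_1, …, u_r)`, for elements
`x` (that is `X`) and `t i` (that is `T_{i+1}`). -/
inductive CyclotomicRel (u : List ℂ) {m : ℕ} {A : Type} [Ring A] [Algebra K A] (x : A)
    (t : Fin m → A) : A → A → Prop
  | hecke (a b : A) (h : HeckeRel t a b) : CyclotomicRel u x t a b
  | comm (i : Fin m) (h : 1 ≤ (i : ℕ)) : CyclotomicRel u x t (x * t i) (t i * x)
  | braid (i : Fin m) (h : (i : ℕ) = 0) :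
      CyclotomicRel u x t (x * t i * x * t i) (t i * x * t i * x)
  | cyclotomic : CyclotomicRel u x t (u.map fun c => x - algebraMap K A (RatFunc.C c)).prod 0

/-- The generic cyclotomic Hecke algebra `H_n(u_1, …, u_r)` (for `n ≥ 1`), with generators `X`
(the index `none`) and `T_1, …, T_{n-1}`. -/
def CyclotomicHecke (n : ℕ) (u : List ℂ) : Type :=
  RingQuot (CyclotomicRel u (FreeAlgebra.ι K none)
    (fun i : Fin (n - 1) => FreeAlgebra.ι K (some i)))

noncomputable instance (n : ℕ) (u : List ℂ) : Ring (CyclotomicHecke n u) := inferInstanceAs (Ring (RingQuot _))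

noncomputable instance (n : ℕ) (u : List ℂ) : Algebra K (CyclotomicHecke n u) := inferInstanceAs (Algebra K (RingQuot _))

/-- The projection from the free algebra on the generators to `H_n(u_1, …, u_r)`. -/
noncomputable def CyclotomicHecke.mk (n : ℕ) (u : List ℂ) : FreeAlgebra K (Option (Fin (n - 1))) →ₐ[K] CyclotomicHecke n u :=
  RingQuot.mkAlgHom K _

/-- The generator `X` of `H_n(u_1, …, u_r)`. -/
noncomputable def CyclotomicHecke.X (n : ℕ) (u : List ℂ) : CyclotomicHecke n u :=
  CyclotomicHecke.mk n u (FreeAlgebra.ι K none)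

/-- The generator `T_{i+1}` of `H_n(u_1, …, u_r)`. -/
noncomputable def CyclotomicHecke.T {n : ℕ} {u : List ℂ} (i : Fin (n - 1)) :
    CyclotomicHecke n u :=
  CyclotomicHecke.mk n u (FreeAlgebra.ι K (some i))

/-- The formula, in terms of `x = X` and `t = T_1`, for the central idempotent of `H_2(1,0)`
belonging to the bipartition `(∅, (2))`. -/
noncomputable def idempotentFormula {A : Type} [Ring A] [Algebra K A] (x t : A) : A :=
  (q + 1)⁻¹ • (1 - x + t - x * t - t * x + x * t * x - t * x * t + x * t * x * t)

/-- The two-sided ideal `I_n^{(∅,(2))}` of `H_n(1,0)` generated by the image of that idempotent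
under `H_2(1,0) → H_n(1,0)`. It is zero for `n = 1`, when there is no `T_1`. -/
noncomputable def idealI (n : ℕ) : TwoSidedIdeal (CyclotomicHecke n [1, 0]) :=
  TwoSidedIdeal.span {y | ∃ i : Fin (n - 1), (i : ℕ) = 0 ∧
    y = idempotentFormula (CyclotomicHecke.X n [1, 0]) (CyclotomicHecke.T i)}

/-- The quotient `H_n(1,0) / I_n^{(∅,(2))}`. -/
abbrev CyclotomicQuotient (n : ℕ) : Type :=
  CyclotomicHecke n [1, 0] ⧸ (idealI n).asIdeal

/-- The projection `H_n(1,0) → H_n(1,0) / I_n^{(∅,(2))}`. -/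
noncomputable def toQuotient (n : ℕ) : CyclotomicHecke n [1, 0] →ₐ[K] CyclotomicQuotient n :=
  Ideal.Quotient.mkₐ K (idealI n).asIdeal

/-! ### The symmetric group -/

/-- The number `i + 1` in `{1, …, n}`, the smaller of the two that `s_{i+1}` exchanges. -/
def lo {n : ℕ} (i : Fin (n - 1)) : Fin n := ⟨i, by omega⟩

/-- The number `i + 2` in `{1, …, n}`, the larger of the two that `s_{i+1}` exchanges. -/
def hi {n : ℕ} (i : Fin (n - 1)) : Fin n := ⟨i + 1, by omega⟩

/-- The simple transposition `s_{i+1}`. -/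
def simple {n : ℕ} (i : Fin (n - 1)) : Equiv.Perm (Fin n) := Equiv.swap (lo i) (hi i)

/-- The Coxeter length of a permutation: the least length of a word in the simple transpositions
that represents it. -/
noncomputable def permLength {n : ℕ} (w : Equiv.Perm (Fin n)) : ℕ :=
  sInf {r | ∃ l : List (Fin (n - 1)), l.length = r ∧ (l.map simple).prod = w}

/-- `l` is a reduced expression of `w`. -/
def IsReducedWord {n : ℕ} (l : List (Fin (n - 1))) (w : Equiv.Perm (Fin n)) : Prop :=
  (l.map simple).prod = w ∧ l.length = permLength w

/-- `w` has minimal length in its coset `w (S_k × S_{n-k})`. -/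
def IsMinimalRep {n : ℕ} (k : ℕ) (w : Equiv.Perm (Fin n)) : Prop :=
  ∀ u : Equiv.Perm (Fin n), (∀ a, (u a : ℕ) < k ↔ (a : ℕ) < k) →
    permLength w ≤ permLength (w * u)

/-! ### Standard tableaux and seminormal representations

Partitions are given by their Young diagrams; the box `(r, c)` is in row `r` and column `c`, counted
from `0`. -/

/-- A filling of the diagram `θ` with the numbers `1, …, |θ|`, given by the function which sends a
number to its box, is a standard tableau. -/
structure IsStandard (θ : YoungDiagram) (f : Fin θ.card → ℕ × ℕ) : Prop where
  bijOn : Set.BijOn f Set.univ {c | c ∈ θ}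
  row_increasing : ∀ a b, (f a).1 = (f b).1 → (f a).2 < (f b).2 → a < b
  col_increasing : ∀ a b, (f a).2 = (f b).2 → (f a).1 < (f b).1 → a < b

/-- The standard tableaux of shape `θ`. -/
abbrev StandardTableau (θ : YoungDiagram) : Type := {f : Fin θ.card → ℕ × ℕ // IsStandard θ f}

/-- The content of a box: column minus row. -/
def content (c : ℕ × ℕ) : ℤ := (c.2 : ℤ) - c.1

/-- The space `V^θ` with basis the standard tableaux of shape `θ`. -/
abbrev V (θ : YoungDiagram) : Type := StandardTableau θ →₀ K

/-- The basis vector `v_T` of `V^θ`. -/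
noncomputable def v {θ : YoungDiagram} (T : StandardTableau θ) : V θ := Finsupp.single T 1

open Classical in
/-- The vector `v_f` for a filling `f`, read as `0` if `f` is not standard. -/
noncomputable def vecV (θ : YoungDiagram) (f : Fin θ.card → ℕ × ℕ) : V θ :=
  if h : IsStandard θ f then v ⟨f, h⟩ else 0

/-- The coefficient `(q - 1) / (1 - q ^ k)`. -/
noncomputable def seminormalCoeff (k : ℤ) : K := (q - 1) / (1 - q ^ k)

/-- The operator by which `T_{i+1}` acts on `V^θ`. -/
noncomputable def seminormalOp (θ : YoungDiagram) (i : Fin (θ.card - 1)) : V θ →ₗ[K] V θ :=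
  Finsupp.lift (V θ) K (StandardTableau θ) fun T =>
    if (T.1 (lo i)).1 = (T.1 (hi i)).1 then q • v T
    else if (T.1 (lo i)).2 = (T.1 (hi i)).2 then -v T
    else
      let a := seminormalCoeff (content (T.1 (lo i)) - content (T.1 (hi i)))
      a • v T + (1 + a) • vecV θ (T.1 ∘ simple i)

/-! ### The induced module -/

/-- The relations that turn `H_n ⊗_ℂ(q) V^θ` into the tensor product over `H_(k) ⊗ H_(n-k)` of `H_n`
with `V^θ ⊠ sign`, where `k = |θ|`: the generators `T_1, …, T_{k-1}` of `H_(k)` pass through the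
tensor sign to act on `V^θ`, the generators `T_{k+1}, …, T_{n-1}` of `H_(n-k)` pass through it to
act by `-1`. -/
noncomputable def balancing (n : ℕ) (θ : YoungDiagram) : Submodule (Hecke n) (Hecke n ⊗[K] V θ) :=
  Submodule.span (Hecke n)
    ({x | ∃ (h : Hecke n) (i : Fin (n - 1)) (j : Fin (θ.card - 1)) (u : V θ), (i : ℕ) = j ∧
        x = (h * Hecke.T i) ⊗ₜ[K] u - h ⊗ₜ[K] seminormalOp θ j u} ∪
     {x | ∃ (h : Hecke n) (i : Fin (n - 1)) (u : V θ), θ.card ≤ (i : ℕ) ∧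
        x = (h * Hecke.T i) ⊗ₜ[K] u - h ⊗ₜ[K] (-u)})

/-- The left `H_n`-module `H_n ⊗_{H_(k) ⊗ H_(n-k)} (V^θ ⊠ sign)`, where `k = |θ| ≤ n`. -/
abbrev Induced (n : ℕ) (θ : YoungDiagram) : Type := (Hecke n ⊗[K] V θ) ⧸ balancing n θ

/-- The element `h ⊗ u` of the induced module. -/
noncomputable def tens {n : ℕ} {θ : YoungDiagram} (h : Hecke n) (u : V θ) : Induced n θ :=
  Submodule.Quotient.mk (h ⊗ₜ[K] u)

/-- The element `T_{i_1} ⋯ T_{i_r} ⊗ v_T` of the induced module. If `l = (i_1, …, i_r)` is a reduced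
expression of `w`, this is `T_w ⊗ v_T`. -/
noncomputable def basisVec {n : ℕ} {θ : YoungDiagram} (l : List (Fin (n - 1)))
    (T : StandardTableau θ) : Induced n θ :=
  tens (l.map Hecke.T).prod (v T)

/-- `ρ` is the action of `R_n` on `M_n^{θ,k}`, where `k = |θ|`: the generators `T_1, …, T_{n-1}`
act as in the left `H_n`-module structure, and `T_0` acts on `T_w ⊗ v_T`, for `w` of minimal length
in its coset, by `q - 1` if `w⁻¹(1) ∈ {1, …, k}` and by `-1` otherwise. -/
structure IsSiegelAction {n : ℕ} [NeZero n] {θ : YoungDiagram}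
    (ρ : MirabolicHecke n →ₐ[K] Module.End K (Induced n θ)) : Prop where
  T_act : ∀ (i : Fin (n - 1)) (x : Induced n θ), ρ (MirabolicHecke.T i) x = Hecke.T i • x
  T₀_act : ∀ (w : Equiv.Perm (Fin n)) (l : List (Fin (n - 1))) (T : StandardTableau θ),
    IsMinimalRep θ.card w → IsReducedWord l w →
    ρ (MirabolicHecke.T₀ n) (basisVec l T) =
      if (w.symm 0 : ℕ) < θ.card then (q - 1) • basisVec l T else -basisVec l T

/-! ### Standard bitableaux and the modules of the cyclotomic Hecke algebra -/

/-- A filling of the pair of diagrams `μ = (μ 0, μ 1)` with the numbers `1, …, n`, given by the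
function which sends a number to the index of its diagram (`0` for the first one, `1` for the second
one) and its box, is a standard bitableau. -/
structure IsStandardBi (n : ℕ) (μ : Fin 2 → YoungDiagram) (f : Fin n → Fin 2 × (ℕ × ℕ)) :
    Prop where
  bijOn : Set.BijOn f Set.univ {c | c.2 ∈ μ c.1}
  row_increasing : ∀ a b, (f a).1 = (f b).1 → (f a).2.1 = (f b).2.1 → (f a).2.2 < (f b).2.2 → a < b
  col_increasing : ∀ a b, (f a).1 = (f b).1 → (f a).2.2 = (f b).2.2 → (f a).2.1 < (f b).2.1 → a < b

/-- The standard bitableaux of shape `μ` with `n` boxes. -/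
abbrev StandardBitableau (n : ℕ) (μ : Fin 2 → YoungDiagram) : Type :=
  {f : Fin n → Fin 2 × (ℕ × ℕ) // IsStandardBi n μ f}

/-- The content of a box of a pair of diagrams. -/
def biContent (c : Fin 2 × (ℕ × ℕ)) : ℤ := (c.1 : ℕ) + content c.2

/-- The space `M^μ` with basis the standard bitableaux of shape `μ`. -/
abbrev BiModule (n : ℕ) (μ : Fin 2 → YoungDiagram) : Type := StandardBitableau n μ →₀ K

/-- The basis vector `v_U` of `M^μ`. -/
noncomputable def vBi {n : ℕ} {μ : Fin 2 → YoungDiagram} (U : StandardBitableau n μ) :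
    BiModule n μ :=
  Finsupp.single U 1

open Classical in
/-- The vector `v_f` for a filling `f`, read as `0` if `f` is not standard. -/
noncomputable def vecBi (n : ℕ) (μ : Fin 2 → YoungDiagram) (f : Fin n → Fin 2 × (ℕ × ℕ)) :
    BiModule n μ :=
  if h : IsStandardBi n μ f then vBi ⟨f, h⟩ else 0

/-- `π` is the seminormal action of `H_n(1,0)` on `M^μ`. -/
structure IsArikiKoikeAction {n : ℕ} [NeZero n] {μ : Fin 2 → YoungDiagram}
    (π : CyclotomicHecke n [1, 0] →ₐ[K] Module.End K (BiModule n μ)) : Prop where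
  X_act : ∀ U : StandardBitableau n μ,
    π (CyclotomicHecke.X n [1, 0]) (vBi U) = if (U.1 0).1 = 0 then vBi U else 0
  T_act : ∀ (i : Fin (n - 1)) (U : StandardBitableau n μ),
    π (CyclotomicHecke.T i) (vBi U) =
      if (U.1 (lo i)).1 = (U.1 (hi i)).1 then
        if (U.1 (lo i)).2.1 = (U.1 (hi i)).2.1 then q • vBi U
        else if (U.1 (lo i)).2.2 = (U.1 (hi i)).2.2 then -vBi U
        else
          let a := seminormalCoeff (biContent (U.1 (lo i)) - biContent (U.1 (hi i)))
          a • vBi U + (1 + a) • vecBi n μ (U.1 ∘ simple i)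
      else if (U.1 (lo i)).1 = 0 then vecBi n μ (U.1 ∘ simple i)
      else (q - 1) • vBi U + q • vecBi n μ (U.1 ∘ simple i)

/-- The partition `1^m`, a single column with `m` boxes. -/
def column (m : ℕ) : YoungDiagram where
  cells := Finset.range m ×ˢ {0}
  isLowerSet := by
    rintro ⟨a, b⟩ ⟨c, d⟩ h hab
    obtain ⟨h1, h2⟩ := Prod.mk_le_mk.1 h
    simp only [Finset.coe_product, Finset.coe_range, Finset.coe_singleton, Set.mem_prod,
      Set.mem_Iio, Set.mem_singleton_iff] at hab ⊢
    omega

/-- The bipartition `(θ, 1^{n-k})` of `n`, where `k = |θ| ≤ n`. -/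
def columnShape (n : ℕ) (θ : YoungDiagram) : Fin 2 → YoungDiagram := ![θ, column (n - θ.card)]

/-- The filling of `(θ, 1^{n-k})` in which, for `1 ≤ l ≤ k`, the number `w(l)` stands in the box of
`θ` that contains `l` in `T`, and the column contains `w(k+1), …, w(n)` from top to bottom. -/
def imageFilling {n : ℕ} {θ : YoungDiagram} (w : Equiv.Perm (Fin n)) (T : StandardTableau θ) :
    Fin n → Fin 2 × (ℕ × ℕ) := fun a =>
  if h : (w.symm a : ℕ) < θ.card then (0, T.1 ⟨w.symm a, h⟩)
  else (1, ((w.symm a : ℕ) - θ.card, 0))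

/-! ### Modules from actions -/

/-- The `A`-module given by an action `ρ` of the algebra `A` on a vector space `M`. -/
def ModuleOf {A M : Type} [Ring A] [Algebra K A] [AddCommGroup M] [Module K M]
    (_ρ : A →ₐ[K] Module.End K M) : Type := M

section ModuleOf

variable {A M : Type} [Ring A] [Algebra K A] [AddCommGroup M] [Module K M]
  (ρ : A →ₐ[K] Module.End K M)

instance : AddCommGroup (ModuleOf ρ) := inferInstanceAs (AddCommGroup M)

noncomputable instance : Module A (ModuleOf ρ) :=
  letI : Module (Module.End K M) (ModuleOf ρ) := inferInstanceAs (Module (Module.End K M) M)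
  Module.compHom (ModuleOf ρ) ρ.toRingHom

/-- An element of `M`, seen in the `A`-module given by `ρ`. -/
def ModuleOf.of : M ≃+ ModuleOf ρ := AddEquiv.refl M

theorem ModuleOf.smul_of (a : A) (x : M) : a • ModuleOf.of ρ x = ModuleOf.of ρ (ρ a x) := rfl

end ModuleOf

end Mirabolic

open Mirabolic

namespace Mirabolic

/-! The isomorphism `Φ` is a change of generator. With `T_0 = qX - 1` the quadratic relation for
`T_0` says that `X` is idempotent. Modulo the quadratic relation of `T_1`, the relation for
`T_0T_1T_0T_1` is `q²` times the vanishing of the numerator of the idempotent, and the relation for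
`T_1T_0T_1T_0` is the same after an application of the braid relation. So the two algebras have
equivalent presentations (`IsCyclo.isMirabolic`, `IsMirabolic.isCyclo`).

All seminormal formulas are instances of one. A box of content `c` in the first component gets the
weight `q^c`, a box of the column gets the weight `0`. For consecutive numbers in boxes of weights
`a`, `b` the diagonal coefficient is `(q-1)b/(b-a)`, and `-1` if both weights vanish. This includes
the mixed cases, and the Hecke relations become rational identities in at most three weights
(`diagCoeff_braid` and its companions). The off-diagonal coefficient vanishes exactly where the
exchange would destroy standardness.

The Jucys-Murphy elements `L_1 = X`, `L_{i+1} = q⁻¹ T_i L_i T_i` are diagonal, with the weights as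
eigenvalues (`Admissible.jm_single`), and the weights determine the bitableau, including its shape
(`IsStandardBi.eq_of_wt`). Bitableaux of one shape are connected by exchanges with non-zero
coefficient (`Admissible.single_mem_of_shape`). Hence the modules `M^{(θ,1^{n-k})}` are irreducible
and pairwise non-isomorphic.

Siegel's module is identified with `M^{(θ,1^{n-k})}` by comparing universal properties. The vector
of a bitableau is obtained from one in which the column comes last by moving entries of `θ` to the
left, one generator at a time (`movedVec`), so `M^{(θ,1^{n-k})}` maps to every module in which `V^θ
⊠ sign` is realised (`exists_intertwiner_first`). For a minimal coset representative, each letter of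
a reduced word moves one entry of `θ` past one entry of the column, and this gives the explicit form
of the map.

For exhaustion, let `Q_j` be the product of the `1 - L_i` for `i ≤ j`, and let `j` be largest with
`Q_j ≠ 0` on a given non-zero module. On the image of `Q_j`, `T_1, …, T_{j-1}` act by `-1` because
of the ideal relation (`IsCyclo.colProj_mul_t`), `X` acts by `0` if `j > 0`, `L_{j+1}` acts by `1`
if `j < n`, and `T_{j+1}, …, T_{n-1}` give an action of a Hecke algebra of rank `n-j`. This image
receives a non-zero map from some `V^θ` (`exists_seminormal_map`), and a second universal property,
with the column first, turns it into a non-zero map out of `M^{(θ,1^j)}`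
(`exists_intertwiner_last`). Schur's lemma finishes the argument; semisimplicity is not needed
beforehand.

The existence of the map from `V^θ` is proved by induction on the rank, with the branching rule `Ind
V^μ = ⊕ V^λ` (`exists_branching`). Surjectivity there comes from Jucys-Murphy eigenvalues,
injectivity from the dimension formula `(k+1) f^μ = ∑ f^λ`, which is the differential property of
Young's lattice (`card_up_inter`, `sum_up`). -/

theorem q_ne_zero : (q : K) ≠ 0 := RatFunc.X_ne_zero

/-! ### Presentations -/

section Relations

variable {m : ℕ} {A : Type*} [Ring A] [Algebra K A]

/-- The family `t` satisfies the Hecke relations. -/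
structure IsHecke (t : Fin m → A) : Prop where
  quadratic : ∀ i, t i * t i = (q - 1) • t i + q • 1
  braid : ∀ i j : Fin m, (i : ℕ) + 1 = j → t i * t j * t i = t j * t i * t j
  comm : ∀ i j : Fin m, (i : ℕ) + 2 ≤ j → t i * t j = t j * t i

/-- The elements `x` and `t i` satisfy the relations of `H_n(1,0) / I`. -/
structure IsCyclo (x : A) (t : Fin m → A) : Prop where
  hecke : IsHecke t
  idem : x * x = x
  comm : ∀ i : Fin m, 1 ≤ (i : ℕ) → x * t i = t i * x
  braid : ∀ i : Fin m, (i : ℕ) = 0 → x * t i * x * t i = t i * x * t i * x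
  ideal : ∀ i : Fin m, (i : ℕ) = 0 →
    1 - x + t i - x * t i - t i * x + x * t i * x - t i * x * t i + x * t i * x * t i = 0

/-- The elements `t₀` and `t i` satisfy the relations of the mirabolic Hecke algebra. -/
structure IsMirabolic (t₀ : A) (t : Fin m → A) : Prop where
  hecke : IsHecke t
  quadratic_zero : t₀ * t₀ = (q - 2) • t₀ + (q - 1) • 1
  zero_one : ∀ i : Fin m, (i : ℕ) = 0 → t₀ * t i * t₀ * t i =
    (q - 1) • (t i * t₀ * t i + t i * t₀) - t₀ * t i * t₀
  one_zero : ∀ i : Fin m, (i : ℕ) = 0 → t i * t₀ * t i * t₀ =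
    (q - 1) • (t i * t₀ * t i + t₀ * t i) - t₀ * t i * t₀
  comm_zero : ∀ i : Fin m, 1 ≤ (i : ℕ) → t₀ * t i = t i * t₀

variable {B : Type*} [Ring B] [Algebra K B]

theorem IsHecke.map {t : Fin m → A} (h : IsHecke t) (f : A →ₐ[K] B) :
    IsHecke fun i => f (t i) where
  quadratic i := by simp only [← map_mul, h.quadratic]; simp
  braid i j hij := by simp only [← map_mul, h.braid i j hij]
  comm i j hij := by simp only [← map_mul, h.comm i j hij]

theorem IsCyclo.map {x : A} {t : Fin m → A} (h : IsCyclo x t) (f : A →ₐ[K] B) :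
    IsCyclo (f x) fun i => f (t i) where
  hecke := h.hecke.map f
  idem := by rw [← map_mul, h.idem]
  comm i hi := by simp only [← map_mul, h.comm i hi]
  braid i hi := by simp only [← map_mul, h.braid i hi]
  ideal i hi := by simpa using congrArg f (h.ideal i hi)

end Relations

/-! ### Equivalence of the two presentations in rank two -/

section Generic

variable {F A : Type*} [Field F] [Ring A] [Algebra F A] {p : F} {x t t₀ : A}

/-- After expansion and reduction of `t²`, the difference of the two sides is exactly `p²` times the
left side of `h1`. -/
theorem zero_one_of_ideal (ht : t * t = (p - 1) • t + p • 1)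
    (h1 : 1 - x + t - x * t - t * x + x * t * x - t * x * t + x * t * x * t = 0) :
    (p • x - 1) * t * (p • x - 1) * t =
      (p - 1) • (t * (p • x - 1) * t + t * (p • x - 1)) - (p • x - 1) * t * (p • x - 1) := by
  simp only [mul_sub, sub_mul, mul_add, smul_mul_assoc, mul_smul_comm, mul_one, one_mul,
    mul_assoc, ht] at h1 ⊢
  linear_combination (norm := module) (p ^ 2 : F) • h1

/-- The mirror image: in `h1` the last term has already been rewritten by the braid relation. -/
theorem one_zero_of_ideal (ht : t * t = (p - 1) • t + p • 1)
    (h1 : 1 - x + t - x * t - t * x + x * t * x - t * x * t + t * x * t * x = 0) :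
    t * (p • x - 1) * t * (p • x - 1) =
      (p - 1) • (t * (p • x - 1) * t + (p • x - 1) * t) - (p • x - 1) * t * (p • x - 1) := by
  simp only [mul_sub, sub_mul, smul_mul_assoc, mul_smul_comm, mul_one, one_mul,
    mul_assoc, ht, add_mul] at h1 ⊢
  linear_combination (norm := module) (p ^ 2 : F) • h1

theorem quadratic_zero_of_idem (hx : x * x = x) :
    (p • x - 1) * (p • x - 1) = (p - 2) • (p • x - 1) + (p - 1) • (1 : A) := by
  simp only [mul_sub, sub_mul, smul_mul_assoc, mul_smul_comm, hx, mul_one, one_mul]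
  module

/-- The roots `p - 1` and `-1` of the quadratic relation of `t₀` correspond to the roots `1` and `0`
of idempotency. -/
theorem idem_of_quadratic_zero (hp : p ≠ 0) (h : t₀ * t₀ = (p - 2) • t₀ + (p - 1) • 1) :
    (p⁻¹ • (t₀ + 1)) * (p⁻¹ • (t₀ + 1)) = p⁻¹ • (t₀ + 1) := by
  simp only [mul_add, add_mul, smul_mul_assoc, mul_smul_comm, h, mul_one, one_mul]
  match_scalars <;> field_simp <;> ring

/-- The right sides of `h1` and `h2` share their terms of higher degree, so the difference of the
two relations is `p²` times the braid relation for `p⁻¹(t₀ + 1)`. -/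
theorem braid_of_mirabolic (hp : p ≠ 0)
    (h1 : t₀ * t * t₀ * t = (p - 1) • (t * t₀ * t + t * t₀) - t₀ * t * t₀)
    (h2 : t * t₀ * t * t₀ = (p - 1) • (t * t₀ * t + t₀ * t) - t₀ * t * t₀)
    (ht : t * t = (p - 1) • t + p • 1) :
    (p⁻¹ • (t₀ + 1)) * t * (p⁻¹ • (t₀ + 1)) * t = t * (p⁻¹ • (t₀ + 1)) * t * (p⁻¹ • (t₀ + 1)) := by
  simp only [add_mul, mul_add, smul_mul_assoc, mul_smul_comm, mul_one, one_mul,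
    mul_assoc, ht] at h1 h2 ⊢
  linear_combination (norm := skip) (p⁻¹ ^ 2 : F) • (h1 - h2)
  match_scalars <;> field_simp <;> ring

theorem ideal_of_mirabolic (hp : p ≠ 0)
    (h1 : t₀ * t * t₀ * t = (p - 1) • (t * t₀ * t + t * t₀) - t₀ * t * t₀)
    (ht : t * t = (p - 1) • t + p • 1) (hx : x = p⁻¹ • (t₀ + 1)) :
    1 - x + t - x * t - t * x + x * t * x - t * x * t + x * t * x * t = 0 := by
  subst hx
  simp only [add_mul, mul_add, smul_mul_assoc, mul_smul_comm, mul_one, one_mul,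
    mul_assoc, ht] at h1 ⊢
  linear_combination (norm := skip) (p⁻¹ ^ 2 : F) • h1
  match_scalars <;> field_simp <;> ring

end Generic

section Relations

variable {m : ℕ} {A : Type*} [Ring A] [Algebra K A]

theorem IsCyclo.isMirabolic {x : A} {t : Fin m → A} (h : IsCyclo x t) :
    IsMirabolic (q • x - 1) t where
  hecke := h.hecke
  quadratic_zero := quadratic_zero_of_idem h.idem
  zero_one i hi := zero_one_of_ideal (h.hecke.quadratic i) (h.ideal i hi)
  one_zero i hi := one_zero_of_ideal (h.hecke.quadratic i) (h.braid i hi ▸ h.ideal i hi)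
  comm_zero i hi := by
    simp only [sub_mul, mul_sub, smul_mul_assoc, mul_smul_comm, h.comm i hi, one_mul, mul_one]

theorem IsMirabolic.isCyclo {t₀ : A} {t : Fin m → A} (h : IsMirabolic t₀ t) :
    IsCyclo ((q⁻¹ : K) • (t₀ + 1)) t where
  hecke := h.hecke
  idem := idem_of_quadratic_zero q_ne_zero h.quadratic_zero
  comm i hi := by
    simp only [add_mul, mul_add, smul_mul_assoc, mul_smul_comm, h.comm_zero i hi, one_mul, mul_one]
  braid i hi := braid_of_mirabolic q_ne_zero (h.zero_one i hi) (h.one_zero i hi)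
    (h.hecke.quadratic i)
  ideal i hi := ideal_of_mirabolic q_ne_zero (h.zero_one i hi) (h.hecke.quadratic i) rfl

end Relations

/-! ### Universal properties of the algebras and the isomorphism `Φ` -/

section Lifts

theorem heckeRel_of {m : ℕ} {A : Type} [Ring A] [Algebra K A] {t : Fin m → A}
    (h : ∀ a b, HeckeRel t a b → a = b) : IsHecke t where
  quadratic i := by
    rw [h _ _ (.quadratic i), Algebra.algebraMap_eq_smul_one]
  braid i j hij := h _ _ (.braid i j hij)
  comm i j hij := h _ _ (.comm i j hij)

theorem HeckeRel.map_eq {m : ℕ} {A B : Type} [Ring A] [Algebra K A] [Ring B] [Algebra K B]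
    (f : A →ₐ[K] B) {t : Fin m → A} (h : IsHecke fun i => f (t i)) {a b : A}
    (hab : HeckeRel t a b) : f a = f b := by
  cases hab with
  | quadratic i => simpa [Algebra.algebraMap_eq_smul_one] using h.quadratic i
  | braid i j hij => simpa using h.braid i j hij
  | comm i j hij => simpa using h.comm i j hij

theorem HeckeRel.mapRel {m : ℕ} {A B : Type} [Ring A] [Algebra K A] [Ring B] [Algebra K B]
    (f : A →ₐ[K] B) {t : Fin m → A} {a b : B} (hab : HeckeRel (fun i => f (t i)) a b) :
    ∃ a' b', HeckeRel t a' b' ∧ f a' = a ∧ f b' = b := by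
  cases hab with
  | quadratic i => exact ⟨_, _, .quadratic i, by simp, by simp⟩
  | braid i j hij => exact ⟨_, _, .braid i j hij, by simp, by simp⟩
  | comm i j hij => exact ⟨_, _, .comm i j hij, by simp, by simp⟩

variable {n : ℕ}

theorem Hecke.isHecke : IsHecke (Hecke.T : Fin (n - 1) → Hecke n) := by
  refine heckeRel_of fun a b hab => ?_
  obtain ⟨a', b', h, rfl, rfl⟩ := HeckeRel.mapRel (Hecke.mk n) hab
  exact RingQuot.mkAlgHom_rel K h

theorem CyclotomicHecke.isHecke :
    IsHecke (CyclotomicHecke.T : Fin (n - 1) → CyclotomicHecke n [1, 0]) := by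
  refine heckeRel_of fun a b hab => ?_
  obtain ⟨a', b', h, rfl, rfl⟩ := HeckeRel.mapRel (CyclotomicHecke.mk n [1, 0]) hab
  exact RingQuot.mkAlgHom_rel K (CyclotomicRel.hecke _ _ h)

theorem MirabolicHecke.isMirabolic :
    IsMirabolic (MirabolicHecke.T₀ n) (MirabolicHecke.T : Fin (n - 1) → MirabolicHecke n) where
  hecke := by
    refine heckeRel_of fun a b hab => ?_
    obtain ⟨a', b', h, rfl, rfl⟩ := HeckeRel.mapRel (MirabolicHecke.mk n) hab
    exact RingQuot.mkAlgHom_rel K (MirabolicRel.hecke _ _ h)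
  quadratic_zero := by
    have : MirabolicHecke.mk n _ = MirabolicHecke.mk n _ :=
      RingQuot.mkAlgHom_rel K MirabolicRel.quadratic_zero
    simp only [map_mul, map_add, map_smul, map_one, Algebra.algebraMap_eq_smul_one] at this
    exact this
  zero_one i hi := by
    have : MirabolicHecke.mk n _ = MirabolicHecke.mk n _ :=
      RingQuot.mkAlgHom_rel K (MirabolicRel.zero_one i hi)
    simp only [map_mul, map_add, map_smul, map_sub] at this
    exact this
  one_zero i hi := by
    have : MirabolicHecke.mk n _ = MirabolicHecke.mk n _ :=
      RingQuot.mkAlgHom_rel K (MirabolicRel.one_zero i hi)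
    simp only [map_mul, map_add, map_smul, map_sub] at this
    exact this
  comm_zero i hi := by
    have : MirabolicHecke.mk n _ = MirabolicHecke.mk n _ :=
      RingQuot.mkAlgHom_rel K (MirabolicRel.comm_zero i hi)
    simp only [map_mul] at this
    exact this

/-- The image of `X` in `H_n(1,0) / I`. -/
noncomputable def quotX (n : ℕ) : CyclotomicQuotient n := toQuotient n (CyclotomicHecke.X n [1, 0])

/-- The image of `T_{i+1}` in `H_n(1,0) / I`. -/
noncomputable def quotT (i : Fin (n - 1)) : CyclotomicQuotient n :=
  toQuotient n (CyclotomicHecke.T i)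

theorem q_add_one_ne_zero : (q + 1 : K) ≠ 0 := by
  intro h
  have h1 : (algebraMap (Polynomial ℂ) K) (Polynomial.X + 1) = 0 := by
    simpa [RatFunc.algebraMap_X] using h
  rw [map_eq_zero_iff _ (RatFunc.algebraMap_injective ℂ)] at h1
  have := congrArg (Polynomial.eval 0) h1
  simp at this

theorem isCyclo_quot : IsCyclo (quotX n) (quotT : Fin (n - 1) → CyclotomicQuotient n) where
  hecke := CyclotomicHecke.isHecke.map (toQuotient n)
  idem := by
    have := RingQuot.mkAlgHom_rel K (CyclotomicRel.cyclotomic (u := [1, 0])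
      (x := FreeAlgebra.ι K none) (t := fun i : Fin (n - 1) => FreeAlgebra.ι K (some i)))
    simp only [List.map_cons, List.map_nil, List.prod_cons, List.prod_nil, map_one, map_zero,
      sub_zero, mul_one, map_mul, map_sub] at this
    have h2 : (CyclotomicHecke.X n [1, 0] - 1) * CyclotomicHecke.X n [1, 0] = 0 := this
    have h3 := congrArg (toQuotient n) h2
    simp only [map_mul, map_sub, map_zero, sub_mul, one_mul] at h3
    exact sub_eq_zero.1 h3
  comm i hi := by
    have := RingQuot.mkAlgHom_rel K (CyclotomicRel.comm (u := [1, 0])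
      (x := FreeAlgebra.ι K none) (t := fun i : Fin (n - 1) => FreeAlgebra.ι K (some i)) i hi)
    have h2 := congrArg (toQuotient n) this
    simp only [map_mul] at h2
    exact h2
  braid i hi := by
    have := RingQuot.mkAlgHom_rel K (CyclotomicRel.braid (u := [1, 0])
      (x := FreeAlgebra.ι K none) (t := fun i : Fin (n - 1) => FreeAlgebra.ι K (some i)) i hi)
    have h2 := congrArg (toQuotient n) this
    simp only [map_mul] at h2
    exact h2
  ideal i hi := by
    have h1 : idempotentFormula (CyclotomicHecke.X n [1, 0]) (CyclotomicHecke.T i) ∈ idealI n :=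
      TwoSidedIdeal.subset_span ⟨i, hi, rfl⟩
    have h2 : toQuotient n (idempotentFormula (CyclotomicHecke.X n [1, 0]) (CyclotomicHecke.T i))
        = 0 := Ideal.Quotient.eq_zero_iff_mem.2 h1
    rw [idempotentFormula, map_smul] at h2
    have h3 := (smul_eq_zero.1 h2).resolve_left (inv_ne_zero q_add_one_ne_zero)
    simp only [map_mul, map_add, map_sub, map_one] at h3
    exact h3

variable {A : Type} [Ring A] [Algebra K A]

theorem exists_heckeLift {t : Fin (n - 1) → A} (h : IsHecke t) :
    ∃ f : Hecke n →ₐ[K] A, ∀ i, f (Hecke.T i) = t i := by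
  have key : ∀ ⦃a b⦄, HeckeRel (fun i : Fin (n - 1) => FreeAlgebra.ι K i) a b →
      FreeAlgebra.lift K t a = FreeAlgebra.lift K t b := fun a b hab =>
    HeckeRel.map_eq _ (by simpa using h) hab
  refine ⟨RingQuot.liftAlgHom K ⟨FreeAlgebra.lift K t, key⟩, fun i => ?_⟩
  exact (RingQuot.liftAlgHom_mkAlgHom_apply _ _ key _).trans (FreeAlgebra.lift_ι_apply _ _)

theorem exists_mirabolicLift {t₀ : A} {t : Fin (n - 1) → A} (h : IsMirabolic t₀ t) :
    ∃ f : MirabolicHecke n →ₐ[K] A, f (MirabolicHecke.T₀ n) = t₀ ∧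
      ∀ i, f (MirabolicHecke.T i) = t i := by
  let g : Option (Fin (n - 1)) → A := fun o => o.elim t₀ t
  have key : ∀ ⦃a b⦄, MirabolicRel (FreeAlgebra.ι K none)
      (fun i : Fin (n - 1) => FreeAlgebra.ι K (some i)) a b →
      FreeAlgebra.lift K g a = FreeAlgebra.lift K g b := by
    intro a b hab
    cases hab with
    | quadratic_zero =>
      simpa [g, Algebra.algebraMap_eq_smul_one, sub_smul] using h.quadratic_zero
    | hecke a b hab => exact HeckeRel.map_eq _ (by simpa [g] using h.hecke) hab
    | zero_one i hi => simpa [g] using h.zero_one i hi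
    | one_zero i hi => simpa [g] using h.one_zero i hi
    | comm_zero i hi => simpa [g] using h.comm_zero i hi
  refine ⟨RingQuot.liftAlgHom K ⟨FreeAlgebra.lift K g, key⟩, ?_, fun i => ?_⟩ <;>
  exact (RingQuot.liftAlgHom_mkAlgHom_apply _ _ key _).trans (FreeAlgebra.lift_ι_apply _ _)

theorem exists_quotLift {x : A} {t : Fin (n - 1) → A} (h : IsCyclo x t) :
    ∃ f : CyclotomicQuotient n →ₐ[K] A, f (quotX n) = x ∧ ∀ i, f (quotT i) = t i := by
  let g : Option (Fin (n - 1)) → A := fun o => o.elim x t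
  have key : ∀ ⦃a b⦄, CyclotomicRel [1, 0] (FreeAlgebra.ι K none)
      (fun i : Fin (n - 1) => FreeAlgebra.ι K (some i)) a b →
      FreeAlgebra.lift K g a = FreeAlgebra.lift K g b := by
    intro a b hab
    cases hab with
    | hecke a b hab => exact HeckeRel.map_eq _ (by simpa [g] using h.hecke) hab
    | comm i hi => simpa [g] using h.comm i hi
    | braid i hi => simpa [g] using h.braid i hi
    | cyclotomic => simpa [g, sub_mul, sub_eq_zero] using h.idem
  let F : CyclotomicHecke n [1, 0] →ₐ[K] A :=
    RingQuot.liftAlgHom K ⟨FreeAlgebra.lift K g, key⟩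
  have hX : F (CyclotomicHecke.X n [1, 0]) = x :=
    (RingQuot.liftAlgHom_mkAlgHom_apply _ _ key _).trans (FreeAlgebra.lift_ι_apply _ _)
  have hT : ∀ i, F (CyclotomicHecke.T i) = t i := fun i =>
    (RingQuot.liftAlgHom_mkAlgHom_apply _ _ key _).trans (FreeAlgebra.lift_ι_apply _ _)
  have hI : idealI n ≤ TwoSidedIdeal.ker F := by
    refine TwoSidedIdeal.span_le.2 ?_
    rintro _ ⟨i, hi, rfl⟩
    rw [SetLike.mem_coe, TwoSidedIdeal.mem_ker, idempotentFormula, map_smul]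
    simp only [map_mul, map_add, map_sub, map_one, hX, hT]
    rw [h.ideal i hi, smul_zero]
  refine ⟨Ideal.Quotient.liftₐ _ F fun a ha => (TwoSidedIdeal.mem_ker F).1 (hI ha), ?_, fun i => ?_⟩
  · exact hX
  · exact hT i

theorem quot_algHom_ext {B : Type*} [Semiring B] [Algebra K B] {f g : CyclotomicQuotient n →ₐ[K] B}
    (hX : f (quotX n) = g (quotX n)) (hT : ∀ i, f (quotT i) = g (quotT i)) : f = g := by
  refine Ideal.Quotient.algHom_ext K ?_
  refine RingQuot.ringQuot_ext' K _ _ (FreeAlgebra.hom_ext (funext fun o => ?_))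
  cases o with
  | none => exact hX
  | some i => exact hT i

theorem mirabolic_algHom_ext {B : Type*} [Semiring B] [Algebra K B] {f g : MirabolicHecke n →ₐ[K] B}
    (h0 : f (MirabolicHecke.T₀ n) = g (MirabolicHecke.T₀ n))
    (hT : ∀ i, f (MirabolicHecke.T i) = g (MirabolicHecke.T i)) : f = g := by
  refine RingQuot.ringQuot_ext' K _ _ (FreeAlgebra.hom_ext (funext fun o => ?_))
  cases o with
  | none => exact h0
  | some i => exact hT i

theorem exists_mirabolicEquiv (n : ℕ) : ∃ Φ : MirabolicHecke n ≃ₐ[K] CyclotomicQuotient n,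
    Φ (MirabolicHecke.T₀ n) = q • quotX n - 1 ∧ ∀ i, Φ (MirabolicHecke.T i) = quotT i := by
  obtain ⟨f, hf0, hfT⟩ := exists_mirabolicLift (isCyclo_quot (n := n)).isMirabolic
  obtain ⟨g, hgX, hgT⟩ := exists_quotLift (MirabolicHecke.isMirabolic (n := n)).isCyclo
  refine ⟨AlgEquiv.ofAlgHom f g (quot_algHom_ext ?_ ?_) (mirabolic_algHom_ext ?_ ?_), hf0, hfT⟩
  · change f (g (quotX n)) = quotX n
    rw [hgX, map_smul, map_add, hf0, map_one, sub_add_cancel, smul_smul,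
      inv_mul_cancel₀ q_ne_zero, one_smul]
  · simp [hgT, hfT]
  · change g (f (MirabolicHecke.T₀ n)) = MirabolicHecke.T₀ n
    rw [hf0, map_sub, map_smul, hgX, map_one, smul_smul, mul_inv_cancel₀ q_ne_zero, one_smul,
      add_sub_cancel_right]
  · simp [hgT, hfT]

end Lifts

/-! ### Simple transpositions -/

section Simple

variable {n : ℕ}

theorem lo_lt_hi (i : Fin (n - 1)) : lo i < hi i := Fin.lt_def.2 (Nat.lt_succ_self _)

@[simp] theorem simple_lo (i : Fin (n - 1)) : simple i (lo i) = hi i := Equiv.swap_apply_left _ _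

@[simp] theorem simple_hi (i : Fin (n - 1)) : simple i (hi i) = lo i := Equiv.swap_apply_right _ _

theorem simple_of_ne {i : Fin (n - 1)} {a : Fin n} (h1 : a ≠ lo i) (h2 : a ≠ hi i) :
    simple i a = a := Equiv.swap_apply_of_ne_of_ne h1 h2

theorem simple_mul_self (i : Fin (n - 1)) : simple i * simple i = 1 := Equiv.swap_mul_self _ _

@[simp] theorem simple_simple (i : Fin (n - 1)) (a : Fin n) : simple i (simple i a) = a := by
  rw [← Equiv.Perm.mul_apply, simple_mul_self, Equiv.Perm.one_apply]

theorem comp_simple_simple {B : Type*} (f : Fin n → B) (i : Fin (n - 1)) :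
    (f ∘ simple i) ∘ simple i = f := by
  funext a; simp

theorem coe_lo (i : Fin (n - 1)) : ((lo i : Fin n) : ℕ) = i := rfl

theorem coe_hi (i : Fin (n - 1)) : ((hi i : Fin n) : ℕ) = i + 1 := rfl

theorem lo_eq_hi {i j : Fin (n - 1)} (h : (i : ℕ) + 1 = j) : lo j = hi i :=
  Fin.ext (by rw [coe_lo, coe_hi, h])

theorem coe_simple (i : Fin (n - 1)) (a : Fin n) :
    ((simple i a : Fin n) : ℕ) = if (a : ℕ) = i then (i : ℕ) + 1 else
      if (a : ℕ) = i + 1 then (i : ℕ) else a := by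
  rw [simple, Equiv.swap_apply_def]
  simp only [Fin.ext_iff, coe_lo, coe_hi]
  split_ifs <;> simp_all [coe_lo, coe_hi]

/-- The only pair whose order is changed by a simple transposition is the pair that it exchanges. -/
theorem lt_of_simple_lt {i : Fin (n - 1)} {a b : Fin n} (h : simple i a < simple i b)
    (hne : ¬(simple i a = lo i ∧ simple i b = hi i)) : a < b := by
  simp only [Fin.lt_def, Fin.ext_iff, coe_simple, coe_lo, coe_hi] at *
  grind

theorem simple_comm {i j : Fin (n - 1)} (h : (i : ℕ) + 2 ≤ j) (a : Fin n) :
    simple i (simple j a) = simple j (simple i a) := by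
  simp only [Fin.ext_iff, coe_simple]
  grind

theorem simple_braid {i j : Fin (n - 1)} (h : (i : ℕ) + 1 = j) (a : Fin n) :
    simple i (simple j (simple i a)) = simple j (simple i (simple j a)) := by
  simp only [Fin.ext_iff, coe_simple]
  grind

end Simple

/-! ### Standard bitableaux -/

/-- A box of a pair of diagrams. -/
abbrev Box : Type := Fin 2 × (ℕ × ℕ)

section Standard

variable {n : ℕ} {μ : Fin 2 → YoungDiagram} {f : Fin n → Box}

theorem IsStandardBi.injective (h : IsStandardBi n μ f) : Function.Injective f :=
  Set.injOn_univ.1 h.bijOn.injOn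

theorem IsStandardBi.mem (h : IsStandardBi n μ f) (a : Fin n) : (f a).2 ∈ μ (f a).1 :=
  h.bijOn.mapsTo (Set.mem_univ a)

theorem IsStandardBi.exists_eq (h : IsStandardBi n μ f) {c : Box} (hc : c.2 ∈ μ c.1) :
    ∃ a, f a = c := by
  obtain ⟨a, -, ha⟩ := h.bijOn.surjOn hc
  exact ⟨a, ha⟩

/-- The corner box in the row of `a` and the column of `b` belongs to the diagram; entries increase
along the row to it and then down the column from it. -/
theorem IsStandardBi.mono (h : IsStandardBi n μ f) {a b : Fin n} (h1 : (f a).1 = (f b).1)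
    (h2 : (f a).2.1 ≤ (f b).2.1) (h3 : (f a).2.2 ≤ (f b).2.2) : a ≤ b := by
  have hm : ((f a).2.1, (f b).2.2) ∈ μ (f b).1 :=
    (μ (f b).1).up_left_mem h2 le_rfl (h.mem b)
  obtain ⟨m, hm⟩ := h.exists_eq (c := ((f b).1, ((f a).2.1, (f b).2.2))) hm
  have h4 : a ≤ m := by
    rcases h3.eq_or_lt with h3 | h3
    · refine (h.injective ?_).le
      rw [hm, ← h3, ← h1]
    · exact (h.row_increasing a m (by rw [hm, h1]) (by rw [hm]) (by rw [hm]; exact h3)).le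
  have h5 : m ≤ b := by
    rcases h2.eq_or_lt with h2 | h2
    · refine (h.injective ?_).le
      rw [hm, h2]
    · exact (h.col_increasing m b (by rw [hm]) (by rw [hm]) (by rw [hm]; exact h2)).le
  exact h4.trans h5

theorem IsStandardBi.exists_le (h : IsStandardBi n μ f) (b : Fin n) {r c : ℕ}
    (h2 : r ≤ (f b).2.1) (h3 : c ≤ (f b).2.2) : ∃ a ≤ b, f a = ((f b).1, (r, c)) := by
  obtain ⟨a, ha⟩ := h.exists_eq (c := ((f b).1, (r, c)))
    ((μ (f b).1).up_left_mem h2 h3 (h.mem b))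
  exact ⟨a, h.mono (by rw [ha]) (by rw [ha]; exact h2) (by rw [ha]; exact h3), ha⟩

/-- Consecutive numbers in the same row are in adjacent boxes. -/
theorem IsStandardBi.row_adjacent (h : IsStandardBi n μ f) {i : Fin (n - 1)}
    (h1 : (f (lo i)).1 = (f (hi i)).1) (h2 : (f (lo i)).2.1 = (f (hi i)).2.1) :
    (f (hi i)).2.2 = (f (lo i)).2.2 + 1 := by
  have h3 : (f (lo i)).2.2 < (f (hi i)).2.2 := by
    by_contra h3
    exact absurd (h.mono h1.symm h2.ge (not_lt.1 h3)) (not_le.2 (lo_lt_hi i))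
  by_contra h4
  -- The entry of the box just right of `lo i` would lie strictly between two consecutive numbers.
  obtain ⟨m, hm, hm'⟩ := h.exists_le (hi i) (r := (f (lo i)).2.1) (c := (f (lo i)).2.2 + 1) h2.le h3
  have h5 : lo i ≤ m := h.mono (by rw [hm', h1]) (by rw [hm']) (by rw [hm']; exact Nat.le_succ _)
  have h6 : m ≠ lo i := by rintro rfl; have := congrArg (fun x => x.2.2) hm'; simp at this
  have h7 : m ≠ hi i := by rintro rfl; exact h4 (congrArg (fun x => x.2.2) hm')
  simp only [Fin.le_def, Fin.ext_iff, coe_lo, coe_hi, Ne] at *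
  omega

/-- Consecutive numbers in the same column are in adjacent boxes. -/
theorem IsStandardBi.col_adjacent (h : IsStandardBi n μ f) {i : Fin (n - 1)}
    (h1 : (f (lo i)).1 = (f (hi i)).1) (h2 : (f (lo i)).2.2 = (f (hi i)).2.2) :
    (f (hi i)).2.1 = (f (lo i)).2.1 + 1 := by
  have h3 : (f (lo i)).2.1 < (f (hi i)).2.1 := by
    by_contra h3
    exact absurd (h.mono h1.symm (not_lt.1 h3) h2.ge) (not_le.2 (lo_lt_hi i))
  by_contra h4
  obtain ⟨m, hm, hm'⟩ := h.exists_le (hi i) (r := (f (lo i)).2.1 + 1) (c := (f (lo i)).2.2) h3 h2.le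
  have h5 : lo i ≤ m := h.mono (by rw [hm', h1]) (by rw [hm']; exact Nat.le_succ _) (by rw [hm'])
  have h6 : m ≠ lo i := by rintro rfl; have := congrArg (fun x => x.2.1) hm'; simp at this
  have h7 : m ≠ hi i := by rintro rfl; exact h4 (congrArg (fun x => x.2.1) hm')
  simp only [Fin.le_def, Fin.ext_iff, coe_lo, coe_hi, Ne] at *
  omega

/-- Numbers on the same diagonal differ by at least three. -/
theorem IsStandardBi.diag_far (h : IsStandardBi n μ f) {a b : Fin n} (hab : a < b)
    (h1 : (f a).1 = (f b).1) (h2 : content (f a).2 = content (f b).2) : (a : ℕ) + 3 ≤ b := by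
  have h3 : (f a).2.1 < (f b).2.1 ∧ (f a).2.2 < (f b).2.2 := by
    by_contra h3
    refine absurd (h.mono h1.symm ?_ ?_) (not_le.2 hab) <;> unfold content at h2 <;> omega
  -- The boxes just below and just right of that of `a` hold two different numbers strictly between
  -- `a` and `b`.
  obtain ⟨m, hm, hm'⟩ := h.exists_le b (r := (f a).2.1 + 1) (c := (f a).2.2) h3.1 h3.2.le
  obtain ⟨k, hk, hk'⟩ := h.exists_le b (r := (f a).2.1) (c := (f a).2.2 + 1) h3.1.le h3.2
  have h5 : a ≤ m := h.mono (by rw [hm', h1]) (by rw [hm']; exact Nat.le_succ _) (by rw [hm'])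
  have h6 : a ≤ k := h.mono (by rw [hk', h1]) (by rw [hk']) (by rw [hk']; exact Nat.le_succ _)
  have h7 : m ≠ a := by rintro rfl; have := congrArg (fun x => x.2.1) hm'; simp at this
  have h8 : k ≠ a := by rintro rfl; have := congrArg (fun x => x.2.2) hk'; simp at this
  have h9 : m ≠ b := by rintro rfl; have := congrArg (fun x => x.2.2) hm'; simp at this; omega
  have h10 : k ≠ b := by rintro rfl; have := congrArg (fun x => x.2.1) hk'; simp at this; omega
  have h11 : m ≠ k := by rintro rfl; rw [hm'] at hk'; simp at hk'
  simp only [Fin.le_def, Fin.lt_def, Fin.ext_iff, Ne] at *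
  omega

/-- Exchanging consecutive numbers that are neither in the same row nor in the same column gives a
standard bitableau. -/
theorem IsStandardBi.comp_simple (h : IsStandardBi n μ f) {i : Fin (n - 1)}
    (hi' : (f (lo i)).1 = (f (hi i)).1 →
      (f (lo i)).2.1 ≠ (f (hi i)).2.1 ∧ (f (lo i)).2.2 ≠ (f (hi i)).2.2) :
    IsStandardBi n μ (f ∘ simple i) where
  bijOn := h.bijOn.comp (Set.bijOn_univ.2 (simple i).bijective)
  row_increasing a b h1 h2 h3 := by
    refine lt_of_simple_lt (h.row_increasing _ _ h1 h2 h3) fun h4 => ?_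
    simp only [Function.comp_apply, h4.1, h4.2] at h1 h2
    exact (hi' h1).1 h2
  col_increasing a b h1 h2 h3 := by
    refine lt_of_simple_lt (h.col_increasing _ _ h1 h2 h3) fun h4 => ?_
    simp only [Function.comp_apply, h4.1, h4.2] at h1 h2
    exact (hi' h1).2 h2

variable {θ : YoungDiagram}

theorem mem_column {m : ℕ} {c : ℕ × ℕ} : c ∈ column m ↔ c.1 < m ∧ c.2 = 0 := by
  change c ∈ Finset.range m ×ˢ {0} ↔ _
  rw [Finset.mem_product, Finset.mem_range, Finset.mem_singleton]

theorem IsStandardBi.snd_eq_zero (h : IsStandardBi n (columnShape n θ) f) {a : Fin n}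
    (ha : (f a).1 = 1) : (f a).2.2 = 0 := by
  have := h.mem a
  rw [ha] at this
  exact (mem_column.1 this).2

end Standard

/-! ### Coefficients of the seminormal forms -/

section Coefficients

variable {F : Type*} [Field F]

open Classical in
/-- The diagonal coefficient of the seminormal form for boxes of weights `a` and `b`. -/
noncomputable def diagCoeff (p a b : F) : F := if a = 0 ∧ b = 0 then -1 else (p - 1) * b / (b - a)

/-- The pairs of weights for which the seminormal form makes sense. -/
def GoodPair (a b : F) : Prop := a = b → a = 0

variable {p a b c : F}

theorem diagCoeff_zero : diagCoeff p 0 0 = -1 := if_pos ⟨rfl, rfl⟩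

theorem diagCoeff_of_ne (h : a ≠ b) : diagCoeff p a b = (p - 1) * b / (b - a) :=
  if_neg fun h' => h (h'.1.trans h'.2.symm)

theorem diagCoeff_add (h : a ≠ b) : diagCoeff p a b + diagCoeff p b a = p - 1 := by
  have h1 : b - a ≠ 0 := sub_ne_zero.2 h.symm
  have h2 : a - b ≠ 0 := sub_ne_zero.2 h
  rw [diagCoeff_of_ne h, diagCoeff_of_ne h.symm]
  field_simp
  ring

/-- The coefficient identity behind the braid relation, for the term with the first two entries
exchanged. -/
theorem diagCoeff_braid_left (h1 : a ≠ b) (h2 : GoodPair a c) (h3 : GoodPair b c) :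
    diagCoeff p a b * diagCoeff p b c + diagCoeff p a c * diagCoeff p b a =
      diagCoeff p b c * diagCoeff p a c := by
  have e1 : b - a ≠ 0 := sub_ne_zero.2 h1.symm
  have e1' : a - b ≠ 0 := sub_ne_zero.2 h1
  by_cases hac : a = c
  · have ha := h2 hac
    subst hac ha
    simp [diagCoeff_zero, diagCoeff_of_ne h1, diagCoeff_of_ne h1.symm]
  by_cases hbc : b = c
  · have hb := h3 hbc
    subst hbc hb
    simp [diagCoeff_zero, diagCoeff_of_ne h1, diagCoeff_of_ne h1.symm]
  have e2 : c - a ≠ 0 := sub_ne_zero.2 (Ne.symm hac)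
  have e3 : c - b ≠ 0 := sub_ne_zero.2 (Ne.symm hbc)
  rw [diagCoeff_of_ne h1, diagCoeff_of_ne h1.symm, diagCoeff_of_ne hac, diagCoeff_of_ne hbc]
  field_simp
  ring

/-- The counterpart of `diagCoeff_braid_left` for the term with the last two entries exchanged. -/
theorem diagCoeff_braid_right (h1 : b ≠ c) (h2 : GoodPair a c) (h3 : GoodPair a b) :
    diagCoeff p a b * diagCoeff p a c =
      diagCoeff p b c * diagCoeff p a b + diagCoeff p a c * diagCoeff p c b := by
  have e1 : c - b ≠ 0 := sub_ne_zero.2 h1.symm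
  have e1' : b - c ≠ 0 := sub_ne_zero.2 h1
  by_cases hac : a = c
  · have ha := h2 hac
    subst hac ha
    simp [diagCoeff_zero, diagCoeff_of_ne h1, diagCoeff_of_ne h1.symm]
  by_cases hab : a = b
  · have hb := h3 hab
    subst hab hb
    simp [diagCoeff_zero, diagCoeff_of_ne h1, diagCoeff_of_ne h1.symm]
  have e2 : c - a ≠ 0 := sub_ne_zero.2 (Ne.symm hac)
  have e3 : b - a ≠ 0 := sub_ne_zero.2 (Ne.symm hab)
  rw [diagCoeff_of_ne h1, diagCoeff_of_ne h1.symm, diagCoeff_of_ne hac, diagCoeff_of_ne hab]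
  field_simp
  ring

/-- This compares the coefficients of the unpermuted vector in the braid relation; a product of two
opposite off-diagonal coefficients enters as `(p - x)(1 + x)`. Weights can coincide only at `0`,
where the coefficient is a convention, so these cases are treated apart. -/
theorem diagCoeff_braid (h1 : GoodPair a b) (h2 : GoodPair a c) (h3 : GoodPair b c) :
    diagCoeff p a b * diagCoeff p a b * diagCoeff p b c +
        (p - diagCoeff p a b) * (1 + diagCoeff p a b) * diagCoeff p a c =
      diagCoeff p b c * diagCoeff p b c * diagCoeff p a b +
        (p - diagCoeff p b c) * (1 + diagCoeff p b c) * diagCoeff p a c := by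
  by_cases hab : a = b
  · have ha := h1 hab
    subst hab ha
    by_cases hac : 0 = c
    · subst hac; simp [diagCoeff_zero]
    have e2 : c ≠ 0 := Ne.symm hac
    simp only [diagCoeff_zero, diagCoeff_of_ne hac]
    field_simp
    ring
  have e1 : b - a ≠ 0 := sub_ne_zero.2 (Ne.symm hab)
  by_cases hac : a = c
  · have ha := h2 hac
    subst hac ha
    have e2 : b ≠ 0 := Ne.symm hab
    simp only [diagCoeff_zero, diagCoeff_of_ne hab, diagCoeff_of_ne e2]
    field_simp
    ring
  by_cases hbc : b = c
  · have hb := h3 hbc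
    subst hbc hb
    simp only [diagCoeff_zero, diagCoeff_of_ne hab]
    field_simp
    ring
  have e2 : c - a ≠ 0 := sub_ne_zero.2 (Ne.symm hac)
  have e3 : c - b ≠ 0 := sub_ne_zero.2 (Ne.symm hbc)
  rw [diagCoeff_of_ne hab, diagCoeff_of_ne hac, diagCoeff_of_ne hbc]
  field_simp
  ring

/-- The coefficient identity for Jucys-Murphy elements. -/
theorem diagCoeff_jm (h : GoodPair a b) :
    diagCoeff p a b * diagCoeff p a b * a + (p - diagCoeff p a b) * (1 + diagCoeff p a b) * b =
      p * b := by
  by_cases hab : a = b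
  · have ha := h hab
    subst hab ha
    simp
  have e1 : b - a ≠ 0 := sub_ne_zero.2 (Ne.symm hab)
  rw [diagCoeff_of_ne hab]
  field_simp
  ring

theorem diagCoeff_jm_off (h : a ≠ b) : diagCoeff p a b * a + diagCoeff p b a * b = 0 := by
  have e1 : b - a ≠ 0 := sub_ne_zero.2 h.symm
  have e2 : a - b ≠ 0 := sub_ne_zero.2 h
  rw [diagCoeff_of_ne h, diagCoeff_of_ne h.symm]
  field_simp
  ring

variable {M : Type*} [AddCommGroup M] [Module F M]

/-- Cayley-Hamilton for a two by two matrix of trace `p - 1` and determinant `-p`. If `s = 0`, then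
`v` is an eigenvector and `h3` alone makes `x` a root of the quadratic. -/
theorem quadratic_of_coeffs {T : M →ₗ[F] M} {v w : M} {x y s t : F} (h1 : T v = x • v + s • w)
    (h2 : T w = y • w + t • v) (h3 : s * t = (p - x) * (1 + x)) (h4 : s ≠ 0 → x + y = p - 1) :
    T (T v) = (p - 1) • T v + p • v := by
  rw [h1, map_add, map_smul, map_smul, h1, h2]
  have h5 : s * (x + y) = s * (p - 1) := by
    by_cases hs : s = 0
    · simp [hs]
    · rw [h4 hs]
  linear_combination (norm := module) h3 • v + h5 • w

/-- The six vectors are the arrangements of three entries. The coefficients of `v231`, `v312`,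
`v321` agree identically; the other three need `e1`, `e2`, `e3`. The first two identities are only
needed when the vector in question occurs. -/
theorem braid_of_coeffs {S T : M →ₗ[F] M} {v123 v213 v132 v231 v312 v321 : M}
    {a12 a21 a13 a23 a32 b12 b21 b13 b23 b32 : F}
    (h1 : S v123 = a12 • v123 + b12 • v213) (h2 : T v123 = a23 • v123 + b23 • v132)
    (h3 : T v213 = a13 • v213 + b13 • v231) (h4 : S v213 = a21 • v213 + b21 • v123)
    (h5 : S v231 = a23 • v231 + b23 • v321) (h6 : S v132 = a13 • v132 + b13 • v312)
    (h7 : T v132 = a32 • v132 + b32 • v123) (h8 : T v312 = a12 • v312 + b12 • v321)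
    (e1 : b12 ≠ 0 → a12 * a23 + a13 * a21 = a23 * a13)
    (e2 : b23 ≠ 0 → a12 * a13 = a23 * a12 + a13 * a32)
    (e3 : a12 * a12 * a23 + b12 * b21 * a13 = a23 * a23 * a12 + b23 * b32 * a13) :
    S (T (S v123)) = T (S (T v123)) := by
  have e1' : b12 * (a12 * a23 + a13 * a21) = b12 * (a23 * a13) := by
    by_cases hs : b12 = 0
    · simp [hs]
    · rw [e1 hs]
  have e2' : b23 * (a12 * a13) = b23 * (a23 * a12 + a13 * a32) := by
    by_cases hs : b23 = 0
    · simp [hs]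
    · rw [e2 hs]
  simp only [h1, h2, h3, h4, h5, h6, h7, h8, map_add, map_smul]
  linear_combination (norm := module) e1' • v213 + e2' • v132 + e3 • v123

end Coefficients

noncomputable instance : Algebra ℕ K := Semiring.toNatAlgebra

noncomputable instance : Algebra ℤ K := Ring.toIntAlgebra _

theorem q_zpow_injective : Function.Injective fun k : ℤ => (q : K) ^ k := by
  have key : ∀ m : ℕ, (q : K) ^ m = 1 → m = 0 := by
    intro m hm
    have h1 : algebraMap (Polynomial ℂ) K (Polynomial.X ^ m) = algebraMap (Polynomial ℂ) K 1 := by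
      simpa [RatFunc.algebraMap_X] using hm
    have := congrArg Polynomial.natDegree (RatFunc.algebraMap_injective ℂ h1)
    simpa using this
  intro k l hkl
  wlog h : l ≤ k generalizing k l
  · exact (this hkl.symm (not_le.1 h).le).symm
  obtain ⟨m, rfl⟩ := Int.le.dest h
  have h1 : (q : K) ^ (l + (m : ℤ)) = q ^ l := hkl
  rw [zpow_add₀ q_ne_zero, zpow_natCast] at h1
  have := key m (mul_left_cancel₀ (zpow_ne_zero l q_ne_zero) (h1.trans (mul_one _).symm))
  simp [this]

/-- The eigenvalue of a Jucys-Murphy element for a box. -/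
noncomputable def wt (c : Box) : K := if c.1 = 0 then q ^ content c.2 else 0

/-- The diagonal coefficient of the seminormal form. -/
noncomputable def diag (x y : Box) : K := diagCoeff q (wt x) (wt y)

/-- The off-diagonal coefficient of the seminormal form. -/
noncomputable def off (x y : Box) : K :=
  if x.1 = y.1 then (if x.2.1 = y.2.1 ∨ x.2.2 = y.2.2 then 0 else 1 + diag x y)
  else if x.1 = 0 then 1 else q

theorem wt_zero {c : Box} (h : c.1 = 0) : wt c = q ^ content c.2 := if_pos h

theorem wt_one {c : Box} (h : c.1 = 1) : wt c = 0 := if_neg (by simp [h])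

theorem wt_ne_zero {c : Box} (h : c.1 = 0) : wt c ≠ 0 := by
  rw [wt_zero h]
  exact zpow_ne_zero _ q_ne_zero

theorem fin_two_cases (x : Fin 2) : x = 0 ∨ x = 1 := by omega

theorem wt_eq_zero_iff {c : Box} : wt c = 0 ↔ c.1 = 1 := by
  refine ⟨fun h => (fin_two_cases c.1).resolve_left fun h' => wt_ne_zero h' h, wt_one⟩

theorem wt_eq_iff {x y : Box} :
    wt x = wt y ↔ x.1 = y.1 ∧ (x.1 = 0 → content x.2 = content y.2) := by
  rcases fin_two_cases x.1 with hx | hx <;> rcases fin_two_cases y.1 with hy | hy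
  · rw [wt_zero hx, wt_zero hy, hx, hy]
    simpa using q_zpow_injective.eq_iff
  · rw [wt_one hy, hx, hy]
    simpa using wt_ne_zero hx
  · rw [wt_one hx, hx, hy]
    simpa using (wt_ne_zero hy).symm
  · simp [wt_one, hx, hy]

theorem diag_zero_one {x y : Box} (hx : x.1 = 0) (hy : y.1 = 1) : diag x y = 0 := by
  rw [diag, wt_one hy, diagCoeff_of_ne (wt_ne_zero hx), mul_zero, zero_div]

theorem diag_one_zero {x y : Box} (hx : x.1 = 1) (hy : y.1 = 0) : diag x y = q - 1 := by
  rw [diag, wt_one hx, diagCoeff_of_ne (wt_ne_zero hy).symm, sub_zero,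
    mul_div_cancel_right₀ _ (wt_ne_zero hy)]

theorem diag_one_one {x y : Box} (hx : x.1 = 1) (hy : y.1 = 1) : diag x y = -1 := by
  rw [diag, wt_one hx, wt_one hy, diagCoeff_zero]

theorem diag_zero_zero {x y : Box} (hx : x.1 = 0) (hy : y.1 = 0)
    (h : content x.2 ≠ content y.2) :
    diag x y = seminormalCoeff (content x.2 - content y.2) := by
  have h1 : wt x ≠ wt y := fun h' => h ((wt_eq_iff.1 h').2 hx)
  rw [diag, diagCoeff_of_ne h1, wt_zero hx, wt_zero hy, seminormalCoeff, zpow_sub₀ q_ne_zero]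
  have h2 : (q : K) ^ content y.2 ≠ 0 := zpow_ne_zero _ q_ne_zero
  rw [one_sub_div h2, div_div_eq_mul_div]

theorem off_zero_one {x y : Box} (hx : x.1 = 0) (hy : y.1 = 1) : off x y = 1 := by
  simp [off, hx, hy]

theorem off_one_zero {x y : Box} (hx : x.1 = 1) (hy : y.1 = 0) : off x y = q := by
  simp [off, hx, hy]

theorem off_eq_zero {x y : Box} (h : x.1 = y.1) (h' : x.2.1 = y.2.1 ∨ x.2.2 = y.2.2) :
    off x y = 0 := by
  rw [off, if_pos h, if_pos h']

theorem off_eq {x y : Box} (h : x.1 = y.1) (h' : ¬(x.2.1 = y.2.1 ∨ x.2.2 = y.2.2)) :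
    off x y = 1 + diag x y := by
  rw [off, if_pos h, if_neg h']

section Standard

variable {n : ℕ} {θ : YoungDiagram} {f : Fin n → Box}

/-- Entries on one diagonal of `θ` differ by at least three, so equal weights at distance at most
two occur only in the column. This is all that the quadratic and braid relations require. -/
theorem IsStandardBi.goodPair (h : IsStandardBi n (columnShape n θ) f) {a b : Fin n} (hab : a < b)
    (hab' : (b : ℕ) ≤ a + 2) : GoodPair (wt (f a)) (wt (f b)) := by
  intro h1
  obtain ⟨h2, h3⟩ := wt_eq_iff.1 h1
  rw [wt_eq_zero_iff]
  refine (fin_two_cases _).resolve_left fun h4 => ?_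
  have := h.diag_far hab h2 (h3 h4)
  omega

theorem IsStandardBi.goodPair_simple (h : IsStandardBi n (columnShape n θ) f) (i : Fin (n - 1)) :
    GoodPair (wt (f (lo i))) (wt (f (hi i))) :=
  h.goodPair (lo_lt_hi i) (by rw [coe_lo, coe_hi]; omega)

theorem q_ne_one : (q : K) ≠ 1 := fun h =>
  one_ne_zero (q_zpow_injective (a₁ := 1) (a₂ := 0) (by simpa using h))

/-- Adjacent boxes of a row have contents differing by one, and `(q-1)/(1-q⁻¹) = q`; the column
cannot contain two entries of one row. -/
theorem IsStandardBi.diag_row (h : IsStandardBi n (columnShape n θ) f) {i : Fin (n - 1)}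
    (h1 : (f (lo i)).1 = (f (hi i)).1) (h2 : (f (lo i)).2.1 = (f (hi i)).2.1) :
    diag (f (lo i)) (f (hi i)) = q := by
  have h3 := h.row_adjacent h1 h2
  rcases fin_two_cases (f (lo i)).1 with h4 | h4
  · have h5 : content (f (hi i)).2 = content (f (lo i)).2 + 1 := by
      simp only [content, h3, h2]; push_cast; ring
    rw [diag_zero_zero h4 (h1 ▸ h4) (by omega), h5, seminormalCoeff,
      show content (f (lo i)).2 - (content (f (lo i)).2 + 1) = -1 by ring, zpow_neg_one]
    have h6 : (q : K) - 1 ≠ 0 := sub_ne_zero.2 q_ne_one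
    have h7 : (1 : K) - q⁻¹ = (q - 1) * q⁻¹ := by
      rw [sub_mul, one_mul, mul_inv_cancel₀ q_ne_zero]
    rw [h7, div_mul_eq_div_div, div_self h6, one_div, inv_inv]
  · have := h.snd_eq_zero (h1 ▸ h4)
    omega

theorem IsStandardBi.diag_col (h : IsStandardBi n (columnShape n θ) f) {i : Fin (n - 1)}
    (h1 : (f (lo i)).1 = (f (hi i)).1) (h2 : (f (lo i)).2.2 = (f (hi i)).2.2) :
    diag (f (lo i)) (f (hi i)) = -1 := by
  have h3 := h.col_adjacent h1 h2
  rcases fin_two_cases (f (lo i)).1 with h4 | h4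
  · have h5 : content (f (hi i)).2 = content (f (lo i)).2 - 1 := by
      simp only [content, h3, h2]; push_cast; ring
    rw [diag_zero_zero h4 (h1 ▸ h4) (by omega), h5, seminormalCoeff,
      show content (f (lo i)).2 - (content (f (lo i)).2 - 1) = 1 by ring, zpow_one]
    have h6 : (q : K) - 1 ≠ 0 := sub_ne_zero.2 q_ne_one
    have h7 : (1 : K) - q = -(q - 1) := (neg_sub _ _).symm
    rw [h7, div_eq_iff (neg_ne_zero.2 h6)]
    ring
  · exact diag_one_one h4 (h1 ▸ h4)

/-- Write `d` and `d'` for the two diagonal coefficients. In one row `d = q` and in one column `d =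
-1`, so both sides vanish; otherwise, inside a component, `d + d' = q - 1` gives `1 + d' = q - d`.
Across components the product is `1 * q` or `q * 1`. -/
theorem IsStandardBi.off_mul_off (h : IsStandardBi n (columnShape n θ) f) (i : Fin (n - 1)) :
    off (f (lo i)) (f (hi i)) * off (f (hi i)) (f (lo i)) =
      (q - diag (f (lo i)) (f (hi i))) * (1 + diag (f (lo i)) (f (hi i))) := by
  by_cases h1 : (f (lo i)).1 = (f (hi i)).1
  · by_cases h2 : (f (lo i)).2.1 = (f (hi i)).2.1
    · rw [off_eq_zero h1 (.inl h2), h.diag_row h1 h2, sub_self, zero_mul, zero_mul]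
    by_cases h3 : (f (lo i)).2.2 = (f (hi i)).2.2
    · rw [off_eq_zero h1 (.inr h3), h.diag_col h1 h3, add_neg_cancel, mul_zero, zero_mul]
    rw [off_eq h1 (by tauto), off_eq h1.symm (by tauto)]
    have h4 : wt (f (lo i)) ≠ wt (f (hi i)) := by
      intro h4
      have h5 := wt_eq_zero_iff.1 (h.goodPair_simple i h4)
      rw [h.snd_eq_zero h5, h.snd_eq_zero (h1 ▸ h5)] at h3
      exact h3 rfl
    have h5 : diag (f (lo i)) (f (hi i)) + diag (f (hi i)) (f (lo i)) = q - 1 := diagCoeff_add h4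
    rw [← eq_sub_iff_add_eq'] at h5
    rw [h5]
    ring
  · rcases fin_two_cases (f (lo i)).1 with h2 | h2 <;>
    rcases fin_two_cases (f (hi i)).1 with h3 | h3
    · exact absurd (h2.trans h3.symm) h1
    · rw [off_zero_one h2 h3, off_one_zero h3 h2, diag_zero_one h2 h3]; ring
    · rw [off_zero_one h3 h2, off_one_zero h2 h3, diag_one_zero h2 h3]; ring
    · exact absurd (h2.trans h3.symm) h1

theorem IsStandardBi.wt_ne (h : IsStandardBi n (columnShape n θ) f) {i : Fin (n - 1)}
    (h0 : off (f (lo i)) (f (hi i)) ≠ 0) : wt (f (lo i)) ≠ wt (f (hi i)) := by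
  intro h1
  obtain ⟨h2, -⟩ := wt_eq_iff.1 h1
  have h3 := wt_eq_zero_iff.1 (h.goodPair_simple i h1)
  exact h0 (off_eq_zero h2 (.inr (by rw [h.snd_eq_zero h3, h.snd_eq_zero (h2 ▸ h3)])))

theorem not_adjacent_of_off_ne_zero {x y : Box} (h0 : off x y ≠ 0) (h : x.1 = y.1) :
    x.2.1 ≠ y.2.1 ∧ x.2.2 ≠ y.2.2 :=
  ⟨fun h' => h0 (off_eq_zero h (.inl h')), fun h' => h0 (off_eq_zero h (.inr h'))⟩

/-- Inside `θ`, vanishing would make the content of `hi i` one less than that of `lo i`. Then `hi i`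
lies strictly south-east of `lo i`, and the box below `lo i` would hold a number strictly between
these two consecutive ones. -/
theorem IsStandardBi.off_ne_zero (h : IsStandardBi n (columnShape n θ) f) {i : Fin (n - 1)}
    (h1 : (f (lo i)).1 = (f (hi i)).1 →
      (f (lo i)).2.1 ≠ (f (hi i)).2.1 ∧ (f (lo i)).2.2 ≠ (f (hi i)).2.2) :
    off (f (lo i)) (f (hi i)) ≠ 0 := by
  by_cases h2 : (f (lo i)).1 = (f (hi i)).1
  · obtain ⟨h3, h4⟩ := h1 h2
    rw [off_eq h2 (by tauto)]
    intro h5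
    rcases fin_two_cases (f (lo i)).1 with h6 | h6
    · have hne : wt (f (lo i)) ≠ wt (f (hi i)) := fun h' => wt_ne_zero h6 (h.goodPair_simple i h')
      have h7 : wt (f (hi i)) - wt (f (lo i)) ≠ 0 := sub_ne_zero.2 hne.symm
      rw [diag, diagCoeff_of_ne hne] at h5
      field_simp at h5
      rw [wt_zero h6, wt_zero (h2 ▸ h6)] at h5
      have h8 : (q : K) ^ (content (f (hi i)).2 + 1) = q ^ content (f (lo i)).2 := by
        rw [zpow_add_one₀ q_ne_zero]
        linear_combination h5
      have h9 : content (f (hi i)).2 + 1 = content (f (lo i)).2 := q_zpow_injective h8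
      have hlt : ¬ hi i ≤ lo i := not_le.2 (lo_lt_hi i)
      have hb1 : ¬ ((f (hi i)).2.1 ≤ (f (lo i)).2.1 ∧ (f (hi i)).2.2 ≤ (f (lo i)).2.2) :=
        fun hh => hlt (h.mono h2.symm hh.1 hh.2)
      have hb2 : (f (lo i)).2.1 < (f (hi i)).2.1 ∧ (f (lo i)).2.2 < (f (hi i)).2.2 := by
        unfold content at h9
        omega
      obtain ⟨m, hm, hm'⟩ := h.exists_le (hi i) hb2.1 hb2.2.le
      have h10 : lo i ≤ m :=
        h.mono (by rw [hm', h2]) (by rw [hm']; exact Nat.le_succ _) (by rw [hm'])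
      have h11 : m ≠ lo i := by
        rintro rfl; have := congrArg (fun x => x.2.1) hm'; simp at this
      have h12 : m ≠ hi i := by
        rintro rfl; have := congrArg (fun x => x.2.2) hm'; simp at this; omega
      simp only [Fin.le_def, Fin.ext_iff, coe_lo, coe_hi, Ne] at *
      omega
    · rw [h.snd_eq_zero h6, h.snd_eq_zero (h2 ▸ h6)] at h4
      exact h4 rfl
  · rcases fin_two_cases (f (lo i)).1 with h3 | h3
    · rw [off_zero_one h3 ((fin_two_cases _).resolve_left fun h4 => h2 (h3.trans h4.symm))]
      exact one_ne_zero
    · rw [off_one_zero h3 ((fin_two_cases _).resolve_right fun h4 => h2 (h3.trans h4.symm))]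
      exact q_ne_zero

end Standard

/-! ### Seminormal operators on all fillings -/

theorem lift_single {X M : Type*} [AddCommGroup M] [Module K M] (φ : X → M) (x : X) :
    Finsupp.lift M K X φ (Finsupp.single x 1) = φ x := by
  rw [Finsupp.lift_apply, Finsupp.sum_single_index, one_smul]
  exact zero_smul _ _

section Big

variable {n : ℕ}

/-- The seminormal operators on the space spanned by all fillings. -/
noncomputable def bigT (i : Fin (n - 1)) : ((Fin n → Box) →₀ K) →ₗ[K] ((Fin n → Box) →₀ K) :=
  Finsupp.lift _ K _ fun f => diag (f (lo i)) (f (hi i)) • Finsupp.single f 1 +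
    off (f (lo i)) (f (hi i)) • Finsupp.single (f ∘ simple i) 1

/-- The operator `X` on the space spanned by all fillings. -/
noncomputable def bigX [NeZero n] : ((Fin n → Box) →₀ K) →ₗ[K] ((Fin n → Box) →₀ K) :=
  Finsupp.lift _ K _ fun f => if (f 0).1 = 0 then Finsupp.single f 1 else 0

theorem bigT_single (i : Fin (n - 1)) (f : Fin n → Box) :
    bigT i (Finsupp.single f 1) = diag (f (lo i)) (f (hi i)) • Finsupp.single f 1 +
      off (f (lo i)) (f (hi i)) • Finsupp.single (f ∘ simple i) 1 := by
  rw [bigT, lift_single]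

theorem bigT_single_comp (i : Fin (n - 1)) (f : Fin n → Box) :
    bigT i (Finsupp.single (f ∘ simple i) 1) =
      diag (f (hi i)) (f (lo i)) • Finsupp.single (f ∘ simple i) 1 +
      off (f (hi i)) (f (lo i)) • Finsupp.single f 1 := by
  rw [bigT_single, comp_simple_simple]
  simp

theorem bigX_single [NeZero n] (f : Fin n → Box) :
    bigX (Finsupp.single f 1) = if (f 0).1 = 0 then Finsupp.single f (1 : K) else 0 := by
  rw [bigX, lift_single]

variable {θ : YoungDiagram} {f : Fin n → Box}

/-- The relations are verified in the span of all fillings, where no vector has to be read as zero,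
but only on standard fillings, where the coefficient identities are available. -/
theorem IsStandardBi.bigT_quadratic (h : IsStandardBi n (columnShape n θ) f) (i : Fin (n - 1)) :
    bigT i (bigT i (Finsupp.single f 1)) =
      (q - 1) • bigT i (Finsupp.single f 1) + q • Finsupp.single f 1 :=
  quadratic_of_coeffs (bigT_single i f) (bigT_single_comp i f) (h.off_mul_off i)
    fun h0 => diagCoeff_add (h.wt_ne h0)

theorem lo_ne_of_lt {i j : Fin (n - 1)} (h : (i : ℕ) + 1 = j) :
    simple j (lo i) = lo i ∧ simple i (hi j) = hi j := by
  simp only [Fin.ext_iff, coe_simple, coe_lo, coe_hi]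
  grind

theorem IsStandardBi.bigT_braid (h : IsStandardBi n (columnShape n θ) f) {i j : Fin (n - 1)}
    (hij : (i : ℕ) + 1 = j) :
    bigT i (bigT j (bigT i (Finsupp.single f 1))) =
      bigT j (bigT i (bigT j (Finsupp.single f 1))) := by
  obtain ⟨e1, e2⟩ := lo_ne_of_lt hij
  have e3 := lo_eq_hi hij
  have e4 : simple j (hi i) = hi j := by rw [← e3, simple_lo]
  have hb : lo i < hi j := by rw [Fin.lt_def, coe_lo, coe_hi]; omega
  have hb' : ((hi j : Fin n) : ℕ) ≤ (lo i : Fin n) + 2 := by rw [coe_lo, coe_hi]; omega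
  have g1 := h.goodPair_simple i
  have g2 := h.goodPair_simple j
  have g3 := h.goodPair hb hb'
  -- The two paths to the reversed arrangement end in the same filling.
  have hw : ((f ∘ simple i) ∘ simple j) ∘ simple i = ((f ∘ simple j) ∘ simple i) ∘ simple j :=
    funext fun a => congrArg f (simple_braid hij a)
  have w1 := h.wt_ne (i := i)
  have w2 := h.wt_ne (i := j)
  have o1 := h.off_mul_off i
  have o2 := h.off_mul_off j
  rw [e3] at g2 w2 o2
  have s5 := bigT_single i ((f ∘ simple i) ∘ simple j)
  have s3 := bigT_single j (f ∘ simple i)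
  have s6 := bigT_single i (f ∘ simple j)
  have s7 := bigT_single_comp j f
  have s8 := bigT_single j ((f ∘ simple j) ∘ simple i)
  have s2 := bigT_single j f
  rw [← hw] at s8
  have e5 : simple j (hi j) = hi i := by rw [simple_hi, e3]
  simp only [Function.comp_apply, e1, e2, e3, e4, e5, simple_lo, simple_hi] at s2 s3 s5 s6 s7 s8
  refine braid_of_coeffs (bigT_single i f) s2 s3 (bigT_single_comp i f) s5 s6 s7 s8 ?_ ?_ ?_
  · exact fun h0 => diagCoeff_braid_left (w1 h0) g3 g2
  · exact fun h0 => diagCoeff_braid_right (w2 h0) g3 g1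
  · rw [o1, o2]
    exact diagCoeff_braid g1 g3 g2

theorem bigT_comm {i j : Fin (n - 1)} (hij : (i : ℕ) + 2 ≤ j) (f : Fin n → Box) :
    bigT i (bigT j (Finsupp.single f 1)) = bigT j (bigT i (Finsupp.single f 1)) := by
  have e1 : simple j (lo i) = lo i ∧ simple j (hi i) = hi i ∧ simple i (lo j) = lo j ∧
      simple i (hi j) = hi j := by
    simp only [Fin.ext_iff, coe_simple, coe_lo, coe_hi]
    grind
  obtain ⟨e1, e2, e3, e4⟩ := e1
  have hw : (f ∘ simple i) ∘ simple j = (f ∘ simple j) ∘ simple i :=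
    funext fun a => congrArg f (simple_comm hij a)
  have s1 := bigT_single i (f ∘ simple j)
  have s2 := bigT_single j (f ∘ simple i)
  simp only [Function.comp_apply, e1, e2, e3, e4] at s1 s2
  rw [bigT_single j, bigT_single i]
  simp only [map_add, map_smul]
  rw [bigT_single i f, bigT_single j f, s1, s2, hw]
  module

section X

variable [NeZero n]

theorem lo_zero {i : Fin (n - 1)} (h : (i : ℕ) = 0) : lo i = 0 := Fin.ext (by simp [coe_lo, h])

theorem simple_zero {i : Fin (n - 1)} (h : 1 ≤ (i : ℕ)) : simple i 0 = 0 := by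
  simp only [Fin.ext_iff, coe_simple, Fin.val_zero]
  grind

theorem bigX_idem (f : Fin n → Box) :
    bigX (bigX (Finsupp.single f 1)) = bigX (Finsupp.single f 1) := by
  rw [bigX_single]
  split_ifs with h
  · rw [bigX_single, if_pos h]
  · simp

theorem bigX_comm {i : Fin (n - 1)} (h : 1 ≤ (i : ℕ)) (f : Fin n → Box) :
    bigX (bigT i (Finsupp.single f 1)) = bigT i (bigX (Finsupp.single f 1)) := by
  simp only [bigT_single, bigX_single, map_add, map_smul, Function.comp_apply, simple_zero h]
  split_ifs with h
  · rw [bigT_single]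
  · simp

/-- The cases are the positions of `1` and `2`. The shape matters only if both are in the second
component: there the ideal relation reduces to `1 + T_1 = 0`, which holds because this component is
a single column. -/
theorem bigX_relations (h : IsStandardBi n (columnShape n θ) f) {i : Fin (n - 1)}
    (hi0 : (i : ℕ) = 0) :
    bigX (bigT i (bigX (bigT i (Finsupp.single f 1)))) =
      bigT i (bigX (bigT i (bigX (Finsupp.single f 1)))) ∧
    Finsupp.single f 1 - bigX (Finsupp.single f 1) + bigT i (Finsupp.single f 1) -
      bigX (bigT i (Finsupp.single f 1)) - bigT i (bigX (Finsupp.single f 1)) +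
      bigX (bigT i (bigX (Finsupp.single f 1))) - bigT i (bigX (bigT i (Finsupp.single f 1))) +
      bigX (bigT i (bigX (bigT i (Finsupp.single f 1)))) = 0 := by
  have s1 := bigT_single i f
  have s2 := bigT_single_comp i f
  have x1 := bigX_single f
  have x2 := bigX_single (f ∘ simple i)
  rw [Function.comp_apply, ← lo_zero hi0, simple_lo] at x2
  rw [← lo_zero hi0] at x1
  rcases fin_two_cases (f (lo i)).1 with h1 | h1 <;>
  rcases fin_two_cases (f (hi i)).1 with h2 | h2
  · simp only [h1, h2, if_true] at x1 x2
    simp only [s1, s2, x1, x2, map_add, map_smul]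
    exact ⟨trivial, by abel⟩
  · simp only [diag_zero_one h1 h2, off_zero_one h1 h2, diag_one_zero h2 h1, off_one_zero h2 h1,
      h1, h2, if_true, one_ne_zero, if_false, zero_smul, one_smul, zero_add] at x1 x2 s1 s2
    simp only [s1, x1, x2, map_zero, sub_zero, add_zero]
    exact ⟨trivial, by abel⟩
  · simp only [diag_zero_one h2 h1, off_zero_one h2 h1, diag_one_zero h1 h2, off_one_zero h1 h2,
      h1, h2, if_true, one_ne_zero, if_false, zero_smul, one_smul, zero_add] at x1 x2 s1 s2
    simp only [s1, s2, x1, x2, map_add, map_smul, map_zero, sub_zero, add_zero, smul_zero, zero_add]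
    exact ⟨trivial, by module⟩
  · have h3 : (f (lo i)).1 = (f (hi i)).1 := h1.trans h2.symm
    have h4 : off (f (lo i)) (f (hi i)) = 0 :=
      off_eq_zero h3 (.inr (by rw [h.snd_eq_zero h1, h.snd_eq_zero h2]))
    simp only [diag_one_one h1 h2, h4, h1, one_ne_zero, if_false, zero_smul, add_zero] at x1 s1
    simp only [s1, x1, map_smul, map_zero, smul_zero]
    exact ⟨trivial, by module⟩

end X

end Big

/-! ### Seminormal modules -/

section Fill

variable {n : ℕ} (P : (Fin n → Box) → Prop)

/-- The set `P` of fillings spans a seminormal module. -/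
structure Admissible : Prop where
  std : ∀ f, P f → ∃ θ, IsStandardBi n (columnShape n θ) f
  closed : ∀ f, P f → ∀ i : Fin (n - 1), off (f (lo i)) (f (hi i)) ≠ 0 → P (f ∘ simple i)

open Classical in
/-- The vector of a filling, read as `0` outside `P`. -/
noncomputable def vecP (f : Fin n → Box) : {f // P f} →₀ K :=
  if h : P f then Finsupp.single ⟨f, h⟩ 1 else 0

/-- The seminormal operator on the span of the fillings in `P`. -/
noncomputable def fillT (i : Fin (n - 1)) : ({f // P f} →₀ K) →ₗ[K] ({f // P f} →₀ K) :=
  Finsupp.lift _ K _ fun f => diag (f.1 (lo i)) (f.1 (hi i)) • Finsupp.single f 1 +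
    off (f.1 (lo i)) (f.1 (hi i)) • vecP P (f.1 ∘ simple i)

/-- The operator `X` on the span of the fillings in `P`. -/
noncomputable def fillX [NeZero n] : ({f // P f} →₀ K) →ₗ[K] ({f // P f} →₀ K) :=
  Finsupp.lift _ K _ fun f => if (f.1 0).1 = 0 then Finsupp.single f 1 else 0

/-- The inclusion into the span of all fillings. -/
noncomputable def emb : ({f // P f} →₀ K) →ₗ[K] ((Fin n → Box) →₀ K) :=
  Finsupp.lmapDomain K K Subtype.val

variable {P}

theorem vecP_of {f : Fin n → Box} (h : P f) : vecP P f = Finsupp.single ⟨f, h⟩ 1 := dif_pos h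

theorem fillT_single (i : Fin (n - 1)) (f : {f // P f}) :
    fillT P i (Finsupp.single f 1) = diag (f.1 (lo i)) (f.1 (hi i)) • Finsupp.single f 1 +
      off (f.1 (lo i)) (f.1 (hi i)) • vecP P (f.1 ∘ simple i) := by
  rw [fillT, lift_single]

theorem fillX_single [NeZero n] (f : {f // P f}) :
    fillX P (Finsupp.single f 1) = if (f.1 0).1 = 0 then Finsupp.single f (1 : K) else 0 := by
  rw [fillX, lift_single]

theorem emb_single (f : {f // P f}) : emb P (Finsupp.single f 1) = Finsupp.single f.1 1 := by
  rw [emb, Finsupp.lmapDomain_apply, Finsupp.mapDomain_single]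

theorem emb_injective : Function.Injective (emb P) :=
  Finsupp.mapDomain_injective Subtype.val_injective

/-- Where the exchanged filling leaves `P`, its coefficient `off` vanishes by closure, so reading
its vector as zero changes nothing. -/
theorem Admissible.emb_fillT (hP : Admissible P) (i : Fin (n - 1)) (x : {f // P f} →₀ K) :
    emb P (fillT P i x) = bigT i (emb P x) := by
  suffices h : emb P ∘ₗ fillT P i = bigT i ∘ₗ emb P from LinearMap.congr_fun h x
  refine Finsupp.lhom_ext' fun f => LinearMap.ext_ring ?_
  simp only [LinearMap.comp_apply, Finsupp.lsingle_apply]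
  rw [fillT_single, emb_single, bigT_single, map_add, map_smul, map_smul, emb_single]
  by_cases h0 : off (f.1 (lo i)) (f.1 (hi i)) = 0
  · rw [h0, zero_smul, zero_smul]
  · rw [vecP_of (hP.closed f.1 f.2 i h0), emb_single]

theorem emb_fillX [NeZero n] (x : {f // P f} →₀ K) :
    emb P (fillX P x) = bigX (emb P x) := by
  suffices h : emb P ∘ₗ fillX P = bigX ∘ₗ emb P from LinearMap.congr_fun h x
  refine Finsupp.lhom_ext' fun f => LinearMap.ext_ring ?_
  simp only [LinearMap.comp_apply, Finsupp.lsingle_apply]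
  rw [fillX_single, emb_single, bigX_single]
  split_ifs
  · rw [emb_single]
  · rw [map_zero]

theorem end_ext {A B : ({f // P f} →₀ K) →ₗ[K] ({f // P f} →₀ K)}
    (h : ∀ f, emb P (A (Finsupp.single f 1)) = emb P (B (Finsupp.single f 1))) : A = B :=
  Finsupp.lhom_ext' fun f => LinearMap.ext_ring (emb_injective (h f))

theorem Admissible.isHecke (hP : Admissible P) : IsHecke (fillT P) where
  quadratic i := end_ext fun f => by
    obtain ⟨θ, h⟩ := hP.std f.1 f.2
    simp only [Module.End.mul_apply, LinearMap.add_apply, LinearMap.smul_apply,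
      Module.End.one_apply, map_add, map_smul, hP.emb_fillT, emb_single, h.bigT_quadratic]
  braid i j hij := end_ext fun f => by
    obtain ⟨θ, h⟩ := hP.std f.1 f.2
    simp only [Module.End.mul_apply, hP.emb_fillT, emb_single, h.bigT_braid hij]
  comm i j hij := end_ext fun f => by
    simp only [Module.End.mul_apply, hP.emb_fillT, emb_single, bigT_comm hij]

theorem Admissible.isCyclo [NeZero n] (hP : Admissible P) : IsCyclo (fillX P) (fillT P) where
  hecke := hP.isHecke
  idem := end_ext fun f => by
    simp only [Module.End.mul_apply, emb_fillX, emb_single, bigX_idem]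
  comm i hi := end_ext fun f => by
    simp only [Module.End.mul_apply, emb_fillX, hP.emb_fillT, emb_single, bigX_comm hi]
  braid i hi := end_ext fun f => by
    obtain ⟨θ, h⟩ := hP.std f.1 f.2
    simp only [Module.End.mul_apply, emb_fillX, hP.emb_fillT, emb_single,
      (bigX_relations h hi).1]
  ideal i hi := end_ext fun f => by
    obtain ⟨θ, h⟩ := hP.std f.1 f.2
    simp only [Module.End.mul_apply, LinearMap.add_apply, LinearMap.sub_apply,
      Module.End.one_apply, LinearMap.zero_apply, map_add, map_sub, map_zero, emb_fillX,
      hP.emb_fillT, emb_single, (bigX_relations h hi).2]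

end Fill

/-! ### Jucys-Murphy elements -/

/-- The Jucys-Murphy elements built from `x` and the `t i`. -/
noncomputable def jm {m : ℕ} {A : Type*} [Ring A] [Algebra K A] (x : A) (t : Fin m → A) : ℕ → A
  | 0 => x
  | k + 1 => if h : k < m then (q⁻¹ : K) • (t ⟨k, h⟩ * jm x t k * t ⟨k, h⟩) else 0

theorem jm_succ {m : ℕ} {A : Type*} [Ring A] [Algebra K A] (x : A) (t : Fin m → A) (i : Fin m) :
    jm x t (i + 1) = (q⁻¹ : K) • (t i * jm x t i * t i) := by
  rw [jm, dif_pos i.2]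

section Fill

variable {n : ℕ} {P : (Fin n → Box) → Prop}

theorem IsStandardBi.fst_zero [NeZero n] {θ : YoungDiagram} {f : Fin n → Box}
    (h : IsStandardBi n (columnShape n θ) f) : (f 0).2 = (0, 0) := by
  obtain ⟨a, ha, ha'⟩ := h.exists_le 0 (Nat.zero_le _) (Nat.zero_le _)
  have h0 : a = 0 := Fin.ext (by simpa [Fin.le_def] using ha)
  subst h0
  exact congrArg Prod.snd ha'

theorem wt_off_eq {x y : Box} (hx : GoodPair (wt x) (wt y))
    (ho : off x y ≠ 0 → wt x ≠ wt y)
    (hp : off x y * off y x = (q - diag x y) * (1 + diag x y)) :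
    diag x y * diag x y * wt x + off x y * off y x * wt y = q * wt y ∧
      off x y * (diag x y * wt x + diag y x * wt y) = 0 := by
  refine ⟨?_, ?_⟩
  · rw [hp]
    exact diagCoeff_jm hx
  · by_cases h0 : off x y = 0
    · rw [h0, zero_mul]
    · have : diag x y * wt x + diag y x * wt y = 0 := diagCoeff_jm_off (ho h0)
      rw [this, mul_zero]

/-- In the span of `v` and `w`, conjugation by `T` carries the eigenvalue `y` of `L` from `w` over
to `v`; `h5` and `h6` are the two matrix entries of this computation. -/
theorem jm_step {M : Type*} [AddCommGroup M] [Module K M] {T L : M →ₗ[K] M} {v w : M}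
    {a b s t x y : K} (h1 : T v = a • v + s • w) (h2 : T w = b • w + t • v)
    (h3 : L v = x • v) (h4 : L w = y • w) (h5 : a * a * x + s * t * y = q * y)
    (h6 : s * (a * x + b * y) = 0) : (q⁻¹ : K) • T (L (T v)) = y • v := by
  have h7 : T (L (T v)) = q • (y • v) := by
    simp only [h1, h2, h3, h4, map_add, map_smul]
    linear_combination (norm := module) h5 • v + h6 • w
  rw [h7, smul_smul, inv_mul_cancel₀ q_ne_zero, one_smul]

/-- The Jucys-Murphy elements act diagonally on seminormal modules. -/
theorem Admissible.jm_single [NeZero n] (hP : Admissible P) (k : ℕ) (hk : k < n)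
    (f : {f // P f}) : jm (fillX P) (fillT P) k (Finsupp.single f 1) =
      wt (f.1 ⟨k, hk⟩) • Finsupp.single f 1 := by
  induction k generalizing f with
  | zero =>
    obtain ⟨θ, h⟩ := hP.std f.1 f.2
    change fillX P (Finsupp.single f 1) = wt (f.1 0) • Finsupp.single f 1
    rw [fillX_single, wt, h.fst_zero]
    split_ifs <;> simp [content]
  | succ k ih =>
    obtain ⟨θ, h⟩ := hP.std f.1 f.2
    let i : Fin (n - 1) := ⟨k, by omega⟩
    have hlo : lo i = ⟨k, by omega⟩ := rfl
    have hhi : hi i = ⟨k + 1, hk⟩ := rfl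
    have e : jm (fillX P) (fillT P) (k + 1) (Finsupp.single f 1) =
        (q⁻¹ : K) • fillT P i (jm (fillX P) (fillT P) k (fillT P i (Finsupp.single f 1))) := by
      rw [jm_succ (fillX P) (fillT P) i]
      rfl
    obtain ⟨e1, e2⟩ := wt_off_eq (h.goodPair_simple i) (fun h0 => h.wt_ne h0)
      (h.off_mul_off i)
    rw [e, ← hhi]
    -- Without an off-diagonal term `f` spans a stable line, and the second vector may be taken to
    -- be `0`.
    by_cases h0 : off (f.1 (lo i)) (f.1 (hi i)) = 0
    · refine jm_step (w := 0) (b := 0) (t := 0) (s := 0) (y := wt (f.1 (hi i)))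
        (a := diag (f.1 (lo i)) (f.1 (hi i))) (x := wt (f.1 (lo i))) ?_ ?_ ?_ ?_ ?_ ?_
      · rw [fillT_single, h0, zero_smul, zero_smul]
      · simp
      · exact ih (by omega) f
      · simp
      · rw [h0] at e1
        simpa using e1
      · simp
    · have hc := hP.closed f.1 f.2 i h0
      have s1 := fillT_single i f
      have s2 := fillT_single i ⟨_, hc⟩
      rw [vecP_of hc] at s1
      simp only [comp_simple_simple, Function.comp_apply, simple_lo, simple_hi, vecP_of f.2] at s2
      have s4 := ih (by omega) ⟨_, hc⟩
      rw [← hlo] at s4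
      simp only [Function.comp_apply, simple_lo] at s4
      exact jm_step s1 s2 (ih (by omega) f) s4 e1 e2

theorem admissible_standard (θ : YoungDiagram) :
    Admissible (IsStandardBi n (columnShape n θ)) where
  std _ hf := ⟨θ, hf⟩
  closed _ hf _ h0 := hf.comp_simple (not_adjacent_of_off_ne_zero h0)

/-- Separation of joint eigenvectors: a subspace stable under diagonal operators with distinct joint
eigenvalues contains every basis vector that occurs in one of its elements. -/
theorem single_mem_of_diagonal {Z ι : Type*} {S : Submodule K (Z →₀ K)}
    (L : ι → (Z →₀ K) →ₗ[K] (Z →₀ K)) (ω : ι → Z → K)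
    (hL : ∀ i z, L i (Finsupp.single z 1) = ω i z • Finsupp.single z 1)
    (hω : ∀ z z', (∀ i, ω i z = ω i z') → z = z') (hS : ∀ i, ∀ x ∈ S, L i x ∈ S)
    {x : Z →₀ K} (hx : x ∈ S) {z : Z} (hz : x z ≠ 0) : Finsupp.single z 1 ∈ S := by
  have hval : ∀ i x z, L i x z = ω i z * x z := by
    intro i x z
    have h : Finsupp.lapply z ∘ₗ L i = ω i z • (Finsupp.lapply z : (Z →₀ K) →ₗ[K] K) := by
      refine Finsupp.lhom_ext' fun w => LinearMap.ext_ring ?_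
      simp only [LinearMap.comp_apply, Finsupp.lsingle_apply, hL, LinearMap.smul_apply,
        Finsupp.lapply_apply, Finsupp.smul_apply]
      by_cases hw : w = z
      · rw [hw]
      · simp [Finsupp.single_eq_of_ne' hw]
    exact LinearMap.congr_fun h x
  induction hc : x.support.card using Nat.strong_induction_on generalizing x with
  | _ c ih =>
    by_cases h : ∃ z' ∈ x.support, z' ≠ z
    · obtain ⟨z', hz', hne⟩ := h
      obtain ⟨i, hi⟩ : ∃ i, ω i z' ≠ ω i z := by
        by_contra! hcon
        exact hne (hω _ _ hcon)
      -- This kills the coefficient at `z'` and only rescales the others, the one at `z` by a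
      -- non-zero factor, so the support shrinks.
      let y := L i x - ω i z' • x
      have hy : ∀ w, y w = (ω i w - ω i z') * x w := by
        intro w
        simp only [y, Finsupp.sub_apply, Finsupp.smul_apply, hval, smul_eq_mul]
        ring
      have hyS : y ∈ S := S.sub_mem (hS i x hx) (S.smul_mem _ hx)
      refine ih y.support.card ?_ hyS ?_ rfl
      · rw [← hc]
        refine Finset.card_lt_card ⟨fun w hw => ?_, fun hsub => ?_⟩
        · rw [Finsupp.mem_support_iff, hy] at hw
          exact Finsupp.mem_support_iff.2 (right_ne_zero_of_mul hw)
        · have := hsub hz'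
          rw [Finsupp.mem_support_iff, hy] at this
          simp at this
      · rw [hy]
        exact mul_ne_zero (sub_ne_zero.2 hi.symm) hz
    · push Not at h
      have hx' : x = x z • Finsupp.single z 1 := by
        ext w
        by_cases hw : w = z
        · rw [hw]; simp
        · rw [Finsupp.smul_apply, Finsupp.single_eq_of_ne hw, smul_zero]
          by_contra h0
          exact hw (h w (Finsupp.mem_support_iff.2 h0))
      have h1 := S.smul_mem (x z)⁻¹ hx
      rw [hx', smul_smul] at h1
      simpa [hz] using h1

/-- The weights determine a standard bitableau. -/
theorem IsStandardBi.eq_of_wt {θ θ' : YoungDiagram} {f g : Fin n → Box}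
    (hf : IsStandardBi n (columnShape n θ) f) (hg : IsStandardBi n (columnShape n θ') g)
    (h : ∀ a, wt (f a) = wt (g a)) : f = g := by
  -- Equal weights put `f a` and `g a` on the same diagonal, or both in the column, so one is weakly
  -- north-west of the other. If it is `f a`, this box is filled in `g` by some `b ≤ a`; `b < a`
  -- would give `f b = g b = f a`.
  have key : ∀ {θ θ' : YoungDiagram} {f g : Fin n → Box}, IsStandardBi n (columnShape n θ) f →
      IsStandardBi n (columnShape n θ') g → (∀ a, wt (f a) = wt (g a)) → ∀ a,
      (∀ b < a, f b = g b) → (f a).2.1 ≤ (g a).2.1 → f a = g a := by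
    intro θ θ' f g hf hg h a ih hle
    obtain ⟨h1, h2⟩ := wt_eq_iff.1 (h a)
    have h3 : (f a).2.2 ≤ (g a).2.2 := by
      rcases fin_two_cases (f a).1 with h4 | h4
      · have := h2 h4
        unfold content at this
        omega
      · rw [hf.snd_eq_zero h4]
        exact Nat.zero_le _
    obtain ⟨b, hb, hb'⟩ := hg.exists_le a hle h3
    rcases hb.eq_or_lt with rfl | hlt
    · rw [hb', ← h1]
    · have h5 := ih b hlt
      rw [hb', ← h1] at h5
      exact absurd (hf.injective h5) hlt.ne
  funext a
  induction ha : (a : ℕ) using Nat.strong_induction_on generalizing a with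
  | _ k ih =>
    have ih' : ∀ b < a, f b = g b := fun b hb => ih b (ha ▸ hb) b rfl
    rcases le_total (f a).2.1 (g a).2.1 with hle | hle
    · exact key hf hg h a ih' hle
    · exact (key hg hf (fun a => (h a).symm) a (fun b hb => (ih' b hb).symm) hle).symm

theorem IsStandardBi.shape_eq {θ θ' : YoungDiagram} {f : Fin n → Box}
    (hf : IsStandardBi n (columnShape n θ) f) (hg : IsStandardBi n (columnShape n θ') f) :
    θ = θ' := by
  ext c
  have h1 := hf.bijOn.image_eq.symm.trans hg.bijOn.image_eq
  have h2 := Set.ext_iff.1 h1 (0, c)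
  exact h2

/-- A subspace stable under the generators that contains a standard bitableau contains all those of
the same shape. -/
theorem Admissible.single_mem_of_shape (hP : Admissible P) {S : Submodule K ({f // P f} →₀ K)}
    (hS : ∀ i, ∀ x ∈ S, fillT P i x ∈ S) {θ : YoungDiagram} {f g : {f // P f}}
    (hf : IsStandardBi n (columnShape n θ) f.1) (hg : IsStandardBi n (columnShape n θ) g.1)
    (hmem : Finsupp.single f 1 ∈ S) : Finsupp.single g 1 ∈ S := by
  -- `r a` is the entry of `g` in the box where `f` has `a`, so `f = g` means `r = id`. Exchanging
  -- neighbours that `r` puts out of order increases `∑ a * r a`, which is bounded; the induction is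
  -- on the remaining gap.
  have hr : ∀ a, ∃ b, g.1 b = f.1 a := fun a => hg.exists_eq (hf.mem a)
  choose r hr using hr
  have hbound : ∀ r : Fin n → Fin n, ∑ a : Fin n, (a : ℕ) * (r a : ℕ) ≤ n * (n * n) := by
    intro r
    refine (Finset.sum_le_card_nsmul _ _ (n * n) fun a _ => ?_).trans (by simp)
    exact Nat.mul_le_mul a.2.le (r a).2.le
  obtain ⟨N, hN⟩ : ∃ N, N = n * (n * n) - ∑ a : Fin n, (a : ℕ) * (r a : ℕ) := ⟨_, rfl⟩
  induction N using Nat.strong_induction_on generalizing f r with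
  | _ N ih =>
    have hinj : Function.Injective r := fun a b hab => hf.injective (by rw [← hr, ← hr, hab])
    by_cases hmono : ∀ i : Fin (n - 1), r (lo i) < r (hi i)
    · have hlt : ∀ d : ℕ, ∀ a b : Fin n, (b : ℕ) = a + d + 1 → r a < r b := by
        intro d
        induction d with
        | zero =>
          intro a b hab
          have := hmono ⟨a, by omega⟩
          rwa [show lo ⟨(a : ℕ), _⟩ = a from rfl,
            show hi ⟨(a : ℕ), by omega⟩ = b from Fin.ext hab.symm] at this
        | succ d ihd =>
          intro a b hab
          have h1 := ihd a ⟨a + d + 1, by omega⟩ rfl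
          have h2 := hmono ⟨a + d + 1, by omega⟩
          rw [show hi ⟨(a : ℕ) + d + 1, by omega⟩ = b from Fin.ext hab.symm] at h2
          exact h1.trans h2
      have hsm : StrictMono r := fun a b hab =>
        hlt (b - a - 1) a b (by rw [Fin.lt_def] at hab; omega)
      have hid : r = id := by
        funext a
        exact le_antisymm hsm.apply_le hsm.le_apply
      have hfg : f = g := Subtype.ext (funext fun a => by rw [← hr a, hid]; rfl)
      rwa [← hfg]
    · push Not at hmono
      obtain ⟨i, hi'⟩ := hmono
      have hlt : r (hi i) < r (lo i) :=
        lt_of_le_of_ne hi' fun h => (lo_lt_hi i).ne (hinj h).symm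
      -- In one row or column, the standardness of `g` would put `r (lo i)` before `r (hi i)`.
      have hne : (f.1 (lo i)).1 = (f.1 (hi i)).1 →
          (f.1 (lo i)).2.1 ≠ (f.1 (hi i)).2.1 ∧ (f.1 (lo i)).2.2 ≠ (f.1 (hi i)).2.2 := by
        intro h1
        refine ⟨fun h2 => ?_, fun h2 => ?_⟩
        · have h3 := hf.row_adjacent h1 h2
          exact absurd (hg.mono (a := r (lo i)) (b := r (hi i)) (by rw [hr, hr, h1])
            (by rw [hr, hr, h2]) (by rw [hr, hr, h3]; exact Nat.le_succ _)) (not_le.2 hlt)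
        · have h3 := hf.col_adjacent h1 h2
          exact absurd (hg.mono (a := r (lo i)) (b := r (hi i)) (by rw [hr, hr, h1])
            (by rw [hr, hr, h3]; exact Nat.le_succ _) (by rw [hr, hr, h2])) (not_le.2 hlt)
      have h0 := hf.off_ne_zero hne
      have hc := hP.closed f.1 f.2 i h0
      have hmem' : Finsupp.single ⟨_, hc⟩ 1 ∈ S := by
        -- Subtracting the diagonal term and dividing by the non-zero `off` leaves the vector of the
        -- exchanged filling.
        have h1 := hS i _ hmem
        rw [fillT_single, vecP_of hc] at h1
        exact (S.smul_mem_iff h0).1 ((S.add_mem_iff_right (S.smul_mem _ hmem)).1 h1)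
      refine ih _ ?_ (hf.comp_simple hne) hmem' (r ∘ simple i) (fun a => hr _) rfl
      have hsum : ∑ a : Fin n, (a : ℕ) * (r a : ℕ) <
          ∑ a : Fin n, (a : ℕ) * ((r ∘ simple i) a : ℕ) := by
        rw [← Nat.cast_lt (α := ℤ), ← sub_pos, Nat.cast_sum, Nat.cast_sum,
          ← Finset.sum_sub_distrib, Finset.sum_eq_add (lo i) (hi i) (lo_lt_hi i).ne]
        · simp only [Function.comp_apply, simple_lo, simple_hi, Nat.cast_mul, coe_lo, coe_hi]
          rw [Fin.lt_def] at hlt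
          push_cast
          nlinarith
        · intro a _ ha
          rw [Function.comp_apply, simple_of_ne ha.1 ha.2, sub_self]
        · simp
        · simp
      have := hbound r
      have := hbound (r ∘ simple i)
      omega

end Fill

/-! ### Irreducibility and weights -/

section Intertwine

variable {m : ℕ} {M N : Type*} [AddCommGroup M] [Module K M] [AddCommGroup N] [Module K N]
  {x : Module.End K M} {t : Fin m → Module.End K M}
  {y : Module.End K N} {u : Fin m → Module.End K N}

theorem jm_mem {S : Submodule K M} (hx : ∀ v ∈ S, x v ∈ S) (ht : ∀ i, ∀ v ∈ S, t i v ∈ S) (k : ℕ) :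
    ∀ v ∈ S, jm x t k v ∈ S := by
  induction k with
  | zero => exact hx
  | succ k ih =>
    intro v hv
    rw [jm]
    split_ifs with h
    · exact S.smul_mem _ (ht _ _ (ih _ (ht _ _ hv)))
    · exact S.zero_mem

theorem jm_map {φ : M →ₗ[K] N} (hx : ∀ v, φ (x v) = y (φ v)) (ht : ∀ i v, φ (t i v) = u i (φ v))
    (k : ℕ) (v : M) : φ (jm x t k v) = jm y u k (φ v) := by
  induction k generalizing v with
  | zero => exact hx v
  | succ k ih =>
    rw [jm, jm]
    split_ifs with h
    · simp only [LinearMap.smul_apply, Module.End.mul_apply, map_smul, ht, ih]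
    · simp

end Intertwine

section Fill

variable {n : ℕ} [NeZero n]

theorem Admissible.single_mem {P : (Fin n → Box) → Prop} (hP : Admissible P)
    {S : Submodule K ({f // P f} →₀ K)}
    (hX : ∀ v ∈ S, fillX P v ∈ S) (hT : ∀ i, ∀ v ∈ S, fillT P i v ∈ S)
    {v : {f // P f} →₀ K} (hv : v ∈ S) {f : {f // P f}} (hf : v f ≠ 0) :
    Finsupp.single f 1 ∈ S := by
  refine single_mem_of_diagonal (fun k : Fin n => jm (fillX P) (fillT P) k)
    (fun k f => wt (f.1 k)) (fun k f => hP.jm_single k k.2 f) ?_ (fun k => jm_mem hX hT k) hv hf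
  intro f g hfg
  obtain ⟨θ, hθ⟩ := hP.std f.1 f.2
  obtain ⟨θ', hθ'⟩ := hP.std g.1 g.2
  exact Subtype.ext (hθ.eq_of_wt hθ' hfg)

/-- The seminormal modules are irreducible. -/
theorem eq_top_of_stable {θ : YoungDiagram}
    {S : Submodule K (BiModule n (columnShape n θ))}
    (hX : ∀ v ∈ S, fillX (IsStandardBi n (columnShape n θ)) v ∈ S)
    (hT : ∀ i, ∀ v ∈ S, fillT (IsStandardBi n (columnShape n θ)) i v ∈ S) (hS : S ≠ ⊥) : S = ⊤ := by
  obtain ⟨v, hv, hv0⟩ := (Submodule.ne_bot_iff S).1 hS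
  obtain ⟨f, hf⟩ := Finsupp.ne_iff.1 hv0
  have h1 := (admissible_standard θ).single_mem hX hT hv hf
  rw [eq_top_iff]
  intro w _
  rw [← w.sum_single]
  refine S.sum_mem fun g _ => ?_
  have h2 := S.smul_mem (w g)
    ((admissible_standard θ).single_mem_of_shape hT f.2 g.2 h1)
  rwa [Finsupp.smul_single, smul_eq_mul, mul_one] at h2

/-- Intertwiners commute with Jucys-Murphy elements. So a bitableau `g` occurring in the image of
`f` has the weights of `f`, hence equals it as a filling, and a filling determines its shape. -/
theorem shape_eq_of_intertwine {θ θ' : YoungDiagram} (f : StandardBitableau n (columnShape n θ))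
    {φ : BiModule n (columnShape n θ) →ₗ[K] BiModule n (columnShape n θ')}
    (hX : ∀ v, φ (fillX (IsStandardBi n (columnShape n θ)) v) =
      fillX (IsStandardBi n (columnShape n θ')) (φ v))
    (hT : ∀ i v, φ (fillT (IsStandardBi n (columnShape n θ)) i v) =
      fillT (IsStandardBi n (columnShape n θ')) i (φ v))
    (hφ : φ (Finsupp.single f 1) ≠ 0) : θ = θ' := by
  obtain ⟨g, hg⟩ := Finsupp.ne_iff.1 hφ
  have h1 := (admissible_standard θ').single_mem (S := LinearMap.range φ)
    (by rintro _ ⟨v, rfl⟩; exact ⟨_, hX v⟩) (by rintro i _ ⟨v, rfl⟩; exact ⟨_, hT i v⟩)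
    ⟨_, rfl⟩ hg
  have hval : ∀ k : Fin n, wt (f.1 k) = wt (g.1 k) := by
    intro k
    have h2 := jm_map (φ := φ) hX hT k (Finsupp.single f 1)
    rw [(admissible_standard θ).jm_single k k.2, map_smul] at h2
    have h3 : ∀ x : BiModule n (columnShape n θ'), jm (fillX (IsStandardBi n (columnShape n θ')))
        (fillT (IsStandardBi n (columnShape n θ'))) k x g = wt (g.1 k) * x g := by
      intro x
      have h : Finsupp.lapply g ∘ₗ jm (fillX (IsStandardBi n (columnShape n θ')))
          (fillT (IsStandardBi n (columnShape n θ'))) k =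
          wt (g.1 k) • (Finsupp.lapply g : _ →ₗ[K] K) := by
        refine Finsupp.lhom_ext' fun w => LinearMap.ext_ring ?_
        simp only [LinearMap.comp_apply, Finsupp.lsingle_apply, LinearMap.smul_apply,
          (admissible_standard θ').jm_single k k.2, Finsupp.lapply_apply, Finsupp.smul_apply]
        by_cases hw : w = g
        · rw [hw]
        · simp [Finsupp.single_eq_of_ne' hw]
      exact LinearMap.congr_fun h x
    have h4 := DFunLike.congr_fun h2 g
    rw [h3, Finsupp.smul_apply, smul_eq_mul] at h4
    exact mul_right_cancel₀ hg h4
  have hfg := f.2.eq_of_wt g.2 hval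
  exact f.2.shape_eq (hfg ▸ g.2)

end Fill

/-- Every Young diagram has a standard tableau. -/
theorem exists_standardTableau (θ : YoungDiagram) : Nonempty (StandardTableau θ) := by
  classical
  -- The boxes are numbered row by row, that is, in lexicographic order.
  let s : Finset (ℕ ×ₗ ℕ) := θ.cells.map toLex.toEmbedding
  have hs : s.card = θ.card := by simp [s]
  let e := s.orderIsoOfFin hs
  have he : ∀ a, ofLex (e a).1 ∈ θ := by
    intro a
    obtain ⟨c, hc, hc'⟩ := Finset.mem_map.1 (e a).2
    rw [← hc']
    exact hc
  refine ⟨⟨fun a => ofLex (e a).1, ⟨⟨fun a _ => he a, ?_, ?_⟩, ?_, ?_⟩⟩⟩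
  · exact fun a _ b _ hab => e.injective (Subtype.ext hab)
  · intro c hc
    refine ⟨e.symm ⟨toLex c, Finset.mem_map.2 ⟨c, hc, rfl⟩⟩, Set.mem_univ _, ?_⟩
    simp
  · intro a b h1 h2
    refine e.lt_iff_lt.1 (Prod.Lex.lt_iff.2 (.inr ⟨h1, h2⟩))
  · intro a b h1 h2
    exact e.lt_iff_lt.1 (Prod.Lex.lt_iff.2 (.inl h2))

/-! ### Bitableaux in which the column comes last -/

section Base

variable {n : ℕ} {θ : YoungDiagram}

/-- The pair of a tableau and a column, in which the column comes last. -/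
def baseFilling (n : ℕ) (f : Fin θ.card → ℕ × ℕ) : Fin n → Box := fun a =>
  if h : (a : ℕ) < θ.card then (0, f ⟨a, h⟩) else (1, ((a : ℕ) - θ.card, 0))

theorem isStandardBi_baseFilling (hθ : θ.card ≤ n) {f : Fin θ.card → ℕ × ℕ} :
    IsStandardBi n (columnShape n θ) (baseFilling n f) ↔ IsStandard θ f := by
  have hval : ∀ a : Fin θ.card, baseFilling n f ⟨a, by omega⟩ = (0, f a) := fun a => dif_pos a.2
  constructor
  · intro h
    refine ⟨⟨fun a _ => ?_, fun a _ b _ hab => ?_, fun c hc => ?_⟩, fun a b h1 h2 => ?_,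
      fun a b h1 h2 => ?_⟩
    · have := h.mem ⟨a, by omega⟩
      rwa [hval] at this
    · have hinj := h.injective
      have := @hinj ⟨a, by omega⟩ ⟨b, by omega⟩ (by rw [hval, hval, hab])
      exact Fin.ext (Fin.mk.inj_iff.1 this)
    · obtain ⟨a, ha⟩ := h.exists_eq (c := (0, c)) hc
      unfold baseFilling at ha
      split_ifs at ha with h'
      · exact ⟨⟨a, h'⟩, Set.mem_univ _, congrArg Prod.snd ha⟩
      · simp at ha
    · have := h.row_increasing ⟨a, by omega⟩ ⟨b, by omega⟩
      simp only [hval] at this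
      exact this trivial h1 h2
    · have := h.col_increasing ⟨a, by omega⟩ ⟨b, by omega⟩
      simp only [hval] at this
      exact this trivial h1 h2
  · intro h
    refine ⟨⟨fun a _ => ?_, fun a _ b _ hab => ?_, fun c hc => ?_⟩, fun a b h0 h1 h2 => ?_,
      fun a b h0 h1 h2 => ?_⟩
    · unfold baseFilling
      split_ifs with h'
      · exact h.bijOn.mapsTo (Set.mem_univ (⟨a, h'⟩ : Fin θ.card))
      · exact show ((a : ℕ) - θ.card, 0) ∈ column (n - θ.card) from
          mem_column.2 ⟨by have := a.2; simp only; omega, rfl⟩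
    · unfold baseFilling at hab
      split_ifs at hab with ha hb hb
      · exact Fin.ext (Fin.mk.inj_iff.1 (h.bijOn.injOn (Set.mem_univ _) (Set.mem_univ _)
          (congrArg Prod.snd hab)))
      · simp at hab
      · simp at hab
      · simp only [Prod.mk.injEq, and_true, true_and] at hab
        exact Fin.ext (by omega)
    · obtain ⟨j, r, c⟩ := c
      rcases fin_two_cases j with rfl | rfl
      · obtain ⟨a, -, ha⟩ := h.bijOn.surjOn hc
        exact ⟨⟨a, by omega⟩, Set.mem_univ _, by rw [hval, ha]⟩
      · obtain ⟨h1, h2⟩ := mem_column.1 hc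
        simp only at h1 h2
        refine ⟨⟨r + θ.card, by omega⟩, Set.mem_univ _, ?_⟩
        simp [baseFilling, h2]
    · unfold baseFilling at h0 h1 h2
      split_ifs at h0 h1 h2 with ha hb hb
      · exact h.row_increasing ⟨a, ha⟩ ⟨b, hb⟩ h1 h2
      · simp at h0
      · simp at h0
      · simp at h2
    · unfold baseFilling at h0 h1 h2
      split_ifs at h0 h1 h2 with ha hb hb
      · exact h.col_increasing ⟨a, ha⟩ ⟨b, hb⟩ h1 h2
      · simp at h0
      · simp at h0
      · simp only at h2
        rw [Fin.lt_def]
        omega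

theorem baseFilling_injective (hθ : θ.card ≤ n) {f g : Fin θ.card → ℕ × ℕ}
    (h : baseFilling n f = baseFilling n g) : f = g := by
  funext a
  have := congrFun h ⟨a, by omega⟩
  simpa [baseFilling] using this

end Base

/-! ### Moving the two components of a filling past each other -/

section Mover

variable {m : ℕ} {A : Type*} [Ring A] [Algebra K A]

/-- The `τ i` satisfy the mixed braid relations with the `t i`; the examples are `τ = t` and
`τ = t⁻¹`. -/
structure IsMover (t τ : Fin m → A) : Prop where
  comm : ∀ i j : Fin m, ((i : ℕ) + 2 ≤ j ∨ (j : ℕ) + 2 ≤ i) → τ i * τ j = τ j * τ i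
  comm_left : ∀ i j : Fin m, ((i : ℕ) + 2 ≤ j ∨ (j : ℕ) + 2 ≤ i) → t i * τ j = τ j * t i
  slide : ∀ i j : Fin m, ((i : ℕ) + 1 = j ∨ (j : ℕ) + 1 = i) → t i * τ j * τ i = τ j * τ i * t j

theorem IsHecke.isMover {t : Fin m → A} (h : IsHecke t) : IsMover t t := by
  have hc : ∀ i j : Fin m, ((i : ℕ) + 2 ≤ j ∨ (j : ℕ) + 2 ≤ i) → t i * t j = t j * t i := by
    rintro i j (hij | hij)
    · exact h.comm i j hij
    · exact (h.comm j i hij).symm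
  refine ⟨hc, hc, ?_⟩
  rintro i j (hij | hij)
  · exact h.braid i j hij
  · exact (h.braid j i hij).symm

/-- The inverse of a generator of the Hecke algebra. -/
noncomputable def heckeInv (t : Fin m → A) (i : Fin m) : A := (q⁻¹ : K) • (t i - (q - 1) • 1)

theorem IsHecke.mul_inv {t : Fin m → A} (h : IsHecke t) (i : Fin m) : t i * heckeInv t i = 1 := by
  rw [heckeInv, mul_smul_comm, mul_sub, h.quadratic, mul_smul_comm, mul_one, add_sub_cancel_left,
    smul_smul, inv_mul_cancel₀ q_ne_zero, one_smul]

theorem IsHecke.inv_mul {t : Fin m → A} (h : IsHecke t) (i : Fin m) : heckeInv t i * t i = 1 := by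
  rw [heckeInv, smul_mul_assoc, sub_mul, h.quadratic, smul_mul_assoc, one_mul, add_sub_cancel_left,
    smul_smul, inv_mul_cancel₀ q_ne_zero, one_smul]

theorem heckeInv_comm {t : Fin m → A} {i : Fin m} {a : A} (h : a * t i = t i * a) :
    a * heckeInv t i = heckeInv t i * a := by
  simp only [heckeInv, mul_smul_comm, smul_mul_assoc, mul_sub, sub_mul, h, mul_one, one_mul]

/-- The mixed relation `t_i t_j⁻¹ t_i⁻¹ = t_j⁻¹ t_i⁻¹ t_j` is the braid relation multiplied by
inverses on both sides. -/
theorem IsHecke.isMover_inv {t : Fin m → A} (h : IsHecke t) : IsMover t (heckeInv t) := by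
  have hc := h.isMover.comm
  refine ⟨fun i j hij => heckeInv_comm (heckeInv_comm (hc j i hij.symm)).symm,
    fun i j hij => heckeInv_comm (hc i j hij), fun i j hij => ?_⟩
  have e1 := h.isMover.slide i j hij
  have hi' := h.mul_inv i
  have hj' := h.mul_inv j
  have hi := h.inv_mul i
  have hj := h.inv_mul j
  calc t i * heckeInv t j * heckeInv t i
      = (heckeInv t j * (heckeInv t i * t i) * t j) * t i * heckeInv t j * heckeInv t i := by
        rw [hi, mul_one, hj, one_mul]
    _ = heckeInv t j * heckeInv t i * (t i * t j * t i) * heckeInv t j * heckeInv t i := by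
        simp only [mul_assoc]
    _ = heckeInv t j * heckeInv t i * t j * (t i * (t j * heckeInv t j) * heckeInv t i) := by
        rw [e1]; simp only [mul_assoc]
    _ = heckeInv t j * heckeInv t i * t j := by rw [hj', mul_one, hi', mul_one]

end Mover

section Descent

variable {n : ℕ} (A : Fin 2)

/-- The component `A` comes right after another one. -/
def IsDescent (f : Fin n → Box) (i : Fin (n - 1)) : Prop := (f (lo i)).1 ≠ A ∧ (f (hi i)).1 = A

/-- The sum of the positions of the entries of the component `A`. -/
def position (f : Fin n → Box) : ℕ := ∑ a : Fin n, if (f a).1 = A then (a : ℕ) else 0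

variable {A}

theorem IsDescent.position_lt {f : Fin n → Box} {i : Fin (n - 1)} (h : IsDescent A f i) :
    position A (f ∘ simple i) < position A f := by
  unfold position
  rw [← Nat.cast_lt (α := ℤ), ← sub_pos, Nat.cast_sum, Nat.cast_sum,
    ← Finset.sum_sub_distrib, Finset.sum_eq_add (lo i) (hi i) (lo_lt_hi i).ne]
  · simp only [Function.comp_apply, simple_lo, simple_hi, h.2, if_true, if_neg h.1, coe_lo, coe_hi]
    push_cast
    omega
  · intro a _ ha
    rw [Function.comp_apply, simple_of_ne ha.1 ha.2, sub_self]
  · simp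
  · simp

variable {N : Type*} [AddCommGroup N] [Module K N]

open Classical in
/-- The family of vectors obtained from the values `e₀` on fillings without descents by the
operators `τ i`. -/
noncomputable def movedVec (A : Fin 2) (τ : Fin (n - 1) → Module.End K N) (e₀ : (Fin n → Box) → N)
    (f : Fin n → Box) : N :=
  if h : ∃ i, IsDescent A f i then τ h.choose (movedVec A τ e₀ (f ∘ simple h.choose)) else e₀ f
termination_by position A f
decreasing_by exact h.choose_spec.position_lt

variable {t τ : Fin (n - 1) → Module.End K N} {e₀ : (Fin n → Box) → N}

theorem movedVec_base {f : Fin n → Box} (h : ∀ i, ¬IsDescent A f i) :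
    movedVec A τ e₀ f = e₀ f := by
  rw [movedVec, dif_neg (not_exists.2 h)]

theorem simple_fixed {i j : Fin (n - 1)} (h : (i : ℕ) + 2 ≤ j ∨ (j : ℕ) + 2 ≤ i) :
    simple i (lo j) = lo j ∧ simple i (hi j) = hi j := by
  simp only [Fin.ext_iff, coe_simple, coe_lo, coe_hi]
  grind

theorem comp_simple_comm {i j : Fin (n - 1)} (h : (i : ℕ) + 2 ≤ j ∨ (j : ℕ) + 2 ≤ i)
    (f : Fin n → Box) : (f ∘ simple i) ∘ simple j = (f ∘ simple j) ∘ simple i := by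
  funext a
  rcases h with h | h
  · exact congrArg f (simple_comm h a)
  · exact congrArg f (simple_comm h a).symm

theorem IsDescent.comp_simple {f : Fin n → Box} {i j : Fin (n - 1)} (hj : IsDescent A f j)
    (h : (i : ℕ) + 2 ≤ j ∨ (j : ℕ) + 2 ≤ i) : IsDescent A (f ∘ simple i) j := by
  obtain ⟨h1, h2⟩ := simple_fixed h
  rwa [IsDescent, Function.comp_apply, Function.comp_apply, h1, h2]

/-- At neighbouring places the middle entry would be both inside and outside the component `A`. -/
theorem IsDescent.far {f : Fin n → Box} {i j : Fin (n - 1)} (hi' : IsDescent A f i)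
    (hj : IsDescent A f j) (hij : i ≠ j) : (i : ℕ) + 2 ≤ j ∨ (j : ℕ) + 2 ≤ i := by
  by_contra! hcon
  rcases lt_or_gt_of_ne (Fin.val_ne_of_ne hij) with h | h
  · have h1 : lo j = hi i := lo_eq_hi (by omega)
    exact hj.1 (h1 ▸ hi'.2)
  · have h1 : lo i = hi j := lo_eq_hi (by omega)
    exact hi'.1 (h1 ▸ hj.2)

/-- The definition chooses one descent; a diamond argument shows that any other would do. Distinct
descents are far apart, so both the exchanges and the operators `τ` commute, and induction on
`position` applies to the two shorter fillings. -/
theorem movedVec_descent (hτ : IsMover t τ) {f : Fin n → Box} {i : Fin (n - 1)}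
    (hi' : IsDescent A f i) :
    movedVec A τ e₀ f = τ i (movedVec A τ e₀ (f ∘ simple i)) := by
  induction hN : position A f using Nat.strong_induction_on generalizing f i with
  | _ N ih =>
    have hex : ∃ i, IsDescent A f i := ⟨i, hi'⟩
    rw [movedVec, dif_pos hex]
    have hj := hex.choose_spec
    set j := hex.choose
    by_cases hij : i = j
    · rw [hij]
    · have hfar := hi'.far hj hij
      rw [ih _ (hN ▸ hj.position_lt) (hi'.comp_simple hfar.symm) rfl,
        ih _ (hN ▸ hi'.position_lt) (hj.comp_simple hfar) rfl, comp_simple_comm hfar.symm]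
      exact LinearMap.congr_fun (hτ.comm j i hfar.symm) _

theorem fixed_of_succ {i j : Fin (n - 1)} (h : (i : ℕ) + 1 = j) :
    simple j (lo i) = lo i ∧ simple i (hi j) = hi j ∧ lo j = hi i ∧ simple j (hi i) = hi j ∧
      simple j (hi j) = hi i ∧ simple i (lo i) = hi i ∧ simple i (hi i) = lo i := by
  obtain ⟨e1, e2⟩ := lo_ne_of_lt h
  have e3 := lo_eq_hi h
  exact ⟨e1, e2, e3, by rw [← e3, simple_lo], by rw [simple_hi, e3], simple_lo i, simple_hi i⟩

/-- The vectors `movedVec` transform under the generators that preserve the components by the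
seminormal formulas. -/
theorem movedVec_same (hτ : IsMover t τ) {P : (Fin n → Box) → Prop}
    (hP : ∀ f, P f → ∀ i, (f (lo i)).1 ≠ (f (hi i)).1 → P (f ∘ simple i))
    (h₀ : ∀ f, P f → (∀ i, ¬IsDescent A f i) → ∀ i, (f (lo i)).1 = (f (hi i)).1 →
      t i (e₀ f) = diag (f (lo i)) (f (hi i)) • e₀ f +
        off (f (lo i)) (f (hi i)) • e₀ (f ∘ simple i))
    {f : Fin n → Box} (hf : P f) {i : Fin (n - 1)} (hi' : (f (lo i)).1 = (f (hi i)).1) :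
    t i (movedVec A τ e₀ f) = diag (f (lo i)) (f (hi i)) • movedVec A τ e₀ f +
      off (f (lo i)) (f (hi i)) • movedVec A τ e₀ (f ∘ simple i) := by
  induction hN : position A f using Nat.strong_induction_on generalizing f i with
  | _ N ih =>
    have hPd : ∀ {f j}, P f → IsDescent A f j → P (f ∘ simple j) := fun hf hj =>
      hP _ hf _ fun h => hj.1 (h.trans hj.2)
    by_cases hs : ∀ j, ¬IsDescent A f j
    · have hs' : ∀ j, ¬IsDescent A (f ∘ simple i) j := by
        have hc : ∀ a, (f (simple i a)).1 = (f a).1 := by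
          intro a
          by_cases h1 : a = lo i
          · rw [h1, simple_lo, hi']
          by_cases h2 : a = hi i
          · rw [h2, simple_hi, hi']
          rw [simple_of_ne h1 h2]
        intro j hj
        refine hs j ?_
        rwa [IsDescent, Function.comp_apply, Function.comp_apply, hc, hc] at hj
      rw [movedVec_base hs, movedVec_base hs', h₀ f hf hs i hi']
    · push Not at hs
      obtain ⟨j, hj⟩ := hs
      have hij : i ≠ j := by rintro rfl; exact hj.1 (hi'.trans hj.2)
      have hlt := hj.position_lt
      by_cases hfar : (i : ℕ) + 2 ≤ j ∨ (j : ℕ) + 2 ≤ i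
      · obtain ⟨h1, h2⟩ := simple_fixed hfar.symm
        have h3 := ih _ (hN ▸ hlt) (hPd hf hj) (i := i)
          (by rwa [Function.comp_apply, Function.comp_apply, h1, h2]) rfl
        rw [Function.comp_apply, Function.comp_apply, h1, h2] at h3
        rw [movedVec_descent hτ hj, movedVec_descent hτ (hj.comp_simple hfar),
          comp_simple_comm hfar, ← map_smul, ← map_smul, ← map_add, ← h3]
        exact LinearMap.congr_fun (hτ.comm_left i j hfar) _
      -- The descent is next to `i`: either one entry of `A` passes the two entries at `lo i`, `hi
      -- i` outside `A`, or one entry outside `A` passes two entries of `A`. In both cases two moves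
      -- shift the pair by one place, and `slide` replaces `t i` by `t j`.
      rcases lt_or_gt_of_ne (Fin.val_ne_of_ne hij) with hlt' | hlt'
      · have hs : (i : ℕ) + 1 = j := by omega
        obtain ⟨e1, e2, e3, e4, e5, e6, e7⟩ := fixed_of_succ hs
        have hd1 : IsDescent A (f ∘ simple j) i := by
          simp only [IsDescent, Function.comp_apply, e1, e4]
          exact ⟨fun h => hj.1 (e3 ▸ hi' ▸ h), hj.2⟩
        have hd2 : IsDescent A (f ∘ simple i) j := by
          simp only [IsDescent, Function.comp_apply, e2, e3, e7]
          exact ⟨fun h => hj.1 (e3 ▸ hi' ▸ h), hj.2⟩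
        have hd3 : IsDescent A ((f ∘ simple i) ∘ simple j) i := by
          simp only [IsDescent, Function.comp_apply, e1, e2, e4, e6]
          exact ⟨fun h => hj.1 (e3 ▸ h), hj.2⟩
        have h3 := ih _ (hN ▸ (hd1.position_lt.trans hlt)) (hPd (hPd hf hj) hd1) (i := j)
          (by simpa only [Function.comp_apply, e1, e2, e3, e4, e5, e6, e7] using hi') rfl
        have hw : ((f ∘ simple j) ∘ simple i) ∘ simple j = ((f ∘ simple i) ∘ simple j) ∘ simple i :=
          funext fun a => congrArg f (simple_braid hs a).symm
        simp only [Function.comp_apply, e1, e2, e3, e5, e7] at h3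
        rw [hw] at h3
        rw [movedVec_descent hτ hj, movedVec_descent hτ hd1, movedVec_descent hτ hd2,
          movedVec_descent hτ hd3]
        simp only [← map_smul, ← map_add]
        rw [← h3]
        exact LinearMap.congr_fun (hτ.slide i j (.inl hs)) _
      · have hs : (j : ℕ) + 1 = i := by omega
        obtain ⟨e1, e2, e3, e4, e5, e6, e7⟩ := fixed_of_succ hs
        have hA : (f (hi i)).1 = A := by rw [← hi', e3, hj.2]
        have hd1 : IsDescent A (f ∘ simple j) i := by
          simp only [IsDescent, Function.comp_apply, e2, e3, e7]
          exact ⟨hj.1, hA⟩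
        have hd2 : IsDescent A (f ∘ simple i) j := by
          simp only [IsDescent, Function.comp_apply, e1, e4]
          exact ⟨hj.1, hA⟩
        have hd3 : IsDescent A ((f ∘ simple i) ∘ simple j) i := by
          simp only [IsDescent, Function.comp_apply, e1, e2, e3, e5, e7]
          exact ⟨hj.1, hj.2⟩
        rw [e3] at hi'
        have h3 := ih _ (hN ▸ (hd1.position_lt.trans hlt)) (hPd (hPd hf hj) hd1) (i := j)
          (by simpa only [Function.comp_apply, e1, e2, e3, e4, e5, e6, e7] using hi') rfl
        have hw : ((f ∘ simple j) ∘ simple i) ∘ simple j = ((f ∘ simple i) ∘ simple j) ∘ simple i :=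
          funext fun a => congrArg f (simple_braid hs a)
        simp only [Function.comp_apply, e1, e2, e4, e6] at h3
        rw [hw] at h3
        rw [movedVec_descent hτ hj, movedVec_descent hτ hd1, movedVec_descent hτ hd2,
          movedVec_descent hτ hd3, e3]
        simp only [← map_smul, ← map_add]
        rw [← h3]
        exact LinearMap.congr_fun (hτ.slide i j (.inr hs)) _

end Descent

/-! ### Comparison with the defining formulas -/

section Formulas

variable {n : ℕ} {θ : YoungDiagram}

/-- With `n = |θ|` the column is empty, so the adjacency results for bitableaux merge the three
defining cases into the uniform formula. -/
theorem seminormalOp_v (T : StandardTableau θ) (j : Fin (θ.card - 1)) :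
    seminormalOp θ j (v T) = diag (0, T.1 (lo j)) (0, T.1 (hi j)) • v T +
      off (0, T.1 (lo j)) (0, T.1 (hi j)) • vecV θ (T.1 ∘ simple j) := by
  have h : IsStandardBi θ.card (columnShape θ.card θ) (baseFilling θ.card T.1) :=
    (isStandardBi_baseFilling le_rfl).2 T.2
  have hv : ∀ a, baseFilling θ.card T.1 a = (0, T.1 a) := fun a => dif_pos a.2
  have h1 := h.diag_row (i := j)
  have h2 := h.diag_col (i := j)
  have h3 := h.goodPair_simple j
  rw [hv, hv] at h1 h2 h3
  rw [seminormalOp, v, lift_single]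
  split_ifs with hr hc
  · have h0 : off (0, T.1 (lo j)) (0, T.1 (hi j)) = 0 := off_eq_zero rfl (.inl hr)
    rw [h1 rfl hr, h0, zero_smul, add_zero]
    rfl
  · have h0 : off (0, T.1 (lo j)) (0, T.1 (hi j)) = 0 := off_eq_zero rfl (.inr hc)
    rw [h2 rfl hc, h0, zero_smul, add_zero, neg_one_smul]
    rfl
  · have h0 : off (0, T.1 (lo j)) (0, T.1 (hi j)) = 1 + diag (0, T.1 (lo j)) (0, T.1 (hi j)) :=
      off_eq rfl (not_or.2 ⟨hr, hc⟩)
    rw [h0, diag_zero_zero rfl rfl]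
    · rfl
    · intro h4
      exact wt_ne_zero rfl (h3 (wt_eq_iff.2 ⟨rfl, fun _ => h4⟩))

theorem fillT_formula (i : Fin (n - 1)) (U : StandardBitableau n (columnShape n θ)) :
    fillT (IsStandardBi n (columnShape n θ)) i (vBi U) =
      if (U.1 (lo i)).1 = (U.1 (hi i)).1 then
        if (U.1 (lo i)).2.1 = (U.1 (hi i)).2.1 then q • vBi U
        else if (U.1 (lo i)).2.2 = (U.1 (hi i)).2.2 then -vBi U
        else
          let a := seminormalCoeff (biContent (U.1 (lo i)) - biContent (U.1 (hi i)))
          a • vBi U + (1 + a) • vecBi n (columnShape n θ) (U.1 ∘ simple i)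
      else if (U.1 (lo i)).1 = 0 then vecBi n (columnShape n θ) (U.1 ∘ simple i)
      else (q - 1) • vBi U + q • vecBi n (columnShape n θ) (U.1 ∘ simple i) := by
  have h := U.2
  have hvec : vecP (IsStandardBi n (columnShape n θ)) (U.1 ∘ simple i) =
    vecBi n (columnShape n θ) (U.1 ∘ simple i) := rfl
  rw [vBi, fillT_single, hvec]
  split_ifs with h1 hr hc h0
  · rw [h.diag_row h1 hr, off_eq_zero h1 (.inl hr), zero_smul, add_zero]
  · rw [h.diag_col h1 hc, off_eq_zero h1 (.inr hc), zero_smul, add_zero, neg_one_smul]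
  -- Two entries of the second component are always in one column, so this branch concerns the first
  -- component.
  · have h2 : (U.1 (lo i)).1 = 0 := by
      refine (fin_two_cases _).resolve_right fun h2 => hc ?_
      rw [h.snd_eq_zero h2, h.snd_eq_zero (h1 ▸ h2)]
    rw [off_eq h1 (by tauto), diag_zero_zero h2 (h1 ▸ h2)]
    · have h3 : biContent (U.1 (lo i)) - biContent (U.1 (hi i)) =
          content (U.1 (lo i)).2 - content (U.1 (hi i)).2 := by
        rw [biContent, biContent, h1]
        ring
      simp only [h3]
    · intro h4
      exact wt_ne_zero h2 (h.goodPair_simple i (wt_eq_iff.2 ⟨h1, fun _ => h4⟩))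
  · have h2 : (U.1 (hi i)).1 = 1 := (fin_two_cases _).resolve_left fun h2 => h1 (h0.trans h2.symm)
    rw [diag_zero_one h0 h2, off_zero_one h0 h2, zero_smul, zero_add, one_smul]
  · have h2 : (U.1 (lo i)).1 = 1 := (fin_two_cases _).resolve_left h0
    have h3 : (U.1 (hi i)).1 = 0 := (fin_two_cases _).resolve_right fun h3 => h1 (h2.trans h3.symm)
    rw [diag_one_zero h2 h3, off_one_zero h2 h3]

end Formulas

/-! ### The positions of the components -/

section Positions

variable {n : ℕ} {θ : YoungDiagram} {f : Fin n → Box}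

theorem mem_iff_lt_card {S : Finset (Fin n)} (h : ∀ i : Fin (n - 1), hi i ∈ S → lo i ∈ S)
    (a : Fin n) : a ∈ S ↔ (a : ℕ) < S.card := by
  have hd : ∀ d : ℕ, ∀ a b : Fin n, (b : ℕ) = a + d → b ∈ S → a ∈ S := by
    intro d
    induction d with
    | zero => exact fun a b hab hb => (Fin.ext hab : b = a) ▸ hb
    | succ d ih =>
      intro a b hab hb
      refine ih a ⟨a + d, by omega⟩ rfl (h ⟨a + d, by omega⟩ ?_)
      rwa [show hi ⟨(a : ℕ) + d, by omega⟩ = b from Fin.ext hab.symm]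
  have hl : ∀ a b : Fin n, a ≤ b → b ∈ S → a ∈ S := fun a b hab =>
    hd (b - a) a b (by rw [Fin.le_def] at hab; omega)
  constructor
  · intro ha
    have : Finset.Iic a ⊆ S := fun b hb => hl b a (Finset.mem_Iic.1 hb) ha
    have := Finset.card_le_card this
    rw [Fin.card_Iic] at this
    omega
  · intro ha
    by_contra hcon
    have : S ⊆ Finset.Iio a := fun b hb =>
      Finset.mem_Iio.2 (lt_of_not_ge fun hab => hcon (hl a b hab hb))
    have := Finset.card_le_card this
    rw [Fin.card_Iio] at this
    omega

theorem IsStandardBi.card_component {μ : Fin 2 → YoungDiagram} (h : IsStandardBi n μ f)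
    (A : Fin 2) : (Finset.univ.filter fun a => (f a).1 = A).card = (μ A).card := by
  refine Finset.card_bij (fun a _ => (f a).2) ?_ ?_ ?_
  · intro a ha
    have := h.mem a
    rwa [(Finset.mem_filter.1 ha).2] at this
  · intro a ha b hb hab
    exact h.injective (Prod.ext ((Finset.mem_filter.1 ha).2.trans (Finset.mem_filter.1 hb).2.symm)
      hab)
  · intro c hc
    obtain ⟨a, ha⟩ := h.exists_eq (c := (A, c)) hc
    exact ⟨a, Finset.mem_filter.2 ⟨Finset.mem_univ _, by rw [ha]⟩, by rw [ha]⟩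

theorem card_column (m : ℕ) : (column m).card = m := by
  change (Finset.range m ×ˢ {0}).card = m
  rw [Finset.card_product, Finset.card_range, Finset.card_singleton, mul_one]

theorem IsStandardBi.component_iff {μ : Fin 2 → YoungDiagram} (h : IsStandardBi n μ f) {A : Fin 2}
    (hs : ∀ i, ¬IsDescent A f i) (a : Fin n) : (f a).1 = A ↔ (a : ℕ) < (μ A).card := by
  rw [← h.card_component A, ← mem_iff_lt_card]
  · simp
  · intro i hi'
    rw [Finset.mem_filter] at hi' ⊢
    refine ⟨Finset.mem_univ _, ?_⟩
    by_contra h0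
    exact hs i ⟨h0, hi'.2⟩

/-- The entries `d + 1, …, d + |θ|`, as a filling of `θ`. -/
def restrictFilling (d : ℕ) (hd : d + θ.card ≤ n) (f : Fin n → Box) : Fin θ.card → ℕ × ℕ :=
  fun a => (f ⟨d + a, by omega⟩).2

theorem IsStandardBi.restrict (h : IsStandardBi n (columnShape n θ) f) {d : ℕ}
    {hd : d + θ.card ≤ n} (hf : ∀ a : Fin n, (f a).1 = 0 ↔ d ≤ a ∧ (a : ℕ) < d + θ.card) :
    IsStandard θ (restrictFilling d hd f) := by
  have hc : ∀ a : Fin θ.card, (f ⟨d + a, by omega⟩).1 = 0 := fun a => (hf _).2 (by simp)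
  refine ⟨⟨fun a _ => ?_, fun a _ b _ hab => ?_, fun c hc' => ?_⟩, fun a b h1 h2 => ?_,
    fun a b h1 h2 => ?_⟩
  · have := h.mem ⟨d + a, by omega⟩
    rw [hc] at this
    exact this
  · have := h.injective (Prod.ext ((hc a).trans (hc b).symm) hab)
    exact Fin.ext (by simpa using this)
  · obtain ⟨a, ha⟩ := h.exists_eq (c := (0, c)) hc'
    obtain ⟨h1, h2⟩ := (hf a).1 (by rw [ha])
    refine ⟨⟨a - d, by omega⟩, Set.mem_univ _, ?_⟩
    have h3 : (⟨d + (a - d), by omega⟩ : Fin n) = a := Fin.ext (by simp only; omega)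
    simp only [restrictFilling, h3, ha]
  · have := h.row_increasing ⟨d + a, by omega⟩ ⟨d + b, by omega⟩
      ((hc a).trans (hc b).symm) h1 h2
    rw [Fin.lt_def] at this ⊢
    simpa using this
  · have := h.col_increasing ⟨d + a, by omega⟩ ⟨d + b, by omega⟩
      ((hc a).trans (hc b).symm) h1 h2
    rw [Fin.lt_def] at this ⊢
    simpa using this

theorem restrictFilling_comp {d : ℕ} (hd : d + θ.card ≤ n) (f : Fin n → Box) {i : Fin (n - 1)}
    {j : Fin (θ.card - 1)} (hij : (i : ℕ) = d + j) :
    restrictFilling d hd (f ∘ simple i) = restrictFilling d hd f ∘ simple j := by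
  funext a
  simp only [restrictFilling, Function.comp_apply]
  congr 2
  simp only [Fin.ext_iff, coe_simple]
  grind

end Positions

/-! ### The universal property of the seminormal modules -/

section Universal

variable {n : ℕ} {θ : YoungDiagram} {N : Type*} [AddCommGroup N] [Module K N]
  {t τ : Fin (n - 1) → Module.End K N}

/-- The vectors attached by a map on `V^θ` to the fillings without descents transform by the
seminormal formulas. -/
theorem base_formula {A : Fin 2} {d : ℕ} (hd : d + θ.card ≤ n)
    (hd' : d = 0 ∨ d + θ.card = n) (ι : V θ →ₗ[K] N)
    (h1 : ∀ (i : Fin (n - 1)) (j : Fin (θ.card - 1)), (i : ℕ) = d + j →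
      ∀ u, t i (ι u) = ι (seminormalOp θ j u))
    (h2 : ∀ i : Fin (n - 1), ((i : ℕ) + 1 < d ∨ d + θ.card ≤ i) → ∀ u, t i (ι u) = -ι u)
    (hs : ∀ f, IsStandardBi n (columnShape n θ) f → (∀ i, ¬IsDescent A f i) →
      ∀ a, (f a).1 = 0 ↔ d ≤ a ∧ (a : ℕ) < d + θ.card)
    {f : Fin n → Box} (hf : IsStandardBi n (columnShape n θ) f) (hfs : ∀ i, ¬IsDescent A f i)
    {i : Fin (n - 1)} (hi' : (f (lo i)).1 = (f (hi i)).1) :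
    t i (ι (vecV θ (restrictFilling d hd f))) =
      diag (f (lo i)) (f (hi i)) • ι (vecV θ (restrictFilling d hd f)) +
        off (f (lo i)) (f (hi i)) • ι (vecV θ (restrictFilling d hd (f ∘ simple i))) := by
  have hc := hs f hf hfs
  have hr := hf.restrict (hd := hd) hc
  rcases fin_two_cases (f (lo i)).1 with h0 | h0
  · have h3 := (hc _).1 h0
    have h4 := (hc _).1 (hi' ▸ h0)
    rw [coe_lo] at h3
    rw [coe_hi] at h4
    let j : Fin (θ.card - 1) := ⟨i - d, by omega⟩
    have hij : (i : ℕ) = d + j := by simp only [j]; omega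
    have e1 : (0, restrictFilling d hd f (lo j)) = f (lo i) := by
      refine Prod.ext h0.symm ?_
      simp only [restrictFilling]
      congr 2
      exact Fin.ext hij.symm
    have e2 : (0, restrictFilling d hd f (hi j)) = f (hi i) := by
      refine Prod.ext (hi' ▸ h0.symm) ?_
      simp only [restrictFilling]
      congr 2
      exact Fin.ext (show d + ((hi j : Fin θ.card) : ℕ) = i + 1 by rw [coe_hi]; omega)
    have e3 := seminormalOp_v ⟨_, hr⟩ j
    rw [e1, e2] at e3
    rw [restrictFilling_comp hd f hij, vecV, dif_pos hr, h1 i j hij, e3, map_add, map_smul,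
      map_smul]
  · have h3 : ¬(d ≤ (i : ℕ) ∧ (i : ℕ) < d + θ.card) := by
      rw [← coe_lo i, ← hc, h0]; decide
    have h4 : ¬(d ≤ (i : ℕ) + 1 ∧ (i : ℕ) + 1 < d + θ.card) := by
      rw [← coe_hi i, ← hc, ← hi', h0]; decide
    have h5 : off (f (lo i)) (f (hi i)) = 0 :=
      off_eq_zero hi' (.inr (by rw [hf.snd_eq_zero h0, hf.snd_eq_zero (hi' ▸ h0)]))
    rw [h2 i (by omega), h5, zero_smul, add_zero, diag_one_one h0 (hi' ▸ h0), neg_one_smul]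

theorem columnShape_zero : columnShape n θ 0 = θ := rfl

theorem columnShape_one : columnShape n θ 1 = column (n - θ.card) := rfl

theorem IsStandardBi.first_iff {f : Fin n → Box} (h : IsStandardBi n (columnShape n θ) f)
    (hs : ∀ i, ¬IsDescent 0 f i) (a : Fin n) :
    (f a).1 = 0 ↔ 0 ≤ (a : ℕ) ∧ (a : ℕ) < 0 + θ.card := by
  rw [h.component_iff hs, columnShape_zero]
  omega

theorem IsStandardBi.last_iff (hθ : θ.card ≤ n) {f : Fin n → Box}
    (h : IsStandardBi n (columnShape n θ) f) (hs : ∀ i, ¬IsDescent 1 f i) (a : Fin n) :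
    (f a).1 = 0 ↔ n - θ.card ≤ (a : ℕ) ∧ (a : ℕ) < n - θ.card + θ.card := by
  have h1 := h.component_iff hs a
  rw [columnShape_one, card_column] at h1
  have h2 : (f a).1 = 0 ↔ ¬(f a).1 = 1 := by
    rcases fin_two_cases (f a).1 with h | h <;> simp [h]
  rw [h2, h1]
  omega

/-- The linear map given on the basis by a function on fillings. -/
noncomputable def fillMap (P : (Fin n → Box) → Prop) (e : (Fin n → Box) → N) :
    ({f // P f} →₀ K) →ₗ[K] N := Finsupp.lift N K _ fun f => e f.1

theorem fillMap_single {P : (Fin n → Box) → Prop} (e : (Fin n → Box) → N) (f : {f // P f}) :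
    fillMap P e (Finsupp.single f 1) = e f.1 := lift_single _ _

theorem fillMap_intertwines {P : (Fin n → Box) → Prop} (hP : Admissible P) {e : (Fin n → Box) → N}
    {i : Fin (n - 1)}
    (h : ∀ f, P f → t i (e f) = diag (f (lo i)) (f (hi i)) • e f +
      off (f (lo i)) (f (hi i)) • e (f ∘ simple i)) (x : {f // P f} →₀ K) :
    fillMap P e (fillT P i x) = t i (fillMap P e x) := by
  suffices h : fillMap P e ∘ₗ fillT P i = t i ∘ₗ fillMap P e from LinearMap.congr_fun h x
  refine Finsupp.lhom_ext' fun f => LinearMap.ext_ring ?_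
  simp only [LinearMap.comp_apply, Finsupp.lsingle_apply]
  rw [fillT_single, fillMap_single, h f.1 f.2, map_add, map_smul, map_smul, fillMap_single]
  by_cases h0 : off (f.1 (lo i)) (f.1 (hi i)) = 0
  · rw [h0, zero_smul, zero_smul]
  · rw [vecP_of (hP.closed f.1 f.2 i h0), fillMap_single]

theorem standard_comp_of_ne {μ : Fin 2 → YoungDiagram} (f : Fin n → Box) (hf : IsStandardBi n μ f)
    (i : Fin (n - 1)) (h : (f (lo i)).1 ≠ (f (hi i)).1) : IsStandardBi n μ (f ∘ simple i) :=
  hf.comp_simple fun h' => absurd h' h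

theorem comp_descent {A : Fin 2} {f : Fin n → Box} {i : Fin (n - 1)} (h1 : (f (lo i)).1 = A)
    (h2 : (f (hi i)).1 ≠ A) : IsDescent A (f ∘ simple i) i := by
  rw [IsDescent, Function.comp_apply, Function.comp_apply, simple_lo, simple_hi]
  exact ⟨h2, h1⟩

/-- Inside a component this is `movedVec_same`. Across components, moving an entry of `θ` to the
left past the column is an application of `t i` by construction, and the opposite case is the
quadratic relation. -/
theorem movedVec_first_formula (ht : IsHecke t) (hθ : θ.card ≤ n) (ι : V θ →ₗ[K] N)
    (h1 : ∀ (i : Fin (n - 1)) (j : Fin (θ.card - 1)), (i : ℕ) = j →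
      ∀ u, t i (ι u) = ι (seminormalOp θ j u))
    (h2 : ∀ i : Fin (n - 1), θ.card ≤ i → ∀ u, t i (ι u) = -ι u) (i : Fin (n - 1))
    {f : Fin n → Box} (hf : IsStandardBi n (columnShape n θ) f) :
    let e := movedVec 0 t fun f => ι (vecV θ (restrictFilling 0 (by omega : 0 + θ.card ≤ n) f))
    t i (e f) = diag (f (lo i)) (f (hi i)) • e f +
      off (f (lo i)) (f (hi i)) • e (f ∘ simple i) := by
  intro e
  by_cases hs : (f (lo i)).1 = (f (hi i)).1
  · refine movedVec_same ht.isMover (P := IsStandardBi n (columnShape n θ)) standard_comp_of_ne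
      (fun f hf hfs i hi' => ?_) hf hs
    exact base_formula (A := 0) _ (.inl rfl) ι
      (fun i j hij => h1 i j (by omega)) (fun i hi' => h2 i (by omega))
      (fun f hf hfs => hf.first_iff hfs) hf hfs hi'
  · rcases fin_two_cases (f (lo i)).1 with h3 | h3
    · have h4 : (f (hi i)).1 = 1 := (fin_two_cases _).resolve_left fun h4 => hs (h3.trans h4.symm)
      have h5 := movedVec_descent (e₀ := fun f => ι (vecV θ (restrictFilling 0 (by omega) f)))
        ht.isMover (comp_descent (A := 0) h3 (by rw [h4]; decide))
      rw [comp_simple_simple] at h5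
      rw [diag_zero_one h3 h4, off_zero_one h3 h4, zero_smul, zero_add, one_smul]
      exact h5.symm
    · have h4 : (f (hi i)).1 = 0 := (fin_two_cases _).resolve_right fun h4 => hs (h3.trans h4.symm)
      have h5 := movedVec_descent (e₀ := fun f => ι (vecV θ (restrictFilling 0 (by omega) f)))
        ht.isMover (show IsDescent 0 f i from ⟨by rw [h3]; decide, h4⟩)
      rw [diag_one_zero h3 h4, off_one_zero h3 h4]
      have h6 : e f = t i (e (f ∘ simple i)) := h5
      rw [h6]
      have h7 := LinearMap.congr_fun (ht.quadratic i) (e (f ∘ simple i))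
      exact h7

/-- Here the entries of the column move to the left by `t⁻¹`. One mixed case is cancellation of `t`
and `t⁻¹`, the other is `q t⁻¹ = t - (q - 1)`. -/
theorem movedVec_last_formula (ht : IsHecke t) (hθ : θ.card ≤ n) (ι : V θ →ₗ[K] N)
    (h1 : ∀ (i : Fin (n - 1)) (j : Fin (θ.card - 1)), (i : ℕ) = n - θ.card + j →
      ∀ u, t i (ι u) = ι (seminormalOp θ j u))
    (h2 : ∀ i : Fin (n - 1), (i : ℕ) + 1 < n - θ.card → ∀ u, t i (ι u) = -ι u) (i : Fin (n - 1))
    {f : Fin n → Box} (hf : IsStandardBi n (columnShape n θ) f) :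
    let e := movedVec 1 (heckeInv t) fun f =>
      ι (vecV θ (restrictFilling (n - θ.card) (by omega : n - θ.card + θ.card ≤ n) f))
    t i (e f) = diag (f (lo i)) (f (hi i)) • e f +
      off (f (lo i)) (f (hi i)) • e (f ∘ simple i) := by
  intro e
  have hd : n - θ.card + θ.card ≤ n := by omega
  by_cases hs : (f (lo i)).1 = (f (hi i)).1
  · refine movedVec_same ht.isMover_inv (P := IsStandardBi n (columnShape n θ)) standard_comp_of_ne
      (fun f hf hfs i hi' => ?_) hf hs
    exact base_formula (A := 1) _ (.inr (by omega)) ι h1 (fun i hi' => h2 i (by omega))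
      (fun f hf hfs => hf.last_iff hθ hfs) hf hfs hi'
  · rcases fin_two_cases (f (lo i)).1 with h3 | h3
    · have h4 : (f (hi i)).1 = 1 := (fin_two_cases _).resolve_left fun h4 => hs (h3.trans h4.symm)
      have h5 := movedVec_descent (e₀ := fun f => ι (vecV θ (restrictFilling _ hd f)))
        ht.isMover_inv (show IsDescent 1 f i from ⟨by rw [h3]; decide, h4⟩)
      rw [diag_zero_one h3 h4, off_zero_one h3 h4, zero_smul, zero_add, one_smul]
      have h6 : e f = heckeInv t i (e (f ∘ simple i)) := h5
      rw [h6]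
      exact LinearMap.congr_fun (ht.mul_inv i) _
    · have h4 : (f (hi i)).1 = 0 := (fin_two_cases _).resolve_right fun h4 => hs (h3.trans h4.symm)
      have h5 := movedVec_descent (e₀ := fun f => ι (vecV θ (restrictFilling _ hd f)))
        ht.isMover_inv (comp_descent (A := 1) h3 (by rw [h4]; decide))
      rw [comp_simple_simple] at h5
      have h6 : e (f ∘ simple i) = heckeInv t i (e f) := h5
      rw [diag_one_zero h3 h4, off_one_zero h3 h4, h6, heckeInv, LinearMap.smul_apply, smul_smul,
        mul_inv_cancel₀ q_ne_zero, one_smul]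
      simp

theorem restrict_baseFilling (hd : 0 + θ.card ≤ n) (f : Fin θ.card → ℕ × ℕ) :
    restrictFilling 0 hd (baseFilling n f) = f := by
  funext a
  simp [restrictFilling, baseFilling]

theorem baseFilling_sorted (f : Fin θ.card → ℕ × ℕ) (i : Fin (n - 1)) :
    ¬IsDescent 0 (baseFilling n f) i := by
  rintro ⟨h1, h2⟩
  unfold baseFilling at h1 h2
  rw [coe_lo] at h1
  rw [coe_hi] at h2
  split_ifs at h1 h2 <;> first | exact h1 rfl | omega | simp at h2

/-- The universal property of the seminormal module as a module induced from `H_(k) ⊗ H_(n-k)`. -/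
theorem exists_intertwiner_first (ht : IsHecke t) (hθ : θ.card ≤ n) (ι : V θ →ₗ[K] N)
    (h1 : ∀ (i : Fin (n - 1)) (j : Fin (θ.card - 1)), (i : ℕ) = j →
      ∀ u, t i (ι u) = ι (seminormalOp θ j u))
    (h2 : ∀ i : Fin (n - 1), θ.card ≤ i → ∀ u, t i (ι u) = -ι u) :
    ∃ G : BiModule n (columnShape n θ) →ₗ[K] N,
      (∀ i x, G (fillT (IsStandardBi n (columnShape n θ)) i x) = t i (G x)) ∧
      ∀ T : StandardTableau θ,
        G (vBi ⟨baseFilling n T.1, (isStandardBi_baseFilling hθ).2 T.2⟩) = ι (v T) := by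
  refine ⟨fillMap _ (movedVec 0 t fun f =>
    ι (vecV θ (restrictFilling 0 (by omega : 0 + θ.card ≤ n) f))), fun i => ?_, fun T => ?_⟩
  · exact fillMap_intertwines (admissible_standard θ)
      fun f hf => movedVec_first_formula ht hθ ι h1 h2 i hf
  · rw [vBi, fillMap_single, movedVec_base (baseFilling_sorted _), restrict_baseFilling, vecV,
      dif_pos T.2]

end Universal

/-! ### Jucys-Murphy elements in the quotient of the cyclotomic Hecke algebra -/

section Stair

variable {m : ℕ}

/-- The product `t_1 ⋯ t_d`. -/
def stair {A : Type*} [Ring A] (t : Fin m → A) : ℕ → A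
  | 0 => 1
  | d + 1 => if h : d < m then stair t d * t ⟨d, h⟩ else 0

theorem stair_succ {A : Type*} [Ring A] (t : Fin m → A) (i : Fin m) : stair t (i + 1) = stair t i * t i := by
  rw [stair, dif_pos i.2]

/-- This unwinds `L = q⁻ᵈ t_d ⋯ t_1 x t_1 ⋯ t_d`, where `jm x t d` is the Jucys-Murphy element of
the number `d + 1`. Knowing `L` on a vector thus gives `x` on a translate of it. -/
theorem IsHecke.jm_stair {A : Type*} [Ring A] [Algebra K A] {x : A} {t : Fin m → A} (ht : IsHecke t) {d : ℕ} (hd : d ≤ m) :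
    x * stair t d = (q ^ d : K) • (stair (heckeInv t) d * jm x t d) := by
  induction d with
  | zero => simp [stair, jm]
  | succ d ih =>
    have h1 := stair_succ t ⟨d, hd⟩
    have h2 := stair_succ (heckeInv t) ⟨d, hd⟩
    have h3 := jm_succ x t ⟨d, hd⟩
    simp only at h1 h2 h3
    have h4 : heckeInv t ⟨d, hd⟩ * (t ⟨d, hd⟩ * jm x t d * t ⟨d, hd⟩) = jm x t d * t ⟨d, hd⟩ := by
      rw [mul_assoc (t _), ← mul_assoc, ht.inv_mul, one_mul]
    rw [h1, h2, h3, ← mul_assoc, ih (by omega), mul_smul_comm, mul_assoc (stair _ _), h4, smul_smul,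
      smul_mul_assoc, mul_assoc, pow_succ, mul_assoc, mul_inv_cancel₀ q_ne_zero, mul_one]

end Stair

section JucysMurphy

variable {m : ℕ} {A : Type*} [Ring A] [Algebra K A] {x : A} {t : Fin m → A}

theorem IsCyclo.jm_comm_of_lt (h : IsCyclo x t) (k : ℕ) (i : Fin m) (hi : k < i) :
    t i * jm x t k = jm x t k * t i := by
  induction k with
  | zero => exact (h.comm i hi).symm
  | succ k ih =>
    have h1 := h.hecke.comm ⟨k, by omega⟩ i hi
    have h2 := ih (by omega)
    have h3 := jm_succ x t ⟨k, by omega⟩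
    simp only at h3
    rw [h3, mul_smul_comm, smul_mul_assoc]
    congr 1
    rw [← mul_assoc, ← mul_assoc, ← h1, mul_assoc (t _) (t i), h2]
    simp only [mul_assoc, h1]

theorem IsCyclo.t_mul_jm_succ (h : IsCyclo x t) (i : Fin m) :
    t i * jm x t (i + 1) = (q - 1) • jm x t (i + 1) + jm x t i * t i := by
  rw [jm_succ, mul_smul_comm, ← mul_assoc, ← mul_assoc, h.hecke.quadratic, add_mul, add_mul,
    smul_add, smul_mul_assoc, smul_mul_assoc, smul_mul_assoc, smul_mul_assoc, one_mul, smul_smul,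
    smul_smul, smul_smul, inv_mul_cancel₀ q_ne_zero, one_smul, mul_comm (q⁻¹ : K) (q - 1)]

theorem IsCyclo.jm_succ_mul_t (h : IsCyclo x t) (i : Fin m) :
    jm x t (i + 1) * t i = (q - 1) • jm x t (i + 1) + t i * jm x t i := by
  rw [jm_succ, smul_mul_assoc, mul_assoc, h.hecke.quadratic, mul_add,
    smul_add, mul_smul_comm, mul_smul_comm, mul_one, smul_smul,
    smul_smul, smul_smul, inv_mul_cancel₀ q_ne_zero, one_smul, mul_comm (q⁻¹ : K) (q - 1)]

/-- The essential case is `k = i + 2`, where `L` is a conjugate by `t_j t_i` of an element commuting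
with `t_j`, and two braid moves carry `t i` through. Later elements are conjugated by generators
that commute with `t i`. -/
theorem IsCyclo.jm_comm_of_gt (h : IsCyclo x t) (k : ℕ) (i : Fin m) (hi : (i : ℕ) + 1 < k)
    (hk : k ≤ m) : t i * jm x t k = jm x t k * t i := by
  induction k with
  | zero => omega
  | succ k ih =>
    have h3 := jm_succ x t ⟨k, by omega⟩
    simp only at h3
    rw [h3, mul_smul_comm, smul_mul_assoc]
    congr 1
    by_cases hik : (i : ℕ) + 1 = k
    · subst hik
      have h4 := jm_succ x t i
      have h5 := h.hecke.braid i ⟨i + 1, by omega⟩ rfl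
      have h6 := h.jm_comm_of_lt i ⟨i + 1, by omega⟩ (Nat.lt_succ_self _)
      rw [h4, mul_smul_comm, smul_mul_assoc, mul_smul_comm, smul_mul_assoc]
      congr 1
      set j : Fin m := ⟨i + 1, by omega⟩
      calc t i * (t j * (t i * jm x t i * t i) * t j)
          = (t i * t j * t i) * jm x t i * t i * t j := by simp only [mul_assoc]
        _ = t j * t i * (t j * jm x t i) * t i * t j := by rw [h5]; simp only [mul_assoc]
        _ = t j * t i * jm x t i * (t j * t i * t j) := by rw [h6]; simp only [mul_assoc]
        _ = t j * (t i * jm x t i * t i) * t j * t i := by rw [← h5]; simp only [mul_assoc]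
    · have h1 := h.hecke.comm i ⟨k, by omega⟩ (by simp only; omega)
      have h2 := ih (by omega) (by omega)
      rw [← mul_assoc, ← mul_assoc, h1, mul_assoc (t _) (t i), h2]
      simp only [mul_assoc, h1]

/-- The first step is the four-term braid relation; afterwards `x` commutes with all generators that
are added. -/
theorem IsCyclo.x_comm_jm (h : IsCyclo x t) (k : ℕ) (hk : k ≤ m) :
    x * jm x t k = jm x t k * x := by
  induction k with
  | zero => rfl
  | succ k ih =>
    have h3 := jm_succ x t ⟨k, by omega⟩
    simp only at h3
    rw [h3, mul_smul_comm, smul_mul_assoc]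
    congr 1
    by_cases hk0 : k = 0
    · subst hk0
      have h4 := h.braid ⟨0, by omega⟩ rfl
      change x * (t _ * x * t _) = t _ * x * t _ * x
      rw [← h4]
      simp only [mul_assoc]
    · have h1 := h.comm ⟨k, by omega⟩ (by simp only; omega)
      have h2 := ih (by omega)
      rw [← mul_assoc, ← mul_assoc, h1, mul_assoc (t _) x, h2]
      simp only [mul_assoc, h1]

theorem IsCyclo.jm_comm_jm (h : IsCyclo x t) (k l : ℕ) (hkl : k ≤ l) (hl : l ≤ m) :
    jm x t k * jm x t l = jm x t l * jm x t k := by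
  induction k with
  | zero => exact h.x_comm_jm l hl
  | succ k ih =>
    rcases hkl.eq_or_lt with rfl | hlt
    · rfl
    have h3 := jm_succ x t ⟨k, by omega⟩
    simp only at h3
    have h1 := h.jm_comm_of_gt l ⟨k, by omega⟩ hlt hl
    have h2 := ih (by omega)
    rw [h3, mul_smul_comm, smul_mul_assoc]
    congr 1
    rw [mul_assoc, h1, mul_assoc, ← mul_assoc (jm x t k), h2, ← mul_assoc, ← mul_assoc, ← mul_assoc,
      h1]
    simp only [mul_assoc]

/-- The product of the `1 - L_i`, `i ≤ j`; it projects to the part where `1, …, j` are in the second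
component. -/
noncomputable def colProj (x : A) (t : Fin m → A) : ℕ → A
  | 0 => 1
  | j + 1 => colProj x t j * (1 - jm x t j)

theorem IsCyclo.jm_comm_colProj (h : IsCyclo x t) (k j : ℕ) (hk : k ≤ m) (hj : j ≤ m + 1) :
    jm x t k * colProj x t j = colProj x t j * jm x t k := by
  induction j with
  | zero => simp [colProj]
  | succ j ih =>
    have h1 : jm x t k * jm x t j = jm x t j * jm x t k := by
      rcases le_total k j with hkj | hkj
      · exact h.jm_comm_jm k j hkj (by omega)
      · exact (h.jm_comm_jm j k hkj hk).symm
    rw [colProj, ← mul_assoc, ih (by omega), mul_assoc, mul_assoc, mul_sub, sub_mul, h1, mul_one,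
      one_mul]

/-- `t i` commutes with every factor except `1 - L` at the indices `i` and `i + 1`, and it commutes
with the product of these two. Only for `j = i + 1` does the product contain one of them without the
other. -/
theorem IsCyclo.t_comm_colProj (h : IsCyclo x t) (i : Fin m) (j : ℕ) (hj : j ≤ m + 1)
    (hij : (i : ℕ) + 1 ≠ j) : t i * colProj x t j = colProj x t j * t i := by
  induction j using Nat.strong_induction_on with
  | _ j ih =>
  rcases j with _ | j
  · simp [colProj]
  by_cases h1 : (i : ℕ) + 1 = j
  · subst h1
    rw [colProj, colProj]
    have h2 := ih i (by omega) (by omega) (by omega)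
    have e1 := h.t_mul_jm_succ i
    have e2 := h.jm_succ_mul_t i
    have e3 : t i * ((1 - jm x t i) * (1 - jm x t (i + 1))) =
        (1 - jm x t i) * (1 - jm x t (i + 1)) * t i := by
      have e4 : t i * (jm x t i * jm x t (i + 1)) = jm x t i * jm x t (i + 1) * t i := by
        rw [jm_succ, mul_smul_comm, mul_smul_comm, smul_mul_assoc]
        congr 1
        have := h.jm_comm_jm i (i + 1) (Nat.le_succ _) i.2
        rw [jm_succ, mul_smul_comm, smul_mul_assoc] at this
        have := smul_right_injective A (inv_ne_zero q_ne_zero) this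
        conv_rhs => rw [this]
        simp only [mul_assoc]
      have e5 : (1 - jm x t i) * (1 - jm x t (i + 1)) =
          1 - jm x t i - jm x t (i + 1) + jm x t i * jm x t (i + 1) := by noncomm_ring
      rw [e5, mul_add, add_mul, mul_sub, mul_sub, sub_mul, sub_mul, e4, e1, e2, mul_one, one_mul]
      abel
    rw [mul_assoc, ← mul_assoc (t i), h2, mul_assoc, e3]
    simp only [mul_assoc]
  · have h2 := ih j (by omega) (by omega) h1
    have h3 : t i * jm x t j = jm x t j * t i := by
      rcases lt_or_ge j i with h4 | h4
      · exact h.jm_comm_of_lt j i h4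
      · exact h.jm_comm_of_gt j i (by omega) (by omega)
    rw [colProj, ← mul_assoc, h2, mul_assoc, mul_assoc, mul_sub, sub_mul, h3, mul_one, one_mul]

theorem IsCyclo.x_mul_colProj (h : IsCyclo x t) (j : ℕ) (hj : j ≤ m) :
    x * colProj x t (j + 1) = 0 := by
  induction j with
  | zero => simp [colProj, jm, mul_sub, h.idem]
  | succ j ih => rw [colProj, ← mul_assoc, ih (by omega), zero_mul]

/-- On the image of `colProj` the first generators act by the sign character. -/
theorem IsCyclo.colProj_mul_t (h : IsCyclo x t) (i : Fin m) (j : ℕ) (hj : j ≤ m + 1)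
    (hij : (i : ℕ) + 1 < j) : colProj x t j * t i = -colProj x t j := by
  obtain ⟨i, hi⟩ := i
  simp only at hij
  induction i with
  | zero =>
    obtain ⟨j, rfl⟩ : ∃ k, j = k + 2 := ⟨j - 2, by omega⟩
    induction j with
    | zero =>
      have e1 := jm_succ x t ⟨0, hi⟩
      change jm x t 1 = _ • (_ * x * _) at e1
      have e2 := h.ideal ⟨0, hi⟩ rfl
      have e3 : q • jm x t 1 = t ⟨0, hi⟩ * x * t ⟨0, hi⟩ := by
        rw [e1, smul_smul, mul_inv_cancel₀ q_ne_zero, one_smul]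
      have e4 := h.jm_succ_mul_t ⟨0, hi⟩
      change jm x t 1 * _ = (q - 1) • jm x t 1 + _ * x at e4
      -- This product is precisely the generator of the ideal without its scalar factor: the
      -- relation says that `T_1 = -1` where `1` and `2` are in the second component.
      have e5 : (1 - x) * (1 - jm x t 1) * (1 + t ⟨0, hi⟩) = 0 := by
        rw [← e2]
        have : (1 - jm x t 1) * (1 + t ⟨0, hi⟩) =
            1 + t ⟨0, hi⟩ - q • jm x t 1 - t ⟨0, hi⟩ * x := by
          rw [sub_mul, one_mul, mul_add, mul_one, e4, sub_smul, one_smul]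
          abel
        rw [mul_assoc, this, e3]
        noncomm_ring
      simp only [colProj, jm, one_mul]
      rw [mul_add, mul_one] at e5
      exact eq_neg_of_add_eq_zero_right e5
    | succ j ih =>
      have h1 := ih (by omega) (by omega)
      have h2 := h.jm_comm_of_gt (j + 2) ⟨0, hi⟩ (by simp) (by omega)
      rw [colProj, mul_assoc, sub_mul, one_mul, ← h2, mul_sub, h1, ← mul_assoc, h1, mul_sub, mul_one]
      noncomm_ring
  | succ i ih =>
    have h1 := ih (by omega) (by omega)
    have h2 := h.hecke.braid ⟨i, by omega⟩ ⟨i + 1, hi⟩ rfl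
    have h3 := h.t_comm_colProj ⟨i + 1, hi⟩ j hj (by simp only; omega)
    set s := t ⟨i, by omega⟩
    set u := t ⟨i + 1, hi⟩ with hu
    set Q := colProj x t j
    -- Given `Q s = -Q`, and since `u` commutes with `Q`, the braid relation becomes `Q u = -Q u²`;
    -- cancelling the invertible `u` gives `Q u = -Q`.
    have h4 : Q * (s * u * s) = Q * u := by
      rw [mul_assoc, ← mul_assoc, h1, neg_mul, ← mul_assoc, ← h3, mul_assoc, h1, mul_neg, neg_neg]
    have h5 : Q * (u * s * u) = -(Q * (u * u)) := by
      rw [mul_assoc, ← mul_assoc, ← h3, mul_assoc, ← mul_assoc Q, h1, neg_mul, mul_neg, ← mul_assoc,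
        h3, mul_assoc]
    have h6 : Q * u = -(Q * (u * u)) := by rw [← h4, h2, h5]
    have h7 : Q * u * heckeInv t ⟨i + 1, hi⟩ = Q := by
      rw [mul_assoc, hu, h.hecke.mul_inv, mul_one]
    have h8 := congrArg (· * heckeInv t ⟨i + 1, hi⟩) h6
    simp only [neg_mul] at h8
    rw [h7, ← mul_assoc, mul_assoc, hu, h.hecke.mul_inv, mul_one] at h8
    exact neg_eq_iff_eq_neg.1 h8.symm

end JucysMurphy

/-! ### The universal property with the column in front -/

section UniversalLast

variable {n : ℕ} {θ : YoungDiagram} {N : Type*} [AddCommGroup N] [Module K N]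
  {x : Module.End K N} {t : Fin (n - 1) → Module.End K N}

/-- Here an entry of `θ` stands at place `p`, after `p` entries of the column, and every remaining
descent is at this place. Each step carries the entry past one more column entry, contributing the
next factor of `stair`, until the whole column is in front. -/
theorem stair_movedVec (ht : IsHecke t) (hθ : θ.card ≤ n) {e₀ : (Fin n → Box) → N}
    (r p : ℕ) (hr : r + p = n - θ.card) (f : Fin n → Box)
    (hf : IsStandardBi n (columnShape n θ) f) (hdesc : ∀ i, IsDescent 1 f i → (i : ℕ) = p)
    (hp : ∀ a : Fin n, (a : ℕ) = p → (f a).1 = 0) (hlt : ∀ a : Fin n, (a : ℕ) < p → (f a).1 = 1)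
    (hpn : p < n) :
    ∃ g, IsStandardBi n (columnShape n θ) g ∧ (∀ i, ¬IsDescent 1 g i) ∧
      stair (heckeInv t) p (movedVec 1 (heckeInv t) e₀ f) =
        stair (heckeInv t) (n - θ.card) (e₀ g) := by
  induction r generalizing p f with
  | zero =>
    have hs : ∀ i, ¬IsDescent 1 f i := by
      intro i hi'
      have h0 := hdesc i hi'
      have h2 := Finset.card_lt_card (s := Finset.univ.filter fun a : Fin n => (a : ℕ) < p)
        (t := Finset.univ.filter fun a => (f a).1 = 1) ⟨fun a ha => by
          simp only [Finset.mem_filter, Finset.mem_univ, true_and] at ha ⊢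
          exact hlt a ha, fun hsub => by
          have h3 := hsub (Finset.mem_filter.2 ⟨Finset.mem_univ (hi i), hi'.2⟩)
          simp only [Finset.mem_filter, Finset.mem_univ, true_and, coe_hi] at h3
          omega⟩
      rw [hf.card_component, columnShape_one, card_column] at h2
      have h4 : (Finset.univ.filter fun a : Fin n => (a : ℕ) < p).card = p := by
        rw [Fin.card_filter_val_lt]
        omega
      omega
    refine ⟨f, hf, hs, ?_⟩
    rw [movedVec_base hs, show p = n - θ.card by omega]
  | succ r ih =>
    by_cases hs : ∀ i, ¬IsDescent 1 f i
    · have h1 := hf.last_iff hθ hs ⟨p, hpn⟩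
      have h2 := h1.1 (hp _ rfl)
      simp only at h2
      omega
    · push Not at hs
      obtain ⟨i, hi'⟩ := hs
      have hip := hdesc i hi'
      have hcomp : ∀ a : Fin n, ((f ∘ simple i) a).1 =
          if (a : ℕ) = p then 1 else if (a : ℕ) = p + 1 then 0 else (f a).1 := by
        intro a
        by_cases h1 : a = lo i
        · rw [h1, Function.comp_apply, simple_lo, coe_lo, if_pos hip, hi'.2]
        by_cases h2 : a = hi i
        · rw [h2, Function.comp_apply, simple_hi, coe_hi, if_neg (by omega), if_pos (by omega)]
          exact hp _ (by rw [coe_lo, hip])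
        rw [Function.comp_apply, simple_of_ne h1 h2]
        rw [Fin.ext_iff, coe_lo] at h1
        rw [Fin.ext_iff, coe_hi] at h2
        rw [if_neg (by omega), if_neg (by omega)]
      have hni : (i : ℕ) < n - 1 := i.2
      obtain ⟨g, hg, hg', hg''⟩ := ih (p + 1) (by omega) (f ∘ simple i)
        (standard_comp_of_ne f hf i fun h => hi'.1 (h.trans hi'.2))
        (fun j hj => by
          obtain ⟨h1, h2⟩ := hj
          rw [hcomp, coe_lo] at h1
          rw [hcomp, coe_hi] at h2
          split_ifs at h1 h2 with h3 h4 h5 h6 h7 h8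
          all_goals first
            | exact absurd rfl h1
            | exact absurd h2 (by decide)
            | omega
            | exact absurd (hlt (lo j) (by rw [coe_lo]; omega)) h1
            | (have := hdesc j ⟨h1, h2⟩; omega))
        (fun a ha => by rw [hcomp, if_neg (by omega), if_pos ha])
        (fun a ha => by
          rw [hcomp]
          split_ifs with h1 h2
          · rfl
          · omega
          · exact hlt a (by omega)) (by omega)
      refine ⟨g, hg, hg', ?_⟩
      have h3 := stair_succ (heckeInv t) i
      rw [hip] at h3
      rw [← hg'', movedVec_descent ht.isMover_inv hi', h3]
      rfl

/-- A rearrangement of a standard bitableau that keeps the order in each component. -/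
theorem IsStandardBi.comp_perm {μ : Fin 2 → YoungDiagram} {f : Fin n → Box}
    (h : IsStandardBi n μ f) (σ : Equiv.Perm (Fin n))
    (hσ : ∀ a b, (f (σ a)).1 = (f (σ b)).1 → σ a < σ b → a < b) : IsStandardBi n μ (f ∘ σ) where
  bijOn := h.bijOn.comp (Set.bijOn_univ.2 σ.bijective)
  row_increasing a b h1 h2 h3 := hσ a b h1 (h.row_increasing _ _ h1 h2 h3)
  col_increasing a b h1 h2 h3 := hσ a b h1 (h.col_increasing _ _ h1 h2 h3)

/-- There is a bitableau in which the column comes first and the tableau is prescribed. -/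
theorem exists_column_first (hθ : θ.card ≤ n) (T : StandardTableau θ) :
    ∃ f, IsStandardBi n (columnShape n θ) f ∧ (∀ i, ¬IsDescent 1 f i) ∧
      restrictFilling (n - θ.card) (by omega : n - θ.card + θ.card ≤ n) f = T.1 := by
  have hinj : Function.Injective fun a : Fin n =>
      if h : (a : ℕ) < n - θ.card then (⟨a + θ.card, by omega⟩ : Fin n)
      else ⟨a - (n - θ.card), by omega⟩ := by
    intro a b hab
    simp only at hab
    split_ifs at hab <;> rw [Fin.mk.injEq] at hab <;> exact Fin.ext (by omega)
  let σ : Equiv.Perm (Fin n) := Equiv.ofBijective _ (Finite.injective_iff_bijective.1 hinj)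
  have hσ1 : ∀ a : Fin n, (a : ℕ) < n - θ.card → (σ a : ℕ) = a + θ.card := fun a h => by
    change ((if h : (a : ℕ) < n - θ.card then _ else _ : Fin n) : ℕ) = _
    rw [dif_pos h]
  have hσ2 : ∀ a : Fin n, ¬(a : ℕ) < n - θ.card → (σ a : ℕ) = a - (n - θ.card) := fun a h => by
    change ((if h : (a : ℕ) < n - θ.card then _ else _ : Fin n) : ℕ) = _
    rw [dif_neg h]
  have hc : ∀ a, (baseFilling n T.1 (σ a)).1 = if (a : ℕ) < n - θ.card then 1 else 0 := by
    intro a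
    unfold baseFilling
    by_cases h : (a : ℕ) < n - θ.card
    · rw [dif_neg (by rw [hσ1 a h]; omega), if_pos h]
    · rw [dif_pos (by rw [hσ2 a h]; omega), if_neg h]
  refine ⟨baseFilling n T.1 ∘ σ,
    ((isStandardBi_baseFilling hθ).2 T.2).comp_perm σ fun a b h1 h2 => ?_, ?_, ?_⟩
  · rw [hc, hc] at h1
    rw [Fin.lt_def] at h2 ⊢
    by_cases ha : (a : ℕ) < n - θ.card <;> by_cases hb : (b : ℕ) < n - θ.card
    · rw [hσ1 a ha, hσ1 b hb] at h2; omega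
    · rw [if_pos ha, if_neg hb] at h1; exact absurd h1 (by decide)
    · rw [if_pos hb, if_neg ha] at h1; exact absurd h1 (by decide)
    · rw [hσ2 a ha, hσ2 b hb] at h2; omega
  · rintro i ⟨h1, h2⟩
    rw [Function.comp_apply, hc, coe_lo] at h1
    rw [Function.comp_apply, hc, coe_hi] at h2
    split_ifs at h1 h2
    · exact h1 rfl
    · exact absurd h2 (by decide)
    · omega
    · exact absurd h2 (by decide)
  · funext a
    have h1 := hσ2 ⟨n - θ.card + a, by omega⟩ (by simp only; omega)
    simp only [restrictFilling, Function.comp_apply, baseFilling]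
    rw [dif_pos (by rw [h1]; simp only; omega)]
    refine congrArg T.1 (Fin.ext (h1.trans ?_))
    simp only
    omega

/-- The universal property of the seminormal module as a module generated by the bitableaux in
which the column comes first. -/
theorem exists_intertwiner_last [NeZero n] (h : IsCyclo x t) (hθ : θ.card ≤ n) (ι : V θ →ₗ[K] N)
    (h1 : ∀ (i : Fin (n - 1)) (j : Fin (θ.card - 1)), (i : ℕ) = n - θ.card + j →
      ∀ u, t i (ι u) = ι (seminormalOp θ j u))
    (h2 : ∀ i : Fin (n - 1), (i : ℕ) + 1 < n - θ.card → ∀ u, t i (ι u) = -ι u)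
    (hX : 0 < n - θ.card → ∀ u, x (ι u) = 0)
    (hL : 0 < θ.card → ∀ u, jm x t (n - θ.card) (ι u) = ι u) (hι : ι ≠ 0) :
    ∃ G : BiModule n (columnShape n θ) →ₗ[K] N,
      (∀ i y, G (fillT (IsStandardBi n (columnShape n θ)) i y) = t i (G y)) ∧
      (∀ y, G (fillX (IsStandardBi n (columnShape n θ)) y) = x (G y)) ∧ G ≠ 0 := by
  have ht := h.hecke
  have hd : n - θ.card + θ.card ≤ n := by omega
  set e := movedVec 1 (heckeInv t) fun f => ι (vecV θ (restrictFilling (n - θ.card) hd f)) with he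
  have hx : ∀ f, IsStandardBi n (columnShape n θ) f →
      x (e f) = if (f 0).1 = 0 then e f else 0 := by
    intro f hf
    induction hp : position 1 f using Nat.strong_induction_on generalizing f with
    | _ p ih =>
      by_cases hs : ∀ i, ¬IsDescent 1 f i
      · have h0 := hf.last_iff hθ hs 0
        rw [he, movedVec_base hs]
        split_ifs with h00
        · have h3 := h0.1 h00
          have h4 := hL (by simp only [Fin.val_zero] at h3; omega)
            (vecV θ (restrictFilling (n - θ.card) hd f))
          -- If `1` is in the tableau although the column comes first, the column is empty, and the
          -- first Jucys-Murphy element is `x` itself.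
          have h5 : jm x t (n - θ.card) = x := by
            rw [show n - θ.card = 0 by simpa using h3.1]
            rfl
          rwa [h5] at h4
        · refine hX ?_ _
          by_contra h3
          exact h00 (h0.2 (by have := NeZero.pos n; simp only [Fin.val_zero]; omega))
      -- A descent away from the first place uses a generator commuting with `x`, so the induction
      -- applies. Otherwise the filling starts with one entry of `θ` followed by the whole column.
      · by_cases hi0 : ∃ i, IsDescent 1 f i ∧ (i : ℕ) ≠ 0
        · obtain ⟨i, hi', hi0⟩ := hi0
          have h3 := ih _ (hp ▸ hi'.position_lt) _
            (standard_comp_of_ne f hf i fun h => hi'.1 (h.trans hi'.2)) rfl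
          have h4 : simple i 0 = 0 := simple_of_ne
            (fun h => hi0 (by rw [Fin.ext_iff, coe_lo, Fin.val_zero] at h; exact h.symm))
            (fun h => by rw [Fin.ext_iff, coe_hi, Fin.val_zero] at h; omega)
          rw [Function.comp_apply, h4] at h3
          have h5 : e f = heckeInv t i (e (f ∘ simple i)) := movedVec_descent ht.isMover_inv hi'
          have h6 := LinearMap.congr_fun
            (heckeInv_comm (h.comm i (Nat.one_le_iff_ne_zero.2 hi0))) (e (f ∘ simple i))
          rw [h5]
          refine h6.trans ?_
          rw [Module.End.mul_apply, h3]
          split_ifs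
          · rfl
          · exact map_zero _
        · push Not at hs hi0
          obtain ⟨i, hi'⟩ := hs
          have hi0' := hi0 i hi'
          have hl0 : lo i = 0 := Fin.ext (by rw [coe_lo, hi0', Fin.val_zero])
          have h00 : (f 0).1 = 0 := (fin_two_cases _).resolve_right (hl0 ▸ hi'.1)
          have hpos : 0 < θ.card := Finset.card_pos.2 ⟨(f 0).2, by
            have := hf.mem 0
            rwa [h00] at this⟩
          -- Now `e f = t_1⁻¹ ⋯ t_d⁻¹ (ι u)`, and `L_{d+1}` fixes `ι u`. By `jm_stair`, `q^d • e f`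
          -- is in the image of the idempotent `x`, hence is fixed by `x`.
          obtain ⟨g, -, -, hg⟩ := stair_movedVec ht hθ
            (e₀ := fun f => ι (vecV θ (restrictFilling (n - θ.card) hd f)))
            (n - θ.card) 0 rfl f hf hi0 (fun a ha => by
              rwa [show a = 0 from Fin.ext (by simpa using ha)]) (fun a ha => by omega)
            (NeZero.pos n)
          change e f = _ at hg
          set u := vecV θ (restrictFilling (n - θ.card) hd g)
          have h3 := LinearMap.congr_fun
            (ht.jm_stair (x := x) (d := n - θ.card) (by omega)) (ι u)
          simp only [Module.End.mul_apply, LinearMap.smul_apply] at h3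
          rw [hL hpos, ← hg] at h3
          have h4 := LinearMap.congr_fun h.idem (stair t (n - θ.card) (ι u))
          rw [Module.End.mul_apply, h3, map_smul] at h4
          rw [if_pos h00]
          exact smul_right_injective _ (pow_ne_zero _ q_ne_zero) h4
  refine ⟨fillMap _ e, fun i => ?_, ?_, ?_⟩
  · exact fillMap_intertwines (admissible_standard θ)
      fun f hf => movedVec_last_formula ht hθ ι h1 h2 i hf
  · suffices h : fillMap _ e ∘ₗ fillX (IsStandardBi n (columnShape n θ)) = x ∘ₗ fillMap _ e from
      LinearMap.congr_fun h
    refine Finsupp.lhom_ext' fun f => LinearMap.ext_ring ?_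
    simp only [LinearMap.comp_apply, Finsupp.lsingle_apply]
    rw [fillX_single, fillMap_single, hx f.1 f.2]
    split_ifs
    · exact fillMap_single _ _
    · exact map_zero _
  · intro h0
    refine hι (Finsupp.lhom_ext' fun T => LinearMap.ext_ring ?_)
    obtain ⟨f, hf, hs, hr⟩ := exists_column_first hθ T
    have h3 := LinearMap.congr_fun h0 (Finsupp.single ⟨f, hf⟩ 1)
    rw [fillMap_single, he, movedVec_base hs, hr, vecV, dif_pos T.2] at h3
    exact h3

end UniversalLast

/-! ### The Young lattice -/

section Young

theorem lt_card_of_mem {μ : YoungDiagram} {c : ℕ × ℕ} (h : c ∈ μ) : c.1 < μ.card ∧ c.2 < μ.card := by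
  have h1 : (Finset.range (c.1 + 1)).image (fun r => (r, c.2)) ⊆ μ.cells := by
    intro d hd
    obtain ⟨r, hr, rfl⟩ := Finset.mem_image.1 hd
    exact μ.up_left_mem (Nat.le_of_lt_succ (Finset.mem_range.1 hr)) le_rfl h
  have h2 : (Finset.range (c.2 + 1)).image (fun r => (c.1, r)) ⊆ μ.cells := by
    intro d hd
    obtain ⟨r, hr, rfl⟩ := Finset.mem_image.1 hd
    exact μ.up_left_mem le_rfl (Nat.le_of_lt_succ (Finset.mem_range.1 hr)) h
  have h3 := Finset.card_le_card h1
  have h4 := Finset.card_le_card h2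
  rw [Finset.card_image_of_injective _ fun a b hab => (Prod.mk.inj hab).1,
    Finset.card_range] at h3
  rw [Finset.card_image_of_injective _ fun a b hab => (Prod.mk.inj hab).2,
    Finset.card_range] at h4
  exact ⟨h3, h4⟩

theorem finite_card_eq (n : ℕ) : {μ : YoungDiagram | μ.card = n}.Finite := by
  refine Set.Finite.of_finite_image (f := YoungDiagram.cells)
    (((Finset.range n ×ˢ Finset.range n).powerset.finite_toSet).subset ?_)
    fun μ _ ν _ h => YoungDiagram.ext h
  rintro _ ⟨μ, rfl, rfl⟩
  rw [Finset.mem_coe, Finset.mem_powerset]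
  intro c hc
  obtain ⟨h1, h2⟩ := lt_card_of_mem hc
  exact Finset.mem_product.2 ⟨Finset.mem_range.2 h1, Finset.mem_range.2 h2⟩

open Classical in
/-- The diagrams obtained by adding a box. -/
noncomputable def up (μ : YoungDiagram) : Finset YoungDiagram :=
  (finite_card_eq (μ.card + 1)).toFinset.filter (μ ≤ ·)

open Classical in
/-- The diagrams obtained by removing a box. -/
noncomputable def down (μ : YoungDiagram) : Finset YoungDiagram :=
  (finite_card_eq (μ.card - 1)).toFinset.filter fun κ => κ ≤ μ ∧ κ.card + 1 = μ.card

theorem mem_up {μ lam : YoungDiagram} : lam ∈ up μ ↔ μ ≤ lam ∧ lam.card = μ.card + 1 := by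
  simp [up, and_comm]

theorem mem_down {μ κ : YoungDiagram} : κ ∈ down μ ↔ κ ≤ μ ∧ μ.card = κ.card + 1 := by
  simp only [down, Finset.mem_filter, Set.Finite.mem_toFinset, Set.mem_ofPred_eq]
  exact ⟨fun h => ⟨h.2.1, h.2.2.symm⟩, fun h => ⟨by omega, h.1, h.2.symm⟩⟩

theorem mem_up_iff_mem_down {μ lam : YoungDiagram} : lam ∈ up μ ↔ μ ∈ down lam :=
  mem_up.trans mem_down.symm

theorem exists_cell {μ lam : YoungDiagram} (h : lam ∈ up μ) :
    ∃ c, c ∉ μ ∧ ∀ d, d ∈ lam ↔ d = c ∨ d ∈ μ := by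
  obtain ⟨h1, h2⟩ := mem_up.1 h
  obtain ⟨c, hc, hc'⟩ := Finset.exists_eq_insert_iff.2
    ⟨YoungDiagram.cells_subset_iff.2 h1, h2.symm⟩
  refine ⟨c, hc, fun d => ?_⟩
  rw [← YoungDiagram.mem_cells, ← hc', Finset.mem_insert, YoungDiagram.mem_cells]

theorem mem_up_of_insert {μ lam : YoungDiagram} {c : ℕ × ℕ} (hc : c ∉ μ)
    (h : ∀ d, d ∈ lam ↔ d = c ∨ d ∈ μ) : lam ∈ up μ := by
  refine mem_up.2 ⟨fun d hd => (h d).2 (.inr hd), ?_⟩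
  have : lam.cells = insert c μ.cells := by
    ext d
    rw [Finset.mem_insert, YoungDiagram.mem_cells, YoungDiagram.mem_cells, h]
  change lam.cells.card = _
  rw [this, Finset.card_insert_of_notMem hc]

/-- The rows from which a box can be removed. -/
def removableRows (μ : YoungDiagram) : Finset ℕ :=
  (Finset.range μ.card).filter fun r => μ.rowLen (r + 1) < μ.rowLen r

theorem mem_removableRows {μ : YoungDiagram} {r : ℕ} :
    r ∈ removableRows μ ↔ μ.rowLen (r + 1) < μ.rowLen r := by
  rw [removableRows, Finset.mem_filter, Finset.mem_range, and_iff_right_iff_imp]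
  intro h
  exact (lt_card_of_mem (YoungDiagram.mem_iff_lt_rowLen.2 h)).1

/-- The box that can be removed from row `r` is its last one, and removal is possible when the next
row is shorter. -/
theorem card_down (μ : YoungDiagram) : (down μ).card = (removableRows μ).card := by
  symm
  have hex : ∀ r ∈ removableRows μ, ∃ κ : YoungDiagram,
      ∀ d, d ∈ κ ↔ d ∈ μ ∧ d ≠ (r, μ.rowLen r - 1) := by
    intro r hr
    rw [mem_removableRows] at hr
    refine ⟨⟨μ.cells.erase (r, μ.rowLen r - 1), ?_⟩, fun d => ?_⟩
    · rintro ⟨a, b⟩ ⟨a', b'⟩ hle hab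
      obtain ⟨h1, h2⟩ := Prod.mk_le_mk.1 hle
      rw [Finset.mem_coe, Finset.mem_erase, YoungDiagram.mem_cells] at hab ⊢
      refine ⟨?_, μ.up_left_mem h1 h2 hab.2⟩
      rintro heq
      obtain ⟨rfl, rfl⟩ := Prod.mk.inj heq
      have h3 := YoungDiagram.mem_iff_lt_rowLen.1 hab.2
      rcases h1.eq_or_lt with rfl | h1
      · exact hab.1 (Prod.ext rfl (by simp only; omega))
      · have := μ.rowLen_anti (a' + 1) a h1
        omega
    · rw [← YoungDiagram.mem_cells, Finset.mem_erase, YoungDiagram.mem_cells, and_comm]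
  choose! κ hκ using hex
  have hmem : ∀ r ∈ removableRows μ, (r, μ.rowLen r - 1) ∈ μ := fun r hr =>
    YoungDiagram.mem_iff_lt_rowLen.2 (by rw [mem_removableRows] at hr; omega)
  refine Finset.card_bij (fun r _ => κ r) (fun r hr => ?_) (fun r hr s hs hrs => ?_) fun ν hν => ?_
  · rw [← mem_up_iff_mem_down]
    refine mem_up_of_insert (c := (r, μ.rowLen r - 1)) (fun h => ((hκ r hr _).1 h).2 rfl)
      fun d => ?_
    rw [hκ r hr]
    by_cases hd : d = (r, μ.rowLen r - 1)
    · simp [hd, hmem r hr]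
    · simp [hd]
  · have h1 := (hκ r hr (r, μ.rowLen r - 1)).not.1 (by
      exact fun h => ((hκ r hr _).1 h).2 rfl)
    have h2 := (hκ s hs (r, μ.rowLen r - 1)).not.1 (by
      rw [← hrs]; exact fun h => ((hκ r hr _).1 h).2 rfl)
    by_contra hne
    exact h2 ⟨hmem r hr, fun h => hne (Prod.mk.inj h).1⟩
  · obtain ⟨⟨r, j⟩, hc, hd⟩ := exists_cell (mem_up_iff_mem_down.2 hν)
    have h1 : j < μ.rowLen r := YoungDiagram.mem_iff_lt_rowLen.1 ((hd _).2 (.inl rfl))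
    have h2 : μ.rowLen r ≤ j + 1 := by
      by_contra h
      have h3 := (hd (r, j + 1)).1 (YoungDiagram.mem_iff_lt_rowLen.2 (by omega))
      rcases h3 with h3 | h3
      · simp at h3
      · exact hc (ν.up_left_mem le_rfl (Nat.le_succ j) h3)
    have h4 : μ.rowLen (r + 1) ≤ j := by
      by_contra h
      have h3 := (hd (r + 1, j)).1 (YoungDiagram.mem_iff_lt_rowLen.2 (by omega))
      rcases h3 with h3 | h3
      · simp at h3
      · exact hc (ν.up_left_mem (Nat.le_succ r) le_rfl h3)
    have hr : r ∈ removableRows μ := mem_removableRows.2 (by omega)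
    refine ⟨r, hr, ?_⟩
    have h5 : μ.rowLen r - 1 = j := by omega
    apply YoungDiagram.ext
    ext d
    rw [YoungDiagram.mem_cells, YoungDiagram.mem_cells, hκ r hr, h5, hd]
    by_cases hd' : d = (r, j)
    · simp [hd', hc]
    · simp [hd']

/-- A box can always be added to row `0`, and to row `r + 1` exactly when one can be removed from
row `r`. This is the source of the extra `1`. -/
theorem card_up (μ : YoungDiagram) : (up μ).card = (removableRows μ).card + 1 := by
  have h0 : (insert 0 ((removableRows μ).image Nat.succ)).card = (removableRows μ).card + 1 := by
    rw [Finset.card_insert_of_notMem (by simp), Finset.card_image_of_injective _ Nat.succ_injective]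
  rw [← h0]
  symm
  have hex : ∀ r ∈ insert 0 ((removableRows μ).image Nat.succ), ∃ lam : YoungDiagram,
      ∀ d, d ∈ lam ↔ d = (r, μ.rowLen r) ∨ d ∈ μ := by
    intro r hr
    refine ⟨⟨insert (r, μ.rowLen r) μ.cells, ?_⟩, fun d => ?_⟩
    · rintro ⟨a, b⟩ ⟨a', b'⟩ hle hab
      obtain ⟨h1, h2⟩ := Prod.mk_le_mk.1 hle
      rw [Finset.mem_coe, Finset.mem_insert, YoungDiagram.mem_cells] at hab ⊢
      rcases hab with hab | hab
      · obtain ⟨rfl, rfl⟩ := Prod.mk.inj hab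
        rcases h1.eq_or_lt with rfl | h1
        · rcases h2.eq_or_lt with rfl | h2
          · exact .inl rfl
          · exact .inr (YoungDiagram.mem_iff_lt_rowLen.2 h2)
        · right
          rw [Finset.mem_insert, Finset.mem_image] at hr
          rcases hr with rfl | ⟨s, hs, rfl⟩
          · omega
          · rw [mem_removableRows] at hs
            have := μ.rowLen_anti a' s (by omega)
            exact YoungDiagram.mem_iff_lt_rowLen.2 (by simp only [Nat.succ_eq_add_one] at h2; omega)
      · exact .inr (μ.up_left_mem h1 h2 hab)
    · rw [← YoungDiagram.mem_cells, Finset.mem_insert, YoungDiagram.mem_cells]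
  choose! lam hlam using hex
  have hnot : ∀ r, (r, μ.rowLen r) ∉ μ := fun r h =>
    lt_irrefl _ (YoungDiagram.mem_iff_lt_rowLen.1 h)
  refine Finset.card_bij (fun r _ => lam r) (fun r hr => mem_up_of_insert (hnot r) (hlam r hr))
    (fun r hr s hs hrs => ?_) fun ν hν => ?_
  · have h1 := (hlam r hr _).2 (.inl rfl)
    rw [hrs, hlam s hs] at h1
    exact (Prod.mk.inj (h1.resolve_right (hnot r))).1
  · obtain ⟨⟨r, j⟩, hc, hd⟩ := exists_cell hν
    have h1 : μ.rowLen r ≤ j := not_lt.1 fun h => hc (YoungDiagram.mem_iff_lt_rowLen.2 h)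
    have hmem := (hd (r, j)).2 (.inl rfl)
    have h2 : j = μ.rowLen r := by
      by_contra h
      have h3 := (hd (r, μ.rowLen r)).1 (ν.up_left_mem le_rfl h1 hmem)
      rcases h3 with h3 | h3
      · exact h (Prod.mk.inj h3).2.symm
      · exact hnot r h3
    have hr : r ∈ insert 0 ((removableRows μ).image Nat.succ) := by
      rcases r with _ | r
      · exact Finset.mem_insert_self _ _
      · refine Finset.mem_insert_of_mem (Finset.mem_image_of_mem _ (mem_removableRows.2 ?_))
        have h3 := (hd (r, j)).1 (ν.up_left_mem (Nat.le_succ r) le_rfl hmem)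
        rcases h3 with h3 | h3
        · simp at h3
        · rw [← h2]
          exact YoungDiagram.mem_iff_lt_rowLen.1 h3
    refine ⟨r, hr, ?_⟩
    apply YoungDiagram.ext
    ext d
    rw [YoungDiagram.mem_cells, YoungDiagram.mem_cells, hlam r hr, ← h2, hd]

open Classical in
-- For `μ ≠ ν` the only possible common upper and lower covers are `μ ⊔ ν` and `μ ⊓ ν`. As `|μ ⊔ ν|
-- + |μ ⊓ ν| = |μ| + |ν|`, either both are covers or neither is.
theorem card_up_inter {μ ν : YoungDiagram} (h : μ.card = ν.card) :
    (up μ ∩ up ν).card = (down μ ∩ down ν).card + if μ = ν then 1 else 0 := by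
  split_ifs with hne
  · rw [hne, Finset.inter_self, Finset.inter_self, card_up, card_down]
  have hsum : (μ ⊔ ν).card + (μ ⊓ ν).card = μ.card + ν.card :=
    Finset.card_union_add_card_inter μ.cells ν.cells
  have hlt : μ.card < (μ ⊔ ν).card := by
    by_contra hcon
    have h1 : μ.cells = (μ ⊔ ν).cells := Finset.eq_of_subset_of_card_le
      (YoungDiagram.cells_subset_iff.2 le_sup_left) (not_lt.1 hcon)
    have h2 : ν.cells = (μ ⊔ ν).cells := Finset.eq_of_subset_of_card_le
      (YoungDiagram.cells_subset_iff.2 le_sup_right) (by rw [h] at hcon; exact not_lt.1 hcon)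
    exact hne (YoungDiagram.ext (h1.trans h2.symm))
  have heq : ∀ {α β : YoungDiagram}, α ≤ β → β.card ≤ α.card → α = β := fun h1 h2 =>
    YoungDiagram.ext (Finset.eq_of_subset_of_card_le (YoungDiagram.cells_subset_iff.2 h1) h2)
  have hup : ∀ lam, lam ∈ up μ ∩ up ν ↔ lam = μ ⊔ ν ∧ (μ ⊔ ν).card = μ.card + 1 := by
    intro lam
    rw [Finset.mem_inter, mem_up, mem_up]
    constructor
    · rintro ⟨⟨h1, h2⟩, h3, -⟩
      have := heq (sup_le h1 h3) (by omega)
      exact ⟨this.symm, this ▸ h2⟩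
    · rintro ⟨rfl, h1⟩
      exact ⟨⟨le_sup_left, h1⟩, le_sup_right, by omega⟩
  have hdown : ∀ lam, lam ∈ down μ ∩ down ν ↔ lam = μ ⊓ ν ∧ (μ ⊔ ν).card = μ.card + 1 := by
    intro lam
    rw [Finset.mem_inter, mem_down, mem_down]
    constructor
    · rintro ⟨⟨h1, h2⟩, h3, -⟩
      have := heq (le_inf h1 h3) (by omega)
      exact ⟨this, by rw [← this] at hsum; omega⟩
    · rintro ⟨rfl, h1⟩
      exact ⟨⟨inf_le_left, by omega⟩, inf_le_right, by omega⟩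
  by_cases hc : (μ ⊔ ν).card = μ.card + 1
  · have h1 : up μ ∩ up ν = {μ ⊔ ν} := by ext lam; rw [hup, Finset.mem_singleton, and_iff_left hc]
    have h2 : down μ ∩ down ν = {μ ⊓ ν} := by
      ext lam; rw [hdown, Finset.mem_singleton, and_iff_left hc]
    rw [h1, h2, Finset.card_singleton, Finset.card_singleton]
  · have h1 : up μ ∩ up ν = ∅ := Finset.eq_empty_of_forall_notMem fun lam h => hc ((hup _).1 h).2
    have h2 : down μ ∩ down ν = ∅ :=
      Finset.eq_empty_of_forall_notMem fun lam h => hc ((hdown _).1 h).2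
    rw [h1, h2]
    rfl

/-- The previous count is the commutation rule `DU = UD + 1` of the operators that add and remove a
box. Rewriting each `F lam` by `hF` and applying this rule leaves `F μ` plus a sum over lower
neighbours, to which induction applies. -/
theorem sum_up {F : YoungDiagram → ℕ}
    (hF : ∀ lam : YoungDiagram, 0 < lam.card → F lam = ∑ κ ∈ down lam, F κ) (μ : YoungDiagram) :
    ∑ lam ∈ up μ, F lam = (μ.card + 1) * F μ := by
  classical
  induction hk : μ.card using Nat.strong_induction_on generalizing μ with
  | _ k ih =>
  set S := (finite_card_eq k).toFinset with hS
  have hmem : ∀ ν, ν ∈ S ↔ ν.card = k := fun ν => by simp [hS]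
  have h1 : ∑ lam ∈ up μ, F lam = ∑ ν ∈ S, (up μ ∩ up ν).card * F ν := by
    calc ∑ lam ∈ up μ, F lam = ∑ lam ∈ up μ, ∑ ν ∈ down lam, F ν :=
          Finset.sum_congr rfl fun lam h => hF lam (by rw [mem_up] at h; omega)
      _ = ∑ ν ∈ S, ∑ lam ∈ up μ ∩ up ν, F ν := by
          refine Finset.sum_comm' fun lam ν => ?_
          rw [Finset.mem_inter, mem_up_iff_mem_down (μ := ν), hmem]
          constructor
          · rintro ⟨h1, h2⟩
            have h3 := (mem_up.1 h1).2
            have h4 := (mem_down.1 h2).2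
            exact ⟨⟨h1, h2⟩, by omega⟩
          · exact fun h => h.1
      _ = _ := Finset.sum_congr rfl fun ν _ => by rw [Finset.sum_const, smul_eq_mul]
  have h2 : ∑ κ ∈ down μ, ∑ ν ∈ up κ, F ν = ∑ ν ∈ S, (down μ ∩ down ν).card * F ν := by
    calc ∑ κ ∈ down μ, ∑ ν ∈ up κ, F ν = ∑ ν ∈ S, ∑ κ ∈ down μ ∩ down ν, F ν := by
          refine Finset.sum_comm' fun κ ν => ?_
          rw [Finset.mem_inter, mem_up_iff_mem_down, hmem]
          constructor
          · rintro ⟨h1, h2⟩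
            have h3 := (mem_down.1 h1).2
            have h4 := (mem_down.1 h2).2
            exact ⟨⟨h1, h2⟩, by omega⟩
          · exact fun h => h.1
      _ = _ := Finset.sum_congr rfl fun ν _ => by rw [Finset.sum_const, smul_eq_mul]
  have h3 : ∑ κ ∈ down μ, ∑ ν ∈ up κ, F ν = k * F μ := by
    have h4 : ∀ κ ∈ down μ, ∑ ν ∈ up κ, F ν = k * F κ := fun κ hκ => by
      have h5 := (mem_down.1 hκ).2
      rw [ih κ.card (by omega) κ rfl, ← h5, hk]
    rw [Finset.sum_congr rfl h4, ← Finset.mul_sum]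
    rcases Nat.eq_zero_or_pos k with rfl | hpos
    · rw [zero_mul, zero_mul]
    · rw [hF μ (by omega)]
  have h6 : ∀ ν ∈ S, (up μ ∩ up ν).card * F ν =
      (down μ ∩ down ν).card * F ν + if μ = ν then F ν else 0 := fun ν hν => by
    rw [card_up_inter (hk.trans ((hmem ν).1 hν).symm), add_mul, ite_mul, one_mul, zero_mul]
  rw [h1, Finset.sum_congr rfl h6, Finset.sum_add_distrib, ← h2, h3, Finset.sum_ite_eq,
    if_pos ((hmem μ).2 hk)]
  ring

end Young

/-! ### Counting standard tableaux -/

section Count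

variable {n : ℕ}

/-- A standard tableau of shape `θ` with entries `1, …, n`. -/
structure IsTableau (n : ℕ) (θ : YoungDiagram) (f : Fin n → ℕ × ℕ) : Prop where
  bijOn : Set.BijOn f Set.univ {c | c ∈ θ}
  le_of_le : ∀ a b, f a ≤ f b → a ≤ b

theorem isTableau_iff {θ : YoungDiagram} {f : Fin θ.card → ℕ × ℕ} :
    IsTableau θ.card θ f ↔ IsStandard θ f := by
  constructor
  · intro h
    refine ⟨h.bijOn, fun a b h1 h2 => ?_, fun a b h1 h2 => ?_⟩
    · exact lt_of_le_of_ne (h.le_of_le a b (Prod.mk_le_mk.2 ⟨h1.le, h2.le⟩))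
        fun hab => absurd h2 (by rw [hab]; exact lt_irrefl _)
    · exact lt_of_le_of_ne (h.le_of_le a b (Prod.mk_le_mk.2 ⟨h2.le, h1.le⟩))
        fun hab => absurd h2 (by rw [hab]; exact lt_irrefl _)
  · intro h
    refine ⟨h.bijOn, fun a b hab => ?_⟩
    have h0 := (isStandardBi_baseFilling (n := θ.card) le_rfl).2 h
    have hval : ∀ a : Fin θ.card, baseFilling θ.card f a = (0, f a) := fun a => dif_pos a.2
    exact h0.mono (by rw [hval, hval]) (by rw [hval, hval]; exact hab.1)
      (by rw [hval, hval]; exact hab.2)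

theorem IsTableau.injective {θ : YoungDiagram} {f : Fin n → ℕ × ℕ} (h : IsTableau n θ f) :
    Function.Injective f := Set.injOn_univ.1 h.bijOn.injOn

theorem IsTableau.mem {θ : YoungDiagram} {f : Fin n → ℕ × ℕ} (h : IsTableau n θ f) (a : Fin n) :
    f a ∈ θ := h.bijOn.mapsTo (Set.mem_univ a)

theorem IsTableau.exists_eq {θ : YoungDiagram} {f : Fin n → ℕ × ℕ} (h : IsTableau n θ f)
    {c : ℕ × ℕ} (hc : c ∈ θ) : ∃ a, f a = c := by
  obtain ⟨a, -, ha⟩ := h.bijOn.surjOn hc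
  exact ⟨a, ha⟩

instance (n : ℕ) (θ : YoungDiagram) : Finite {f : Fin n → ℕ × ℕ // IsTableau n θ f} := by
  refine Finite.of_injective (β := Fin n → θ.cells) (fun f a => ⟨f.1 a, f.2.mem a⟩) ?_
  intro f g hfg
  refine Subtype.ext (funext fun a => ?_)
  exact congrArg Subtype.val (congrFun hfg a)

theorem IsTableau.snoc {μ lam : YoungDiagram} {c : ℕ × ℕ} (hc : c ∉ μ)
    (hd : ∀ d, d ∈ lam ↔ d = c ∨ d ∈ μ) {g : Fin n → ℕ × ℕ} (h : IsTableau n μ g) :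
    IsTableau (n + 1) lam (Fin.snoc (α := fun _ => ℕ × ℕ) g c) := by
  refine ⟨⟨fun a _ => ?_, fun a _ b _ => ?_, fun d hd' => ?_⟩, fun a b => ?_⟩
  · refine Fin.lastCases ?_ (fun a => ?_) a
    · rw [Fin.snoc_last]; exact (hd c).2 (.inl rfl)
    · rw [Fin.snoc_castSucc]; exact (hd _).2 (.inr (h.mem a))
  · refine Fin.lastCases ?_ (fun a => ?_) a <;> refine Fin.lastCases ?_ (fun b => ?_) b
    · exact fun _ => rfl
    · rw [Fin.snoc_last, Fin.snoc_castSucc]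
      exact fun he => absurd (he ▸ h.mem b) hc
    · rw [Fin.snoc_last, Fin.snoc_castSucc]
      exact fun he => absurd (he ▸ h.mem a) hc
    · rw [Fin.snoc_castSucc, Fin.snoc_castSucc]
      exact fun he => congrArg _ (h.injective he)
  · rcases (hd d).1 hd' with rfl | hd'
    · exact ⟨Fin.last n, Set.mem_univ _, Fin.snoc_last _ _⟩
    · obtain ⟨a, ha⟩ := h.exists_eq hd'
      exact ⟨a.castSucc, Set.mem_univ _, by rw [Fin.snoc_castSucc, ha]⟩
  · refine Fin.lastCases ?_ (fun a => ?_) a <;> refine Fin.lastCases ?_ (fun b => ?_) b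
    · exact fun _ => le_rfl
    · rw [Fin.snoc_last, Fin.snoc_castSucc]
      exact fun he => absurd (μ.up_left_mem he.1 he.2 (h.mem b)) hc
    · exact fun _ => Fin.le_last _
    · rw [Fin.snoc_castSucc, Fin.snoc_castSucc]
      exact fun he => Fin.castSucc_le_castSucc_iff.2 (h.le_of_le a b he)

theorem IsTableau.exists_snoc {lam : YoungDiagram} {f : Fin (n + 1) → ℕ × ℕ}
    (h : IsTableau (n + 1) lam f) :
    ∃ μ, f (Fin.last n) ∉ μ ∧ (∀ d, d ∈ lam ↔ d = f (Fin.last n) ∨ d ∈ μ) ∧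
      IsTableau n μ (Fin.init f) := by
  have hmem := h.mem (Fin.last n)
  refine ⟨⟨lam.cells.erase (f (Fin.last n)), ?_⟩, ?_, fun d => ?_, ?_⟩
  · rintro c c' hle hc
    rw [Finset.mem_coe, Finset.mem_erase, YoungDiagram.mem_cells] at hc ⊢
    refine ⟨fun heq => ?_, lam.up_left_mem hle.1 hle.2 hc.2⟩
    obtain ⟨a, rfl⟩ := h.exists_eq hc.2
    rw [heq] at hle
    exact hc.1 (congrArg f (le_antisymm (Fin.le_last a) (h.le_of_le _ _ hle)))
  · rw [← YoungDiagram.mem_cells]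
    exact Finset.notMem_erase _ _
  · rw [← YoungDiagram.mem_cells, ← YoungDiagram.mem_cells, Finset.mem_erase]
    by_cases hd : d = f (Fin.last n)
    · simp [hd, hmem]
    · simp [hd]
  · refine ⟨⟨fun a _ => ?_, fun a _ b _ hab => ?_, fun d hd' => ?_⟩, fun a b hab => ?_⟩
    · change Fin.init f a ∈ Finset.erase _ _
      exact Finset.mem_erase.2 ⟨fun he => (Fin.castSucc_lt_last a).ne (h.injective he), h.mem _⟩
    · exact Fin.castSucc_injective n (h.injective hab)
    · obtain ⟨h1, h2⟩ := Finset.mem_erase.1 (show d ∈ Finset.erase _ _ from hd')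
      obtain ⟨a, rfl⟩ := h.exists_eq h2
      refine ⟨a.castPred fun he => h1 (congrArg f he), Set.mem_univ _, ?_⟩
      simp [Fin.init]
    · exact Fin.castSucc_le_castSucc_iff.1 (h.le_of_le _ _ hab)

/-- The number of standard tableaux of a given shape. -/
noncomputable def numTableaux (θ : YoungDiagram) : ℕ :=
  Nat.card {f : Fin θ.card → ℕ × ℕ // IsTableau θ.card θ f}

theorem numTableaux_eq (θ : YoungDiagram) (hn : θ.card = n) :
    numTableaux θ = Nat.card {f : Fin n → ℕ × ℕ // IsTableau n θ f} := by
  subst hn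
  rfl

/-- The largest entry of a tableau occupies a removable box; deleting it is a bijection onto the
tableaux of the smaller shapes. -/
theorem numTableaux_eq_sum_down {lam : YoungDiagram} (hlam : 0 < lam.card) :
    numTableaux lam = ∑ κ ∈ down lam, numTableaux κ := by
  obtain ⟨n, hn⟩ : ∃ n, lam.card = n + 1 := ⟨lam.card - 1, by omega⟩
  have hcard : ∀ κ ∈ down lam, κ.card = n := fun κ hκ => by
    have := (mem_down.1 hκ).2
    omega
  rw [numTableaux_eq lam hn, Finset.sum_congr rfl fun κ hκ => numTableaux_eq κ (hcard κ hκ),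
    ← Finset.sum_coe_sort (down lam), ← Nat.card_sigma]
  symm
  have hex : ∀ κ : down lam, ∃ c, c ∉ κ.1 ∧ ∀ d, d ∈ lam ↔ d = c ∨ d ∈ κ.1 := fun κ =>
    exists_cell (mem_up_iff_mem_down.2 κ.2)
  choose c hc hd using hex
  refine Nat.card_congr (Equiv.ofBijective (fun p : Σ κ : down lam,
    {f : Fin n → ℕ × ℕ // IsTableau n κ.1 f} =>
    (⟨Fin.snoc (α := fun _ => ℕ × ℕ) p.2.1 (c p.1), p.2.2.snoc (hc p.1) (hd p.1)⟩ :
      {f : Fin (n + 1) → ℕ × ℕ // IsTableau (n + 1) lam f})) ⟨?_, ?_⟩)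
  · rintro ⟨κ, g, hg⟩ ⟨κ', g', hg'⟩ heq
    rw [Subtype.mk.injEq, Fin.snoc_injective2.eq_iff] at heq
    obtain ⟨rfl, h2⟩ := heq
    obtain rfl : κ = κ' := by
      refine Subtype.ext (SetLike.coe_injective ?_)
      exact hg.bijOn.image_eq.symm.trans hg'.bijOn.image_eq
    rfl
  · rintro ⟨f, hf⟩
    obtain ⟨μ, h1, h2, h3⟩ := hf.exists_snoc
    have hμ : μ ∈ down lam := mem_up_iff_mem_down.1 (mem_up_of_insert h1 h2)
    refine ⟨⟨⟨μ, hμ⟩, ⟨_, h3⟩⟩, Subtype.ext ?_⟩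
    have h4 : c ⟨μ, hμ⟩ = f (Fin.last n) := by
      have := (h2 _).1 ((hd ⟨μ, hμ⟩ _).2 (.inl rfl))
      exact this.resolve_right (hc ⟨μ, hμ⟩)
    simp only [h4]
    exact Fin.snoc_init_self f

end Count

/-! ### The seminormal representations of the Hecke algebra -/

section BaseMap

variable {n : ℕ} {θ : YoungDiagram} {P : (Fin n → Box) → Prop}

/-- The inclusion of `V^θ` as the span of the tableaux in which the column comes last. -/
noncomputable def baseMap (P : (Fin n → Box) → Prop) (θ : YoungDiagram) :
    V θ →ₗ[K] ({f // P f} →₀ K) :=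
  Finsupp.lift _ K _ fun T => vecP P (baseFilling n T.1)

theorem baseMap_v (T : StandardTableau θ) : baseMap P θ (v T) = vecP P (baseFilling n T.1) :=
  lift_single _ _

theorem fillT_vecP {f : Fin n → Box} (h : P f) (i : Fin (n - 1)) :
    fillT P i (vecP P f) = diag (f (lo i)) (f (hi i)) • vecP P f +
      off (f (lo i)) (f (hi i)) • vecP P (f ∘ simple i) := by
  rw [vecP_of h, fillT_single]

theorem baseFilling_comp (f : Fin θ.card → ℕ × ℕ) {i : Fin (n - 1)}
    {j : Fin (θ.card - 1)} (hij : (i : ℕ) = j) :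
    baseFilling n (f ∘ simple j) = baseFilling n f ∘ simple i := by
  funext a
  have h1 := coe_simple i a
  unfold baseFilling
  simp only [Function.comp_apply]
  by_cases ha : (a : ℕ) < θ.card
  · have h2 : ((simple i a : Fin n) : ℕ) < θ.card := by
      have := j.2
      rw [h1]
      split_ifs <;> omega
    rw [dif_pos ha, dif_pos h2]
    refine Prod.ext rfl (congrArg f (Fin.ext ?_))
    rw [coe_simple]
    simp only [h1, hij]
  · have h2 : ((simple i a : Fin n) : ℕ) = a := by
      have := j.2
      rw [h1, if_neg (by omega), if_neg (by omega)]
    rw [dif_neg ha, dif_neg (by omega), h2]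

theorem baseFilling_lo_hi (f : Fin θ.card → ℕ × ℕ) {i : Fin (n - 1)}
    {j : Fin (θ.card - 1)} (hij : (i : ℕ) = j) :
    baseFilling n f (lo i) = (0, f (lo j)) ∧ baseFilling n f (hi i) = (0, f (hi j)) := by
  have hj := j.2
  unfold baseFilling
  constructor
  · rw [dif_pos (by rw [coe_lo]; omega)]
    exact Prod.ext rfl (congrArg f (Fin.ext hij))
  · rw [dif_pos (by rw [coe_hi]; omega)]
    exact Prod.ext rfl (congrArg f (Fin.ext (show ((hi i : Fin n) : ℕ) = (hi j : Fin θ.card) by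
      rw [coe_hi, coe_hi, hij])))

theorem standard_comp_of_off {T : Fin θ.card → ℕ × ℕ} (hT : IsStandard θ T) (j : Fin (θ.card - 1))
    (h : off (0, T (lo j)) (0, T (hi j)) ≠ 0) : IsStandard θ (T ∘ simple j) := by
  have h1 := (isStandardBi_baseFilling (n := θ.card) le_rfl).2 hT
  obtain ⟨e1, e2⟩ := baseFilling_lo_hi T (i := j) rfl
  rw [← isStandardBi_baseFilling (n := θ.card) le_rfl, baseFilling_comp T (i := j) rfl]
  refine (admissible_standard θ).closed _ h1 j ?_
  rwa [e1, e2]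

theorem baseMap_intertwines (hP : ∀ f, IsStandardBi n (columnShape n θ) f → P f)
    (hθ : θ.card ≤ n) {i : Fin (n - 1)} {j : Fin (θ.card - 1)} (hij : (i : ℕ) = j) (u : V θ) :
    fillT P i (baseMap P θ u) = baseMap P θ (seminormalOp θ j u) := by
  suffices h : fillT P i ∘ₗ baseMap P θ = baseMap P θ ∘ₗ seminormalOp θ j from
    LinearMap.congr_fun h u
  refine Finsupp.lhom_ext' fun T => LinearMap.ext_ring ?_
  change fillT P i (baseMap P θ (v T)) = baseMap P θ (seminormalOp θ j (v T))
  obtain ⟨e1, e2⟩ := baseFilling_lo_hi T.1 hij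
  rw [seminormalOp_v, baseMap_v, map_add, map_smul, map_smul, baseMap_v,
    fillT_vecP (hP _ ((isStandardBi_baseFilling hθ).2 T.2)), e1, e2,
    ← baseFilling_comp _ hij]
  congr 1
  by_cases h : off (0, T.1 (lo j)) (0, T.1 (hi j)) = 0
  · rw [h, zero_smul, zero_smul]
  · have := standard_comp_of_off T.2 j h
    rw [vecV, dif_pos this, baseMap_v]

/-- The operators on `V^θ` satisfy the Hecke relations. -/
theorem isHecke_seminormalOp (θ : YoungDiagram) : IsHecke (seminormalOp θ) := by
  -- For `n = |θ|` the column is empty and `baseMap` embeds `V^θ` into a module where the relations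
  -- are known.
  have h := (admissible_standard (n := θ.card) θ).isHecke
  have hi : ∀ j u, fillT _ j (baseMap _ θ u) = baseMap _ θ (seminormalOp θ j u) := fun j u =>
    baseMap_intertwines (P := IsStandardBi θ.card (columnShape θ.card θ)) (fun _ h => h) le_rfl rfl u
  have hinj : Function.Injective (baseMap (IsStandardBi θ.card (columnShape θ.card θ)) θ) := by
    have h1 : baseMap (IsStandardBi θ.card (columnShape θ.card θ)) θ =
        Finsupp.lmapDomain K K fun T : StandardTableau θ =>
          (⟨baseFilling θ.card T.1, (isStandardBi_baseFilling le_rfl).2 T.2⟩ :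
            {f // IsStandardBi θ.card (columnShape θ.card θ) f}) := by
      refine Finsupp.lhom_ext' fun T => LinearMap.ext_ring ?_
      refine (baseMap_v T).trans ?_
      rw [vecP_of ((isStandardBi_baseFilling le_rfl).2 T.2)]
      simp
    rw [h1]
    exact Finsupp.mapDomain_injective fun T T' hTT' =>
      Subtype.ext (baseFilling_injective le_rfl (congrArg Subtype.val hTT'))
  refine ⟨fun i => ?_, fun i j hij => ?_, fun i j hij => ?_⟩ <;>
    refine LinearMap.ext fun u => hinj ?_ <;>
    simp only [Module.End.mul_apply, LinearMap.add_apply, LinearMap.smul_apply,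
      Module.End.one_apply, map_add, map_smul, ← hi]
  · exact LinearMap.congr_fun (h.quadratic i) _
  · exact LinearMap.congr_fun (h.braid i j hij) _
  · exact LinearMap.congr_fun (h.comm i j hij) _

end BaseMap

/-! ### The branching rule for induction -/

section Branching

variable {n : ℕ} {μ lam : YoungDiagram}

theorem IsStandardBi.fst_eq_zero {f : Fin n → Box} (h : IsStandardBi n (columnShape n lam) f)
    (hn : lam.card = n) (a : Fin n) : (f a).1 = 0 := by
  refine (fin_two_cases _).resolve_right fun h1 => ?_
  have h2 := h.mem a
  rw [h1] at h2
  have := (mem_column.1 h2).1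
  omega

/-- A filling of one diagram as a filling of a pair. -/
def pairFilling (g : Fin n → ℕ × ℕ) : Fin n → Box := fun a => (0, g a)

theorem IsTableau.isStandardBi {g : Fin n → ℕ × ℕ} (h : IsTableau n lam g) (hn : lam.card = n) :
    IsStandardBi n (columnShape n lam) (pairFilling g) := by
  subst hn
  have h1 := (isStandardBi_baseFilling (n := lam.card) le_rfl).2 (isTableau_iff.1 h)
  rwa [show baseFilling lam.card g = pairFilling g from funext fun a => dif_pos a.2] at h1

variable (μ) in
/-- The tableaux whose shape is obtained from `μ` by adding a box. -/
def IsUpFilling (f : Fin (μ.card + 1) → Box) : Prop :=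
  ∃ lam ∈ up μ, IsStandardBi (μ.card + 1) (columnShape (μ.card + 1) lam) f

theorem admissible_up (μ : YoungDiagram) : Admissible (IsUpFilling μ) where
  std _ := fun ⟨lam, _, h⟩ => ⟨lam, h⟩
  closed f := fun ⟨lam, hlam, h⟩ i h0 => ⟨lam, hlam, (admissible_standard lam).closed f h i h0⟩

/-- The first component has all boxes, so `1` always lies in it. Jucys-Murphy elements are therefore
expressed by the `fillT` alone. -/
theorem fillX_up (x : {f // IsUpFilling μ f} →₀ K) : fillX (IsUpFilling μ) x = x := by
  suffices h : fillX (IsUpFilling μ) = LinearMap.id from LinearMap.congr_fun h x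
  refine Finsupp.lhom_ext' fun f => LinearMap.ext_ring ?_
  obtain ⟨lam, hlam, h⟩ := f.2
  simp only [LinearMap.comp_apply, Finsupp.lsingle_apply, LinearMap.id_apply]
  rw [fillX_single, if_pos (h.fst_eq_zero (mem_up.1 hlam).2 0)]

/-- The box added to `μ`. -/
noncomputable def upCell (lam : up μ) : ℕ × ℕ := (exists_cell lam.2).choose

theorem upCell_notMem (lam : up μ) : upCell lam ∉ μ := (exists_cell lam.2).choose_spec.1

theorem mem_iff_upCell (lam : up μ) (d : ℕ × ℕ) : d ∈ lam.1 ↔ d = upCell lam ∨ d ∈ μ :=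
  (exists_cell lam.2).choose_spec.2 d

theorem upCell_injective : Function.Injective (upCell (μ := μ)) := by
  intro lam lam' h
  refine Subtype.ext (YoungDiagram.ext (Finset.ext fun d => ?_))
  rw [YoungDiagram.mem_cells, YoungDiagram.mem_cells, mem_iff_upCell, mem_iff_upCell, h]

/-- The filling obtained from a tableau of shape `μ` by putting the largest entry in the added
box. -/
noncomputable def extend (lam : up μ) (T : Fin μ.card → ℕ × ℕ) : Fin (μ.card + 1) → Box :=
  pairFilling (Fin.snoc (α := fun _ => ℕ × ℕ) T (upCell lam))

theorem isStandardBi_extend (lam : up μ) {T : Fin μ.card → ℕ × ℕ} (hT : IsStandard μ T) :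
    IsStandardBi (μ.card + 1) (columnShape (μ.card + 1) lam.1) (extend lam T) :=
  ((isTableau_iff.2 hT).snoc (upCell_notMem lam) (mem_iff_upCell lam)).isStandardBi
    (mem_up.1 lam.2).2

theorem extend_castSucc (lam : up μ) (T : Fin μ.card → ℕ × ℕ) (a : Fin μ.card) :
    extend lam T a.castSucc = (0, T a) := by
  rw [extend, pairFilling, Fin.snoc_castSucc]

theorem extend_last (lam : up μ) (T : Fin μ.card → ℕ × ℕ) :
    extend lam T (Fin.last μ.card) = (0, upCell lam) := by
  rw [extend, pairFilling, Fin.snoc_last]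

theorem extend_comp (lam : up μ) (T : Fin μ.card → ℕ × ℕ) {i : Fin (μ.card + 1 - 1)}
    {j : Fin (μ.card - 1)} (hij : (i : ℕ) = j) :
    extend lam (T ∘ simple j) = extend lam T ∘ simple i := by
  have hj := j.2
  funext a
  refine Fin.lastCases ?_ (fun a => ?_) a
  · have h1 : simple i (Fin.last μ.card) = Fin.last μ.card := by
      rw [Fin.ext_iff, coe_simple, Fin.val_last, if_neg (by omega), if_neg (by omega)]
    rw [Function.comp_apply, h1, extend_last, extend_last]
  · have h1 : simple i a.castSucc = (simple j a).castSucc := by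
      rw [Fin.ext_iff, coe_simple, Fin.val_castSucc, Fin.val_castSucc, coe_simple, hij]
    rw [Function.comp_apply, h1, extend_castSucc, extend_castSucc, Function.comp_apply]

theorem extend_lo_hi (lam : up μ) (T : Fin μ.card → ℕ × ℕ) {i : Fin (μ.card + 1 - 1)}
    {j : Fin (μ.card - 1)} (hij : (i : ℕ) = j) :
    extend lam T (lo i) = (0, T (lo j)) ∧ extend lam T (hi i) = (0, T (hi j)) := by
  rw [← extend_castSucc lam T, ← extend_castSucc lam T]
  refine ⟨congrArg _ (Fin.ext hij), congrArg _ (Fin.ext ?_)⟩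
  rw [coe_hi, Fin.val_castSucc, coe_hi, hij]

/-- The map from `V^μ` to the sum of the `V^λ` for the diagrams `λ` obtained by adding a box. -/
noncomputable def upMap (μ : YoungDiagram) : V μ →ₗ[K] ({f // IsUpFilling μ f} →₀ K) :=
  Finsupp.lift _ K _ fun T => ∑ lam : up μ, vecP (IsUpFilling μ) (extend lam T.1)

theorem upMap_v (T : StandardTableau μ) :
    upMap μ (v T) = ∑ lam : up μ, vecP (IsUpFilling μ) (extend lam T.1) := lift_single _ _

/-- The smaller Hecke algebra does not move the largest entry, so its generators act with the same
coefficients on all extensions of a tableau. -/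
theorem upMap_intertwines {i : Fin (μ.card + 1 - 1)} {j : Fin (μ.card - 1)} (hij : (i : ℕ) = j)
    (u : V μ) : fillT (IsUpFilling μ) i (upMap μ u) = upMap μ (seminormalOp μ j u) := by
  suffices h : fillT (IsUpFilling μ) i ∘ₗ upMap μ = upMap μ ∘ₗ seminormalOp μ j from
    LinearMap.congr_fun h u
  refine Finsupp.lhom_ext' fun T => LinearMap.ext_ring ?_
  change fillT _ i (upMap μ (v T)) = upMap μ (seminormalOp μ j (v T))
  rw [seminormalOp_v, upMap_v, map_sum, map_add, map_smul, map_smul, upMap_v]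
  have h1 : ∀ lam : up μ, fillT (IsUpFilling μ) i (vecP (IsUpFilling μ) (extend lam T.1)) =
      diag (0, T.1 (lo j)) (0, T.1 (hi j)) • vecP (IsUpFilling μ) (extend lam T.1) +
        off (0, T.1 (lo j)) (0, T.1 (hi j)) •
          vecP (IsUpFilling μ) (extend lam (T.1 ∘ simple j)) := by
    intro lam
    obtain ⟨e1, e2⟩ := extend_lo_hi lam T.1 hij
    rw [fillT_vecP ⟨lam.1, lam.2, isStandardBi_extend lam T.2⟩, e1, e2,
      ← extend_comp lam T.1 hij]
  rw [Finset.sum_congr rfl fun lam _ => h1 lam, Finset.sum_add_distrib, ← Finset.smul_sum,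
    ← Finset.smul_sum]
  congr 1
  by_cases h : off (0, T.1 (lo j)) (0, T.1 (hi j)) = 0
  · rw [h, zero_smul, zero_smul]
  · have := standard_comp_of_off T.2 j h
    rw [vecV, dif_pos this, upMap_v]

/-- A stable subspace that contains the image of `upMap` is everything. -/
theorem eq_top_of_upMap_mem {S : Submodule K ({f // IsUpFilling μ f} →₀ K)}
    (hS : ∀ i, ∀ x ∈ S, fillT (IsUpFilling μ) i x ∈ S) (h : ∀ T, upMap μ (v T) ∈ S) : S = ⊤ := by
  rw [eq_top_iff]
  intro w _
  rw [← w.sum_single]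
  refine S.sum_mem fun g _ => ?_
  suffices h2 : Finsupp.single g 1 ∈ S by
    have h2 := S.smul_mem (w g) h2
    rwa [Finsupp.smul_single, smul_eq_mul, mul_one] at h2
  obtain ⟨lam, hlam, hg⟩ := g.2
  obtain ⟨T⟩ := exists_standardTableau μ
  have hstd : ∀ lam : up μ, IsUpFilling μ (extend lam T.1) := fun lam =>
    ⟨lam.1, lam.2, isStandardBi_extend lam T.2⟩
  -- The summands of `upMap μ (v T)` are different basis vectors, told apart by the added box. Hence
  -- each occurs with coefficient `1`, and diagonal separation extracts it from the sum.
  have hv : upMap μ (v T) ⟨_, hstd ⟨lam, hlam⟩⟩ ≠ 0 := by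
    rw [upMap_v, Finsupp.finsetSum_apply, Finset.sum_eq_single ⟨lam, hlam⟩, vecP_of (hstd _),
      Finsupp.single_eq_same]
    · exact one_ne_zero
    · intro lam' _ hne
      rw [vecP_of (hstd _), Finsupp.single_eq_of_ne]
      intro heq
      have h1 := congrFun (congrArg Subtype.val heq) (Fin.last μ.card)
      simp only [extend_last] at h1
      exact hne (upCell_injective (Prod.mk.inj h1).2.symm)
    · exact fun h => absurd (Finset.mem_univ _) h
  exact (admissible_up μ).single_mem_of_shape hS (isStandardBi_extend ⟨lam, hlam⟩ T.2) hg
    ((admissible_up μ).single_mem (fun x hx => by rwa [fillX_up]) hS (h T) hv)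

variable (μ) in
/-- A bitableau whose second component is one box, as an entry and a tableau. -/
theorem exists_box_split :
    ∃ φ : StandardBitableau (μ.card + 1) (columnShape (μ.card + 1) μ) →
      Fin (μ.card + 1) × {f : Fin μ.card → ℕ × ℕ // IsTableau μ.card μ f},
      Function.Injective φ := by
  have hbox : ∀ c, c ∈ column (μ.card + 1 - μ.card) ↔ c = (0, 0) := fun c => by
    rw [mem_column, show μ.card + 1 - μ.card = 1 by omega, Nat.lt_one_iff, Prod.ext_iff]
  have hex : ∀ U : StandardBitableau (μ.card + 1) (columnShape (μ.card + 1) μ),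
      ∃ a, U.1 a = (1, (0, 0)) := fun U => U.2.exists_eq ((hbox _).2 rfl)
  choose a ha using hex
  have h0 : ∀ (U : StandardBitableau (μ.card + 1) (columnShape (μ.card + 1) μ)) b,
      (U.1 ((a U).succAbove b)).1 = 0 := fun U b => by
    refine (fin_two_cases _).resolve_right fun h1 => Fin.succAbove_ne (a U) b ?_
    have h2 := U.2.mem ((a U).succAbove b)
    rw [h1] at h2
    exact U.2.injective ((Prod.ext h1 ((hbox _).1 h2)).trans (ha U).symm)
  have hT : ∀ U : StandardBitableau (μ.card + 1) (columnShape (μ.card + 1) μ),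
      IsTableau μ.card μ fun b => (U.1 ((a U).succAbove b)).2 := by
    intro U
    refine ⟨⟨fun b _ => ?_, fun b _ c _ hbc => ?_, fun d hd => ?_⟩, fun b c hbc => ?_⟩
    · have := U.2.mem ((a U).succAbove b)
      rwa [h0] at this
    · exact Fin.succAbove_right_injective
        (U.2.injective (Prod.ext ((h0 U b).trans (h0 U c).symm) hbc))
    · obtain ⟨b, hb⟩ := U.2.exists_eq (c := (0, d)) hd
      have hne : b ≠ a U := by
        rintro rfl
        rw [ha] at hb
        simp at hb
      obtain ⟨c, rfl⟩ := Fin.exists_succAbove_eq hne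
      exact ⟨c, Set.mem_univ _, by simp only [hb]⟩
    · exact (Fin.strictMono_succAbove _).le_iff_le.1
        (U.2.mono ((h0 U b).trans (h0 U c).symm) hbc.1 hbc.2)
  refine ⟨fun U => (a U, ⟨_, hT U⟩), fun U U' h => ?_⟩
  obtain ⟨h1, h2⟩ := Prod.mk.inj h
  have h3 := congrArg Subtype.val h2
  refine Subtype.ext (funext fun b => ?_)
  by_cases hb : b = a U
  · rw [hb, ha, h1, ha]
  · obtain ⟨c, rfl⟩ := Fin.exists_succAbove_eq hb
    refine Prod.ext ((h0 U c).trans ?_) ((congrFun h3 c).trans ?_)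
    · rw [h1, h0]
    · simp only [h1]

theorem card_up_le [Finite {f // IsUpFilling μ f}] :
    (μ.card + 1) * numTableaux μ ≤ Nat.card {f // IsUpFilling μ f} := by
  rw [← sum_up fun lam h => numTableaux_eq_sum_down h,
    Finset.sum_congr rfl fun lam h => numTableaux_eq lam (mem_up.1 h).2,
    ← Finset.sum_coe_sort (up μ), ← Nat.card_sigma]
  refine Nat.card_le_card_of_injective (fun p : Σ lam : up μ,
    {f : Fin (μ.card + 1) → ℕ × ℕ // IsTableau (μ.card + 1) lam.1 f} =>
    (⟨pairFilling p.2.1, p.1.1, p.1.2, p.2.2.isStandardBi (mem_up.1 p.1.2).2⟩ :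
      {f // IsUpFilling μ f})) ?_
  rintro ⟨lam, g, hg⟩ ⟨lam', g', hg'⟩ heq
  replace heq := congrArg Subtype.val heq
  obtain rfl : g = g' := funext fun a => congrArg Prod.snd (congrFun heq a)
  obtain rfl : lam = lam' :=
    Subtype.ext (SetLike.coe_injective (hg.bijOn.image_eq.symm.trans hg'.bijOn.image_eq))
  rfl

/-- The module induced from `V^μ` is the sum of the `V^λ` for the diagrams `λ` obtained by adding a
box. -/
theorem exists_branching (μ : YoungDiagram) :
    ∃ G : BiModule (μ.card + 1) (columnShape (μ.card + 1) μ) ≃ₗ[K] ({f // IsUpFilling μ f} →₀ K),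
      ∀ i x, G (fillT (IsStandardBi (μ.card + 1) (columnShape (μ.card + 1) μ)) i x) =
        fillT (IsUpFilling μ) i (G x) := by
  -- The bimodule of shape `(μ, (1))` plays the role of the induced module; its sign condition is
  -- empty. The map is surjective because its image contains `upMap`, and bijective because its
  -- source has dimension at most `(|μ| + 1) f^μ`, which does not exceed the dimension of the
  -- target.
  obtain ⟨G, hG, hG'⟩ := exists_intertwiner_first (admissible_up μ).isHecke (Nat.le_succ _) (upMap μ)
    (fun i j hij u => upMap_intertwines hij u) fun i hi' => absurd i.2 (by omega)
  have hsurj : Function.Surjective G := by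
    rw [← LinearMap.range_eq_top]
    refine eq_top_of_upMap_mem ?_ fun T => ⟨_, hG' T⟩
    rintro i _ ⟨x, rfl⟩
    exact ⟨_, hG i x⟩
  obtain ⟨φ, hφ⟩ := exists_box_split μ
  have hfin : Finite (StandardBitableau (μ.card + 1) (columnShape (μ.card + 1) μ)) :=
    Finite.of_injective φ hφ
  have hfin1 : Module.Finite K (BiModule (μ.card + 1) (columnShape (μ.card + 1) μ)) :=
    inferInstance
  have hfin2 : Module.Finite K ({f // IsUpFilling μ f} →₀ K) := Module.Finite.of_surjective G hsurj
  have hfin3 : Finite {f // IsUpFilling μ f} :=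
    Module.Finite.finite_basis (Finsupp.basisSingleOne (R := K) (ι := {f // IsUpFilling μ f}))
  have h1 : Module.finrank K (BiModule (μ.card + 1) (columnShape (μ.card + 1) μ)) =
      Nat.card (StandardBitableau (μ.card + 1) (columnShape (μ.card + 1) μ)) :=
    Module.finrank_eq_nat_card_basis Finsupp.basisSingleOne
  have h2 : Module.finrank K ({f // IsUpFilling μ f} →₀ K) = Nat.card {f // IsUpFilling μ f} :=
    Module.finrank_eq_nat_card_basis Finsupp.basisSingleOne
  have h3 := Nat.card_le_card_of_injective φ hφ
  rw [Nat.card_prod, Nat.card_fin] at h3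
  have h4 : Module.finrank K (BiModule (μ.card + 1) (columnShape (μ.card + 1) μ)) =
      Module.finrank K ({f // IsUpFilling μ f} →₀ K) := by
    refine le_antisymm ?_ (LinearMap.finrank_le_finrank_of_surjective hsurj)
    rw [h1, h2]
    exact h3.trans card_up_le
  exact ⟨LinearEquiv.ofBijective G
    ⟨(LinearMap.injective_iff_surjective_of_finrank_eq_finrank h4).2 hsurj, hsurj⟩, hG⟩

end Branching

/-- Every non-zero module over a Hecke algebra contains a non-zero image of a seminormal
representation. -/
theorem exists_seminormal_map (k : ℕ) {W : Type*} [AddCommGroup W] [Module K W] [Nontrivial W]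
    {t : Fin (k - 1) → Module.End K W} (ht : IsHecke t) :
    ∃ θ : YoungDiagram, θ.card = k ∧ ∃ ι : V θ →ₗ[K] W, ι ≠ 0 ∧
      ∀ (i : Fin (k - 1)) (j : Fin (θ.card - 1)), (i : ℕ) = j →
        ∀ u, t i (ι u) = ι (seminormalOp θ j u) := by
  induction k with
  | zero =>
    obtain ⟨w, hw⟩ := exists_ne (0 : W)
    obtain ⟨T⟩ := exists_standardTableau ⊥
    refine ⟨⊥, rfl, Finsupp.lift W K _ fun _ => w, fun h => hw ?_, fun i => absurd i.2 (by omega)⟩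
    have := LinearMap.congr_fun h (v T)
    rwa [v, lift_single] at this
  | succ k ih =>
    obtain ⟨μ, rfl, ι, hι, h⟩ := ih (t := fun i => t (Fin.castLE (by omega) i))
      ⟨fun i => ht.quadratic _, fun i j hij => ht.braid _ _ hij, fun i j hij => ht.comm _ _ hij⟩
    -- The map found for the smaller algebra extends to the induced module, which is then replaced
    -- by the sum of the `V^λ`.
    obtain ⟨G, hG, hG'⟩ := exists_intertwiner_first ht (Nat.le_succ _) ι
      (fun i j hij => h ⟨i, by omega⟩ j hij) fun i hi' => absurd i.2 (by omega)
    obtain ⟨B, hB⟩ := exists_branching μ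
    let ψ : ({f // IsUpFilling μ f} →₀ K) →ₗ[K] W := G ∘ₗ B.symm.toLinearMap
    have hψ : ∀ i x, ψ (fillT (IsUpFilling μ) i x) = t i (ψ x) := by
      intro i x
      change G (B.symm _) = t i (G (B.symm x))
      rw [← hG]
      congr 1
      rw [LinearEquiv.symm_apply_eq, hB, LinearEquiv.apply_symm_apply]
    have hψ0 : ψ ≠ 0 := by
      intro h0
      refine hι (Finsupp.lhom_ext' fun T => LinearMap.ext_ring ?_)
      refine (hG' T).symm.trans ?_
      have h1 := LinearMap.congr_fun h0 (B (vBi ⟨_, (isStandardBi_baseFilling (Nat.le_succ _)).2 T.2⟩))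
      rwa [LinearMap.comp_apply, LinearEquiv.coe_coe, LinearEquiv.symm_apply_apply] at h1
    obtain ⟨f, hf⟩ : ∃ f, ψ (Finsupp.single f 1) ≠ 0 := by
      by_contra! hcon
      exact hψ0 (Finsupp.lhom_ext' fun f => LinearMap.ext_ring (hcon f))
    obtain ⟨lam, hlam, hf'⟩ := f.2
    have hcard := (mem_up.1 hlam).2
    have hP : ∀ g, IsStandardBi (μ.card + 1) (columnShape (μ.card + 1) lam) g → IsUpFilling μ g :=
      fun g hg => ⟨lam, hlam, hg⟩
    refine ⟨lam, hcard, ψ ∘ₗ baseMap (IsUpFilling μ) lam, fun h0 => hf ?_, fun i j hij u => ?_⟩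
    -- `ker ψ` is stable; if it contained one tableau of shape `lam`, it would contain all of them,
    -- including `f`.
    · obtain ⟨T⟩ := exists_standardTableau lam
      have h1 := LinearMap.congr_fun h0 (v T)
      have h2 := (isStandardBi_baseFilling hcard.le).2 T.2
      rw [LinearMap.comp_apply, baseMap_v, vecP_of (hP _ h2)] at h1
      exact (admissible_up μ).single_mem_of_shape (S := LinearMap.ker ψ)
        (fun i x hx => by rw [LinearMap.mem_ker] at hx ⊢; rw [hψ, hx, map_zero]) h2 hf' h1
    · change t i (ψ _) = ψ (baseMap _ _ _)
      rw [← hψ, baseMap_intertwines hP hcard.le hij]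

/-- Every non-zero module over `H_n(1,0) / I` receives a non-zero map from a seminormal module of
shape `(θ, 1^{n-k})`. -/
theorem exists_seminormal_biModule_map {n : ℕ} [NeZero n] {N : Type*} [AddCommGroup N] [Module K N]
    [Nontrivial N] {x : Module.End K N} {t : Fin (n - 1) → Module.End K N} (h : IsCyclo x t) :
    ∃ θ : YoungDiagram, θ.card ≤ n ∧ ∃ G : BiModule n (columnShape n θ) →ₗ[K] N,
      (∀ i y, G (fillT (IsStandardBi n (columnShape n θ)) i y) = t i (G y)) ∧
      (∀ y, G (fillX (IsStandardBi n (columnShape n θ)) y) = x (G y)) ∧ G ≠ 0 := by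
  classical
  have hn := NeZero.pos n
  -- `j` will be the length of the column. Maximality means that `Q (1 - L_{j+1}) = 0` if `j < n`,
  -- so that `L_{j+1}` fixes the image of `Q`.
  set j := Nat.findGreatest (fun j => colProj x t j ≠ 0) n with hj
  have hjn : j ≤ n := Nat.findGreatest_le n
  have hQ : colProj x t j ≠ 0 :=
    Nat.findGreatest_spec (P := fun j => colProj x t j ≠ 0) (Nat.zero_le n) one_ne_zero
  have hmax : j < n → colProj x t (j + 1) = 0 := fun hlt => by
    by_contra hne
    have := Nat.le_findGreatest (P := fun j => colProj x t j ≠ 0) hlt hne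
    omega
  set Q := colProj x t j
  let W : Submodule K N := LinearMap.range Q
  have hcomm : ∀ i : Fin (n - 1), (i : ℕ) + 1 ≠ j → ∀ y, t i (Q y) = Q (t i y) := fun i hi' y =>
    LinearMap.congr_fun (h.t_comm_colProj i j (by omega) hi') y
  have hW : ∀ i : Fin (n - 1), (i : ℕ) + 1 ≠ j → ∀ w ∈ W, t i w ∈ W := by
    rintro i hi' _ ⟨y, rfl⟩
    exact ⟨t i y, (hcomm i hi' y).symm⟩
  have : Nontrivial W := by
    obtain ⟨y, hy⟩ : ∃ y, Q y ≠ 0 := by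
      by_contra! hcon
      exact hQ (LinearMap.ext hcon)
    exact ⟨⟨Q y, y, rfl⟩, 0, fun h0 => hy (congrArg Subtype.val h0)⟩
  -- The index `j + a` stands for `T_{j+a+1}`; the generator `T_j`, to which `t_comm_colProj` does
  -- not apply, is skipped.
  let t' : Fin (n - j - 1) → Module.End K W := fun a =>
    (t ⟨j + a, by omega⟩).restrict (hW ⟨j + a, by omega⟩ (by simp only; omega))
  have ht' : IsHecke t' :=
    ⟨fun a => LinearMap.ext fun w => Subtype.ext
        (LinearMap.congr_fun (h.hecke.quadratic ⟨j + a, by omega⟩) w.1),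
      fun a b hab => LinearMap.ext fun w => Subtype.ext
        (LinearMap.congr_fun (h.hecke.braid ⟨j + a, by omega⟩ ⟨j + b, by omega⟩
          (by simp only; omega)) w.1),
      fun a b hab => LinearMap.ext fun w => Subtype.ext
        (LinearMap.congr_fun (h.hecke.comm ⟨j + a, by omega⟩ ⟨j + b, by omega⟩
          (by simp only; omega)) w.1)⟩
  obtain ⟨θ, hθ, ι, hι, hι'⟩ := exists_seminormal_map (n - j) ht'
  have hd : n - θ.card = j := by omega
  refine ⟨θ, by omega, exists_intertwiner_last h (by omega) (W.subtype ∘ₗ ι) (fun i a hia u => ?_)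
    (fun i hi' u => ?_) (fun hpos u => ?_) (fun hpos u => ?_) fun h0 => hι ?_⟩
  · have h1 := congrArg Subtype.val (hι' ⟨a, by omega⟩ a rfl u)
    rw [hd] at hia
    rwa [show (t' ⟨a, by omega⟩ (ι u) : W).1 = t i (ι u).1 from
      congrArg (fun i => t i (ι u).1) (Fin.ext hia.symm)] at h1
  · obtain ⟨y, hy⟩ := (ι u).2
    rw [hd] at hi'
    change t i (ι u).1 = -(ι u).1
    rw [← hy, hcomm i (by omega)]
    exact LinearMap.congr_fun (h.colProj_mul_t i j (by omega) hi') y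
  · obtain ⟨y, hy⟩ := (ι u).2
    have h1 := LinearMap.congr_fun (h.x_mul_colProj (j - 1) (by omega)) y
    rw [Nat.sub_add_cancel (by omega)] at h1
    change x (ι u).1 = 0
    rw [← hy]
    exact h1
  · obtain ⟨y, hy⟩ := (ι u).2
    have h1 := LinearMap.congr_fun (hmax (by omega)) y
    have h2 := LinearMap.congr_fun (h.jm_comm_colProj j j (by omega) (by omega)) y
    change jm x t (n - θ.card) (ι u).1 = (ι u).1
    rw [hd, ← hy]
    refine h2.trans ?_
    rw [colProj, mul_sub, mul_one] at h1
    exact (sub_eq_zero.1 h1).symm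
  · refine LinearMap.ext fun u => Subtype.ext ?_
    exact LinearMap.congr_fun h0 u

/-! ### Intertwiners -/

section Generators

variable {M N : Type*} [AddCommGroup M] [Module K M] [AddCommGroup N] [Module K N]

theorem intertwines_of_generators {X A : Type} [Ring A] [Algebra K A] {p : FreeAlgebra K X →ₐ[K] A}
    (hp : Function.Surjective p) {α : A →ₐ[K] Module.End K M} {β : A →ₐ[K] Module.End K N}
    {G : M →ₗ[K] N} (h : ∀ x m, G (α (p (FreeAlgebra.ι K x)) m) = β (p (FreeAlgebra.ι K x)) (G m))
    (a : A) (m : M) : G (α a m) = β a (G m) := by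
  obtain ⟨a, rfl⟩ := hp a
  induction a using FreeAlgebra.induction generalizing m with
  | grade0 c => simp [Module.algebraMap_end_apply]
  | grade1 x => exact h x m
  | mul a b ha hb => rw [map_mul, map_mul, map_mul, Module.End.mul_apply, Module.End.mul_apply, ha, hb]
  | add a b ha hb =>
    rw [map_add, map_add, map_add, LinearMap.add_apply, LinearMap.add_apply, map_add, ha, hb]

theorem hecke_intertwines {n : ℕ} {α : Hecke n →ₐ[K] Module.End K M}
    {β : Hecke n →ₐ[K] Module.End K N} {G : M →ₗ[K] N}
    (h : ∀ i m, G (α (Hecke.T i) m) = β (Hecke.T i) (G m)) (a : Hecke n) (m : M) :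
    G (α a m) = β a (G m) :=
  intertwines_of_generators (p := Hecke.mk n) (RingQuot.mkAlgHom_surjective K _) h a m

theorem mirabolic_intertwines {n : ℕ} {α : MirabolicHecke n →ₐ[K] Module.End K M}
    {β : MirabolicHecke n →ₐ[K] Module.End K N} {G : M →ₗ[K] N}
    (h0 : ∀ m, G (α (MirabolicHecke.T₀ n) m) = β (MirabolicHecke.T₀ n) (G m))
    (h : ∀ i m, G (α (MirabolicHecke.T i) m) = β (MirabolicHecke.T i) (G m))
    (a : MirabolicHecke n) (m : M) : G (α a m) = β a (G m) := by
  refine intertwines_of_generators (p := MirabolicHecke.mk n) (RingQuot.mkAlgHom_surjective K _)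
    (fun o m => ?_) a m
  cases o with
  | none => exact h0 m
  | some i => exact h i m

end Generators

/-! ### The induced module -/

section Induced

variable {n : ℕ} {θ : YoungDiagram}

theorem smul_tens (h h' : Hecke n) (u : V θ) : h • tens (θ := θ) h' u = tens (h * h') u := rfl

theorem tens_mul_T (h : Hecke n) {i : Fin (n - 1)} {j : Fin (θ.card - 1)} (hij : (i : ℕ) = j)
    (u : V θ) : tens (h * Hecke.T i) u = tens h (seminormalOp θ j u) := by
  refine (Submodule.Quotient.eq _).2 (Submodule.subset_span (.inl ⟨h, i, j, u, hij, rfl⟩))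

theorem tens_mul_T_of_le (h : Hecke n) {i : Fin (n - 1)} (hi' : θ.card ≤ i) (u : V θ) :
    tens (h * Hecke.T i) u = -tens h u := by
  refine Eq.trans ((Submodule.Quotient.eq _).2 (Submodule.subset_span (.inr ⟨h, i, u, hi', rfl⟩)))
    ?_
  rw [TensorProduct.tmul_neg]
  rfl

variable (n θ) in
/-- The map `u ↦ 1 ⊗ u`. -/
noncomputable def oneTens : V θ →ₗ[K] Induced n θ where
  toFun u := tens 1 u
  map_add' u u' := by
    unfold tens
    rw [TensorProduct.tmul_add, Submodule.Quotient.mk_add]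
  map_smul' c u := by
    unfold tens
    rw [TensorProduct.tmul_smul, Submodule.Quotient.mk_smul]
    rfl

/-- The maps out of the induced module. -/
theorem exists_induced_lift {B : Type*} [AddCommGroup B] [Module K B]
    (σ : Hecke n →ₐ[K] Module.End K B) (ι : V θ →ₗ[K] B)
    (h1 : ∀ (i : Fin (n - 1)) (j : Fin (θ.card - 1)), (i : ℕ) = j →
      ∀ u, σ (Hecke.T i) (ι u) = ι (seminormalOp θ j u))
    (h2 : ∀ i : Fin (n - 1), θ.card ≤ i → ∀ u, σ (Hecke.T i) (ι u) = -ι u) :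
    ∃ F : Induced n θ →ₗ[K] B, ∀ h u, F (tens h u) = σ h (ι u) := by
  let F₀ : Hecke n ⊗[K] V θ →ₗ[K] B := TensorProduct.lift
    (LinearMap.mk₂ K (fun h u => σ h (ι u)) (fun _ _ _ => by rw [map_add, LinearMap.add_apply])
      (fun _ _ _ => by rw [map_smul, LinearMap.smul_apply])
      (fun _ _ _ => by rw [map_add, map_add]) (fun _ _ _ => by rw [map_smul, map_smul]))
  have hF₀ : ∀ h u, F₀ (h ⊗ₜ u) = σ h (ι u) := fun h u => rfl
  have hsmul : ∀ (h : Hecke n) y, F₀ (h • y) = σ h (F₀ y) := by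
    intro h y
    induction y using TensorProduct.induction_on with
    | zero => rw [smul_zero, map_zero, map_zero]
    | tmul h' u =>
      rw [TensorProduct.smul_tmul', smul_eq_mul, hF₀, hF₀, map_mul, Module.End.mul_apply]
    | add y z hy hz => rw [smul_add, map_add, map_add, map_add, hy, hz]
  have hker : (balancing n θ).restrictScalars K ≤ LinearMap.ker F₀ := by
    intro y hy
    rw [Submodule.restrictScalars_mem] at hy
    rw [LinearMap.mem_ker]
    induction hy using Submodule.span_induction with
    | mem y hy =>
      rcases hy with ⟨h, i, j, u, hij, rfl⟩ | ⟨h, i, u, hi', rfl⟩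
      · rw [map_sub, hF₀, hF₀, map_mul, Module.End.mul_apply, h1 i j hij, sub_self]
      · rw [map_sub, hF₀, hF₀, map_mul, Module.End.mul_apply, h2 i hi', map_neg ι, sub_self]
    | zero => exact map_zero _
    | add y z _ _ hy hz => rw [map_add, hy, hz, add_zero]
    | smul h y _ hy => rw [hsmul, hy, map_zero]
  exact ⟨(Submodule.liftQ _ F₀ hker) ∘ₗ
    (Submodule.Quotient.restrictScalarsEquiv K (balancing n θ)).symm.toLinearMap, fun h u => rfl⟩

theorem induced_hom_ext {B : Type*} [AddCommGroup B] [Module K B] {F G : Induced n θ →ₗ[K] B}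
    (h : ∀ a u, F (tens a u) = G (tens a u)) : F = G := by
  refine LinearMap.ext fun y => ?_
  obtain ⟨y, rfl⟩ := Submodule.Quotient.mk_surjective _ y
  induction y using TensorProduct.induction_on with
  | zero => rw [Submodule.Quotient.mk_zero, map_zero, map_zero]
  | tmul a u => exact h a u
  | add y z hy hz => rw [Submodule.Quotient.mk_add, map_add, map_add, hy, hz]

/-- An endomorphism of a seminormal module that fixes the tableaux in which the column comes last is
the identity. -/
theorem eq_id_of_intertwines [NeZero n] (hθ : θ.card ≤ n)
    {φ : BiModule n (columnShape n θ) →ₗ[K] BiModule n (columnShape n θ)}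
    (hφ : ∀ i y, φ (fillT (IsStandardBi n (columnShape n θ)) i y) =
      fillT (IsStandardBi n (columnShape n θ)) i (φ y))
    (hb : ∀ T : StandardTableau θ,
      φ (vBi ⟨baseFilling n T.1, (isStandardBi_baseFilling hθ).2 T.2⟩) =
        vBi ⟨baseFilling n T.1, (isStandardBi_baseFilling hθ).2 T.2⟩) : φ = LinearMap.id := by
  obtain ⟨T⟩ := exists_standardTableau θ
  have h0 := (isStandardBi_baseFilling hθ).2 T.2
  refine Finsupp.lhom_ext' fun f => LinearMap.ext_ring ?_
  have h1 := (admissible_standard θ).single_mem_of_shape (S := LinearMap.eqLocus φ LinearMap.id)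
    (fun i x hx => by
      rw [LinearMap.mem_eqLocus, LinearMap.id_apply] at hx ⊢
      rw [hφ, hx]) (f := ⟨_, h0⟩) (g := f) h0 f.2 (hb T)
  exact h1

/-- Siegel's module is the seminormal module of shape `(θ, 1^{n-k})`. -/
theorem exists_inducedEquiv [NeZero n] (hθ : θ.card ≤ n) :
    ∃ E : Induced n θ ≃ₗ[K] BiModule n (columnShape n θ),
      (∀ i y, E (Hecke.T i • y) = fillT (IsStandardBi n (columnShape n θ)) i (E y)) ∧
      ∀ T : StandardTableau θ, E (tens 1 (v T)) =
        vBi ⟨baseFilling n T.1, (isStandardBi_baseFilling hθ).2 T.2⟩ := by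
  have hP := admissible_standard (n := n) θ
  obtain ⟨σ, hσ⟩ := exists_heckeLift hP.isHecke
  have hbase : ∀ T : StandardTableau θ, baseMap (IsStandardBi n (columnShape n θ)) θ (v T) =
      vBi ⟨baseFilling n T.1, (isStandardBi_baseFilling hθ).2 T.2⟩ := fun T => by
    rw [baseMap_v, vecP_of ((isStandardBi_baseFilling hθ).2 T.2)]
    rfl
  have hsign : ∀ i : Fin (n - 1), θ.card ≤ i → ∀ u,
      fillT (IsStandardBi n (columnShape n θ)) i (baseMap _ θ u) = -baseMap _ θ u := by
    intro i hi' u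
    suffices h : fillT (IsStandardBi n (columnShape n θ)) i ∘ₗ baseMap _ θ = -baseMap _ θ from
      LinearMap.congr_fun h u
    refine Finsupp.lhom_ext' fun T => LinearMap.ext_ring ?_
    change fillT _ i (baseMap _ θ (v T)) = -baseMap _ θ (v T)
    have hs := (isStandardBi_baseFilling hθ).2 T.2
    have e1 : (baseFilling n T.1 (lo i)).1 = 1 := by
      rw [baseFilling, dif_neg (by rw [coe_lo]; omega)]
    have e2 : (baseFilling n T.1 (hi i)).1 = 1 := by
      rw [baseFilling, dif_neg (by rw [coe_hi]; omega)]
    rw [baseMap_v, fillT_vecP hs, diag_one_one e1 e2, off_eq_zero (e1.trans e2.symm)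
      (.inr (by rw [hs.snd_eq_zero e1, hs.snd_eq_zero e2])), zero_smul, add_zero, neg_one_smul]
  -- `F` comes from the universal property of the tensor product, `G` below from that of the
  -- seminormal module. They are inverse to each other because both composites fix generating
  -- vectors.
  obtain ⟨F, hF⟩ := exists_induced_lift σ (baseMap (IsStandardBi n (columnShape n θ)) θ)
    (fun i j hij u => by rw [hσ]; exact baseMap_intertwines (fun _ h => h) hθ hij u)
    (fun i hi' u => by rw [hσ]; exact hsign i hi' u)
  let L : Hecke n →ₐ[K] Module.End K (Induced n θ) := Algebra.lsmul K K (Induced n θ)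
  have hL : ∀ h y, L h y = h • y := fun _ _ => rfl
  obtain ⟨G, hG, hG'⟩ := exists_intertwiner_first (Hecke.isHecke.map L) hθ (oneTens n θ)
    (fun i j hij u => by
      have := tens_mul_T 1 hij u
      rwa [one_mul, ← mul_one (Hecke.T i), ← smul_tens] at this)
    (fun i hi' u => by
      have := tens_mul_T_of_le 1 hi' u
      rwa [one_mul, ← mul_one (Hecke.T i), ← smul_tens] at this)
  have hFT : ∀ i y, F (Hecke.T i • y) = fillT (IsStandardBi n (columnShape n θ)) i (F y) := by
    intro i
    suffices h : F ∘ₗ L (Hecke.T i) = fillT (IsStandardBi n (columnShape n θ)) i ∘ₗ F from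
      LinearMap.congr_fun h
    refine induced_hom_ext fun a u => ?_
    rw [LinearMap.comp_apply, LinearMap.comp_apply, hL, smul_tens, hF, hF, map_mul, hσ]
    rfl
  have hGσ : ∀ h y, G (σ h y) = h • G y := hecke_intertwines (β := L) fun i m => by
    rw [hσ]
    exact hG i m
  have hGb : ∀ u, G (baseMap _ θ u) = tens 1 u := by
    suffices h : G ∘ₗ baseMap _ θ = oneTens n θ from LinearMap.congr_fun h
    refine Finsupp.lhom_ext' fun T => LinearMap.ext_ring ?_
    exact (congrArg G (hbase T)).trans (hG' T)
  have hGF : G ∘ₗ F = LinearMap.id := by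
    refine induced_hom_ext fun a u => ?_
    rw [LinearMap.comp_apply, hF, hGσ, hGb, smul_tens, mul_one]
    rfl
  have hF1 : ∀ T : StandardTableau θ, F (tens 1 (v T)) =
      vBi ⟨baseFilling n T.1, (isStandardBi_baseFilling hθ).2 T.2⟩ := fun T => by
    rw [hF, map_one, hbase]
    rfl
  have hFG : F ∘ₗ G = LinearMap.id := by
    refine eq_id_of_intertwines hθ (fun i y => ?_) fun T => ?_
    · rw [LinearMap.comp_apply, LinearMap.comp_apply, hG, hL, hFT]
    · rw [LinearMap.comp_apply, hG']
      exact hF1 T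
  exact ⟨LinearEquiv.ofLinearMap F G hFG hGF, hFT, hF1⟩

end Induced

/-! ### Reduced words -/

section Words

variable {n : ℕ}

theorem permLength_le (l : List (Fin (n - 1))) : permLength (l.map simple).prod ≤ l.length :=
  Nat.sInf_le ⟨l, rfl, rfl⟩

/-- A word can be shortened by a letter to represent the product with a transposition that is an
inversion. -/
theorem exists_shorter_word (l : List (Fin (n - 1))) {a b : Fin n} (hab : a < b)
    (h : (l.map simple).prod.symm b < (l.map simple).prod.symm a) :
    ∃ l' : List (Fin (n - 1)), l'.length + 1 = l.length ∧
      (l'.map simple).prod = Equiv.swap a b * (l.map simple).prod := by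
  induction l generalizing a b with
  | nil => exact absurd h (not_lt.2 hab.le)
  | cons j l ih =>
    rw [List.map_cons, List.prod_cons] at h ⊢
    set w := (l.map simple).prod
    by_cases hj : simple j a < simple j b
    · obtain ⟨l', h1, h2⟩ := ih hj (by
        have h3 : ∀ c, (simple j * w).symm c = w.symm (simple j c) := fun c => rfl
        rwa [h3, h3] at h)
      refine ⟨j :: l', by simp [h1], ?_⟩
      rw [List.map_cons, List.prod_cons, h2, ← mul_assoc, ← mul_assoc]
      congr 1
      rw [Equiv.mul_swap_eq_swap_mul, simple_simple, simple_simple]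
    -- The first letter reverses the order of `a` and `b` only if it is the transposition of this
    -- pair; then it is the letter to delete.
    · have h3 : a = lo j ∧ b = hi j := by
        have h4 := coe_simple j a
        have h5 := coe_simple j b
        rw [Fin.lt_def] at hj hab
        rw [Fin.ext_iff, Fin.ext_iff, coe_lo, coe_hi]
        split_ifs at h4 h5 <;> omega
      refine ⟨l, by simp, ?_⟩
      rw [h3.1, h3.2, ← mul_assoc]
      change w = simple j * simple j * w
      rw [simple_mul_self, one_mul]

theorem permLength_simple_mul_le (i : Fin (n - 1)) (w : Equiv.Perm (Fin n)) :
    permLength (simple i * w) ≤ permLength w + 1 := by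
  by_cases h : ∃ l : List (Fin (n - 1)), (l.map simple).prod = w
  · obtain ⟨l, hl⟩ := h
    obtain ⟨l', h1, h2⟩ := Nat.sInf_mem (s := {r | ∃ l : List (Fin (n - 1)), l.length = r ∧
      (l.map simple).prod = w}) ⟨_, l, rfl, hl⟩
    have h3 := permLength_le (i :: l')
    rwa [List.map_cons, List.prod_cons, h2, List.length_cons, h1] at h3
  -- If `w` had no word, neither would `s_i w`, and its length would be the infimum `0` of the empty
  -- set. So it is not necessary to know that the simple transpositions generate.
  · have h1 : {r | ∃ l : List (Fin (n - 1)), l.length = r ∧ (l.map simple).prod = simple i * w} =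
        ∅ := by
      refine Set.eq_empty_of_forall_notMem ?_
      rintro r ⟨l, -, hl⟩
      refine h ⟨i :: l, ?_⟩
      rw [List.map_cons, List.prod_cons, hl, ← mul_assoc, simple_mul_self, one_mul]
    rw [permLength, h1, Nat.sInf_empty]
    exact Nat.zero_le _

/-- Removing the first letter of a reduced word of a minimal coset representative. -/
theorem IsReducedWord.of_cons {i : Fin (n - 1)} {l : List (Fin (n - 1))} {w : Equiv.Perm (Fin n)}
    {k : ℕ} (h : IsReducedWord (i :: l) w) (hw : IsMinimalRep k w) :
    ∃ w', w = simple i * w' ∧ IsReducedWord l w' ∧ IsMinimalRep k w' ∧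
      (w'.symm (lo i) : ℕ) < k ∧ k ≤ (w'.symm (hi i) : ℕ) := by
  obtain ⟨rfl, h2⟩ := h
  rw [List.map_cons, List.prod_cons] at hw h2
  set w' := (l.map simple).prod with hw'
  rw [List.length_cons] at h2
  have h3 := permLength_simple_mul_le i w'
  have h4 : permLength w' ≤ l.length := permLength_le l
  refine ⟨w', by rw [List.map_cons, List.prod_cons], ⟨rfl, by omega⟩, fun u hu => ?_, ?_⟩
  · have h5 := hw u hu
    rw [mul_assoc] at h5
    have := permLength_simple_mul_le i (w' * u)
    omega
  -- Otherwise the exchange property would give a word for `s_i w'` shorter than `w'`, against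
  -- reducedness.
  · have hlt : ¬w'.symm (hi i) < w'.symm (lo i) := by
      intro h
      obtain ⟨l', h5, h6⟩ := exists_shorter_word l (lo_lt_hi i) h
      have h7 := permLength_le l'
      rw [h6] at h7
      change permLength (simple i * w') ≤ _ at h7
      omega
    have hconj : w' * Equiv.swap (w'.symm (lo i)) (w'.symm (hi i)) = simple i * w' := by
      rw [Equiv.mul_swap_eq_swap_mul, Equiv.apply_symm_apply, Equiv.apply_symm_apply]
      rfl
    -- If both places were in one block, `s_i w'` would be `w'` times a transposition in `S_k ×
    -- S_{n-k}`, and the shorter `w'` would be in the same coset.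
    have hblock : ¬((w'.symm (lo i) : ℕ) < k ↔ (w'.symm (hi i) : ℕ) < k) := by
      intro h
      have h5 := hw (Equiv.swap (w'.symm (lo i)) (w'.symm (hi i))) fun a => by
        rw [Equiv.swap_apply_def]
        split_ifs with h6 h7
        · rw [h6, h]
        · rw [h7, h]
        · rfl
      rw [← hconj, mul_assoc, Equiv.swap_mul_self, mul_one] at h5
      rw [hconj] at h5
      omega
    rw [Fin.lt_def] at hlt
    omega

/-- The image of the standard basis of the induced module. -/
theorem map_basisVec [NeZero n] {θ : YoungDiagram} (hθ : θ.card ≤ n)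
    {E : Induced n θ ≃ₗ[K] BiModule n (columnShape n θ)}
    (hE : ∀ i y, E (Hecke.T i • y) = fillT (IsStandardBi n (columnShape n θ)) i (E y))
    (hE1 : ∀ T : StandardTableau θ, E (tens 1 (v T)) =
      vBi ⟨baseFilling n T.1, (isStandardBi_baseFilling hθ).2 T.2⟩)
    {w : Equiv.Perm (Fin n)} {l : List (Fin (n - 1))} (T : StandardTableau θ)
    (hw : IsMinimalRep θ.card w) (hl : IsReducedWord l w) :
    ∃ h : IsStandardBi n (columnShape n θ) (imageFilling w T),
      E (basisVec l T) = vBi ⟨imageFilling w T, h⟩ := by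
  induction l generalizing w with
  | nil =>
    obtain rfl : 1 = w := hl.1
    exact ⟨(isStandardBi_baseFilling hθ).2 T.2, hE1 T⟩
  | cons i l ih =>
    obtain ⟨w', rfl, hl', hw', h1, h2⟩ := hl.of_cons hw
    obtain ⟨h, hEl⟩ := ih hw' hl'
    -- The smaller of the two numbers is in `θ` and the larger in the column, which is the case
    -- where `T_i` simply permutes the basis.
    have e1 : (imageFilling w' T (lo i)).1 = 0 := by rw [imageFilling, dif_pos h1]
    have e2 : (imageFilling w' T (hi i)).1 = 1 := by rw [imageFilling, dif_neg (not_lt.2 h2)]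
    have h3 := standard_comp_of_ne _ h i (by rw [e1, e2]; decide)
    refine ⟨h3, ?_⟩
    have h4 : basisVec (i :: l) T = Hecke.T i • basisVec l T := by
      rw [basisVec, basisVec, smul_tens, List.map_cons, List.prod_cons]
    rw [h4, hE, hEl, vBi, fillT_single, diag_zero_one e1 e2, off_zero_one e1 e2, zero_smul, zero_add,
      one_smul, vecP_of h3]
    rfl

end Words

/-! ### The irreducible modules of the mirabolic Hecke algebra -/

section Simple

variable {n : ℕ} {A M : Type} [Ring A] [Algebra K A] [AddCommGroup M] [Module K M]

theorem ModuleOf.of_smul (α : A →ₐ[K] Module.End K M) (c : K) (y : M) :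
    ModuleOf.of α (c • y) = algebraMap K A c • ModuleOf.of α y := by
  rw [ModuleOf.smul_of, AlgHom.commutes]
  rfl

variable [NeZero n] {θ : YoungDiagram}

/-- `α` is the action of `R_n` on the seminormal module of shape `(θ, 1^{n-k})`. -/
structure IsSeminormalAction
    (α : MirabolicHecke n →ₐ[K] Module.End K (BiModule n (columnShape n θ))) : Prop where
  T₀_act : ∀ y, α (MirabolicHecke.T₀ n) y = q • fillX (IsStandardBi n (columnShape n θ)) y - y
  T_act : ∀ i, α (MirabolicHecke.T i) = fillT (IsStandardBi n (columnShape n θ)) i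

variable {α : MirabolicHecke n →ₐ[K] Module.End K (BiModule n (columnShape n θ))}

theorem IsSeminormalAction.fillX_eq (h : IsSeminormalAction α)
    (y : BiModule n (columnShape n θ)) : fillX (IsStandardBi n (columnShape n θ)) y =
      α ((q⁻¹ : K) • (MirabolicHecke.T₀ n + 1)) y := by
  rw [map_smul α, map_add, map_one, LinearMap.smul_apply, LinearMap.add_apply, h.T₀_act,
    Module.End.one_apply, sub_add_cancel, smul_smul, inv_mul_cancel₀ q_ne_zero, one_smul]

theorem IsSeminormalAction.isSimpleModule (hθ : θ.card ≤ n) (h : IsSeminormalAction α) :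
    IsSimpleModule (MirabolicHecke n) (ModuleOf α) := by
  obtain ⟨T⟩ := exists_standardTableau θ
  have : Nontrivial (ModuleOf α) := by
    refine ⟨⟨ModuleOf.of α (vBi ⟨_, (isStandardBi_baseFilling hθ).2 T.2⟩), 0, fun h0 => ?_⟩⟩
    exact Finsupp.single_ne_zero.2 (one_ne_zero (α := K)) h0
  rw [isSimpleModule_iff]
  refine { eq_bot_or_eq_top := fun S => ?_ }
  let S' : Submodule K (BiModule n (columnShape n θ)) :=
    { carrier := {y | ModuleOf.of α y ∈ S}
      add_mem' := fun hy hz => S.add_mem hy hz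
      zero_mem' := S.zero_mem
      smul_mem' := fun c y hy => by
        rw [Set.mem_ofPred_eq, ModuleOf.of_smul]
        exact S.smul_mem _ hy }
  have hS' : ∀ a, ∀ y ∈ S', α a y ∈ S' := fun a y hy => S.smul_mem a hy
  by_cases hbot : S' = ⊥
  · left
    rw [eq_bot_iff]
    intro y hy
    have h1 : (ModuleOf.of α).symm y ∈ S' := hy
    rw [hbot] at h1
    exact h1
  · right
    have htop := eq_top_of_stable (S := S') (fun y hy => by rw [h.fillX_eq]; exact hS' _ y hy)
      (fun i y hy => by rw [← h.T_act]; exact hS' _ y hy) hbot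
    rw [eq_top_iff]
    intro y _
    have h1 : (ModuleOf.of α).symm y ∈ S' := htop ▸ Submodule.mem_top
    exact h1

theorem IsSeminormalAction.shape_eq {θ' : YoungDiagram} (hθ : θ.card ≤ n)
    (h : IsSeminormalAction α)
    {α' : MirabolicHecke n →ₐ[K] Module.End K (BiModule n (columnShape n θ'))}
    (h' : IsSeminormalAction α') (φ : ModuleOf α ≃ₗ[MirabolicHecke n] ModuleOf α') : θ = θ' := by
  obtain ⟨T⟩ := exists_standardTableau θ
  let G : BiModule n (columnShape n θ) →ₗ[K] BiModule n (columnShape n θ') :=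
    { toFun := fun y => (ModuleOf.of α').symm (φ (ModuleOf.of α y))
      map_add' := fun y z => by rw [map_add, map_add, map_add]
      map_smul' := fun c y => by
        rw [ModuleOf.of_smul, map_smul, AddEquiv.symm_apply_eq, RingHom.id_apply,
          ModuleOf.of_smul, AddEquiv.apply_symm_apply] }
  have hG : ∀ a y, G (α a y) = α' a (G y) := fun a y => φ.map_smul a (ModuleOf.of α y)
  refine shape_eq_of_intertwine (φ := G) ⟨_, (isStandardBi_baseFilling hθ).2 T.2⟩
    (fun y => by rw [h.fillX_eq, h'.fillX_eq, hG])
    (fun i y => by rw [← h.T_act, ← h'.T_act, hG]) fun h0 => ?_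
  have h1 : φ (ModuleOf.of α (Finsupp.single ⟨_, (isStandardBi_baseFilling hθ).2 T.2⟩ 1)) = 0 := h0
  rw [LinearEquiv.map_eq_zero_iff] at h1
  exact Finsupp.single_ne_zero.2 (one_ne_zero (α := K)) h1

/-- The seminormal modules exhaust the irreducible modules. -/
theorem exists_equiv_seminormal (N : Type*) [AddCommGroup N] [Module (MirabolicHecke n) N]
    [IsSimpleModule (MirabolicHecke n) N] : ∃ θ : YoungDiagram, θ.card ≤ n ∧
      ∀ α : MirabolicHecke n →ₐ[K] Module.End K (BiModule n (columnShape n θ)),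
        IsSeminormalAction α → Nonempty (N ≃ₗ[MirabolicHecke n] ModuleOf α) := by
  let _ : Module K N := Module.compHom N (algebraMap K (MirabolicHecke n))
  have hK : ∀ (c : K) (y : N), c • y = algebraMap K (MirabolicHecke n) c • y := fun _ _ => rfl
  have : IsScalarTower K (MirabolicHecke n) N := ⟨fun c a y => by
    rw [hK, smul_smul, Algebra.smul_def]⟩
  have : Nontrivial N := IsSimpleModule.nontrivial (MirabolicHecke n) N
  let L : MirabolicHecke n →ₐ[K] Module.End K N := Algebra.lsmul K K N
  obtain ⟨θ, hθ, G, hT, hX, hG⟩ :=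
    exists_seminormal_biModule_map ((MirabolicHecke.isMirabolic (n := n)).isCyclo.map L)
  refine ⟨θ, hθ, fun α hα => ?_⟩
  have hGα : ∀ a y, G (α a y) = L a (G y) := by
    refine mirabolic_intertwines (fun y => ?_) fun i y => by rw [hα.T_act, hT]
    rw [hα.T₀_act, map_sub, map_smul, hX, map_smul L,
      LinearMap.smul_apply, smul_smul, mul_inv_cancel₀ q_ne_zero, one_smul, map_add, map_one,
      LinearMap.add_apply, Module.End.one_apply, add_sub_cancel_right]
  let G' : ModuleOf α →ₗ[MirabolicHecke n] N :=
    { toFun := fun y => G ((ModuleOf.of α).symm y)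
      map_add' := fun y z => by rw [map_add, map_add]
      map_smul' := fun a y => hGα a _ }
  have hG' : G' ≠ 0 := fun h0 => hG (LinearMap.ext fun y => LinearMap.congr_fun h0 (ModuleOf.of α y))
  have := hα.isSimpleModule hθ
  -- Schur's lemma: a non-zero map between simple modules is bijective.
  exact ⟨(LinearEquiv.ofBijective G' (LinearMap.bijective_of_ne_zero hG')).symm⟩

end Simple

end Mirabolic

/-! ### The main theorem -/

open Mirabolic

theorem mainTheorem3 (n : ℕ) [NeZero n] :
    -- the algebra isomorphism `R_n ≃ H_n(1,0) / I`
    ∃ Φ : MirabolicHecke n ≃ₐ[K] CyclotomicQuotient n,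
      Φ (MirabolicHecke.T₀ n) = q • toQuotient n (CyclotomicHecke.X n [1, 0]) - 1 ∧
      (∀ i, Φ (MirabolicHecke.T i) = toQuotient n (CyclotomicHecke.T i)) ∧
    -- the `H_k`-modules `V^θ`
    (∀ θ : YoungDiagram, ∃ σ : Hecke θ.card →ₐ[K] Module.End K (V θ),
      ∀ i, σ (Hecke.T i) = seminormalOp θ i) ∧
    -- the `R_n`-modules `M_n^{θ,k}` and the `H_n(1,0) / I`-modules `M^{(θ,1^{n-k})}`
    ∃ (ρ : ∀ θ : YoungDiagram, θ.card ≤ n → MirabolicHecke n →ₐ[K] Module.End K (Induced n θ))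
      (π : ∀ θ : YoungDiagram, θ.card ≤ n →
        CyclotomicQuotient n →ₐ[K] Module.End K (BiModule n (columnShape n θ))),
      (∀ θ hθ, IsSiegelAction (ρ θ hθ)) ∧
      (∀ θ hθ, IsArikiKoikeAction ((π θ hθ).comp (toQuotient n))) ∧
      -- they are isomorphic, by the explicit map
      (∀ θ hθ, ∃ f : ModuleOf (ρ θ hθ) ≃ₗ[MirabolicHecke n]
          ModuleOf ((π θ hθ).comp Φ.toAlgHom),
        ∀ (w : Equiv.Perm (Fin n)) (l : List (Fin (n - 1))) (T : StandardTableau θ),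
          IsMinimalRep θ.card w → IsReducedWord l w →
          ∃ h : IsStandardBi n (columnShape n θ) (imageFilling w T),
            f (ModuleOf.of _ (basisVec l T)) = ModuleOf.of _ (vBi ⟨imageFilling w T, h⟩)) ∧
      -- the modules `M_n^{θ,k}` are irreducible, pairwise non-isomorphic, and exhaust the
      -- irreducible `R_n`-modules
      (∀ θ hθ, IsSimpleModule (MirabolicHecke n) (ModuleOf (ρ θ hθ))) ∧
      (∀ θ hθ θ' hθ', Nonempty (ModuleOf (ρ θ hθ) ≃ₗ[MirabolicHecke n] ModuleOf (ρ θ' hθ')) →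
        θ = θ') ∧
      (∀ (N : Type*) [AddCommGroup N] [Module (MirabolicHecke n) N],
        IsSimpleModule (MirabolicHecke n) N →
        ∃ θ hθ, Nonempty (N ≃ₗ[MirabolicHecke n] ModuleOf (ρ θ hθ))) := by
  obtain ⟨Φ, hΦ₀, hΦT⟩ := exists_mirabolicEquiv n
  have hE := fun (θ : YoungDiagram) (hθ : θ.card ≤ n) => exists_inducedEquiv hθ
  choose E hET hE1 using hE
  have hπ := fun θ : YoungDiagram => exists_quotLift ((admissible_standard (n := n) θ).isCyclo)
  choose π hπX hπT using hπ
  -- The action on Siegel's module is transported along `E`. His formula for `T_0` then follows,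
  -- since `qX - 1` acts by `q - 1` or `-1` according to the component containing `1`.
  let ρ : ∀ θ : YoungDiagram, θ.card ≤ n → MirabolicHecke n →ₐ[K] Module.End K (Induced n θ) :=
    fun θ hθ => ((E θ hθ).symm.conjAlgEquiv K).toAlgHom.comp ((π θ).comp Φ.toAlgHom)
  have hρ : ∀ θ hθ a y, ρ θ hθ a y = (E θ hθ).symm (π θ (Φ a) (E θ hθ y)) := fun _ _ _ _ => rfl
  have hα : ∀ θ, IsSeminormalAction ((π θ).comp Φ.toAlgHom) := fun θ =>
    ⟨fun y => by
      change π θ (Φ (MirabolicHecke.T₀ n)) y = _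
      rw [hΦ₀, map_sub, map_smul, map_one, hπX]
      rfl,
     fun i => by
      change π θ (Φ (MirabolicHecke.T i)) = _
      rw [hΦT, hπT]⟩
  have hmap : ∀ θ hθ (w : Equiv.Perm (Fin n)) (l : List (Fin (n - 1))) (T : StandardTableau θ),
      IsMinimalRep θ.card w → IsReducedWord l w →
      ∃ h : IsStandardBi n (columnShape n θ) (imageFilling w T),
        E θ hθ (basisVec l T) = vBi ⟨imageFilling w T, h⟩ := fun θ hθ w l T hw hl =>
    map_basisVec hθ (hET θ hθ) (hE1 θ hθ) T hw hl
  let f : ∀ θ hθ, ModuleOf (ρ θ hθ) ≃ₗ[MirabolicHecke n] ModuleOf ((π θ).comp Φ.toAlgHom) :=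
    fun θ hθ =>
      { ((ModuleOf.of (ρ θ hθ)).symm.trans (E θ hθ).toAddEquiv).trans (ModuleOf.of _) with
        map_smul' := fun a y => (E θ hθ).apply_symm_apply _ }
  refine ⟨Φ, hΦ₀, hΦT, fun θ => exists_heckeLift (isHecke_seminormalOp θ), ρ, fun θ _ => π θ,
    fun θ hθ => ⟨fun i y => ?_, fun w l T hw hl => ?_⟩, fun θ hθ => ⟨fun U => ?_, fun i U => ?_⟩,
    fun θ hθ => ⟨f θ hθ, hmap θ hθ⟩, fun θ hθ => ?_, fun θ hθ θ' hθ' => ?_, fun N _ _ _ => ?_⟩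
  · rw [hρ, hΦT, hπT, ← hET, LinearEquiv.symm_apply_apply]
  · obtain ⟨h, hw'⟩ := hmap θ hθ w l T hw hl
    have h1 := (hα θ).T₀_act (vBi ⟨imageFilling w T, h⟩)
    rw [hρ, LinearEquiv.symm_apply_eq, hw']
    refine h1.trans ?_
    rw [vBi, fillX_single]
    have h2 : (imageFilling w T 0).1 = 0 ↔ (w.symm 0 : ℕ) < θ.card := by
      unfold imageFilling
      split_ifs with h3 <;> simp [h3]
    simp only [h2]
    split_ifs
    · rw [map_smul, hw', sub_smul, one_smul]
      rfl
    · rw [smul_zero, zero_sub, map_neg, hw']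
      rfl
  · change π θ (quotX n) (vBi U) = _
    rw [hπX]
    exact fillX_single U
  · change π θ (quotT i) (vBi U) = _
    rw [hπT]
    exact fillT_formula i U
  · have := (hα θ).isSimpleModule hθ
    exact IsSimpleModule.congr (f θ hθ)
  · rintro ⟨φ⟩
    exact (hα θ).shape_eq hθ (hα θ') (((f θ hθ).symm.trans φ).trans (f θ' hθ'))
  · obtain ⟨θ, hθ, h⟩ := exists_equiv_seminormal (n := n) N
    obtain ⟨φ⟩ := h _ (hα θ)
    exact ⟨θ, hθ, ⟨φ.trans (f θ hθ).symm⟩⟩
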